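/- Let $\Bbbk$ be a field of characteristic $0$ and $n\ge 0$. Let $W_n^{\mathsf{pol}}$ be the Lie algebra of polynomial vector fields $\sum_{j=1}^n f_j\partial_j$, $f_j\in\Bbbk[x_1,\dots,x_n]$, and for $d\ge 1$ let $\mathsf L_d(n)\subset W_n^{\mathsf{pol}}$ be the subalgebra of those fields all of whose coefficients $f_j$ contain only monomials of degree at least $d+1$. Let $\mathsf L_1^{(x_s)}$ be the span of the fields $x_s^{k+1}\partial_s$, $k\ge 1$, and $\mathsf L_1^{\oplus n}:=\mathsf L_1^{(x_1)}\oplus\dots\oplus \mathsf L_1^{(x_n)}$. For $d\ge1$ this Lie algebra embeds into $\mathsf L_d(n)$ by $\imath_d: x_s^{k+1}\partial_s\mapsto \frac1d x_s^{dk+1}\partial_s$; for $d=1$ this is the inclusion. For a finite-dimensional irreducible $\mathfrak{gl}_n$-module $V_\lambda$ with highest weight $\lambda\in\Bbbk^n$ (for example a dominant $\lambda\in\mathbb Z^n$), let $\mathcal T_\lambda=\Bbbk[x_1,\dots,x_n]\otimes V_\lambda$ be the $W_n^{\mathsf{pol}}$-module of polynomial tensor fields, on which $$\Big(\sum_j f_j\partial_j\Big)\cdot(g\otimes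 v)=\sum_j f_j\,\partial_j g\otimes v+\sum_{i,j}(\partial_i f_j)\,g\otimes E_{ij}v ,$$ where $E_{ij}$ are the matrix units, corresponding to the linear fields $x_i\partial_j$. A module over a Lie algebra is called noetherian if its submodules satisfy the ascending chain condition. **Theorem.** Let $r\ge 0$ and let $\lambda_1,\dots,\lambda_r$ be highest weights of finite-dimensional irreducible $\mathfrak{gl}_n$-modules. Let $\mathcal T:=\mathcal T_{\lambda_1}\otimes_\Bbbk\dots\otimes_\Bbbk\mathcal T_{\lambda_r}$, with the Leibniz action of $W_n^{\mathsf{pol}}$. Then: 1. for every $d\ge1$, $\mathcal T$ is a noetherian $\mathsf L_1^{\oplus n}$-module through $\imath_d$; in particular ($d=1$) it is noetherian over the subalgebra $\mathsf L_1^{(x_1)}\oplus\dots\oplus \mathsf L_1^{(x_n)}$; 2. for every $d\ge1$, $\mathcal T$ is a noetherian $\mathsf L_d(n)$-module; 3. $\mathcal T$ is a noetherian $\mathfrak g$-module for every Lie subalgebra $\mathfrak g\subset W_n^{\mathsf{pol}}$ of finite codimension. -/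

import Mathlib

open scoped TensorProduct

-- Associative algebras (matrices, endomorphism rings) carry the commutator bracket.
attribute [local instance] LieRing.ofAssociativeRing

/-! ### Finite tensor products of Lie modules -/

namespace LieTensor

variable {R L ι : Type*} {M : ι → Type*} [CommRing R] [LieRing L] [LieAlgebra R L]
  [Fintype ι] [DecidableEq ι] [∀ i, AddCommGroup (M i)] [∀ i, Module R (M i)]
  [∀ i, LieRingModule L (M i)] [∀ i, LieModule R L (M i)]

/-- The operator `1 ⊗ ⋯ ⊗ f ⊗ ⋯ ⊗ 1`, with `f` acting on the `i`-th tensor factor. -/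
noncomputable def onFactor (i : ι) (f : M i →ₗ[R] M i) :
    Module.End R (PiTensorProduct R M) :=
  PiTensorProduct.map (Function.update (fun _ => LinearMap.id) i f)

theorem onFactor_tprod (i : ι) (f : M i →ₗ[R] M i) (m : ∀ i, M i) :
    onFactor i f (PiTensorProduct.tprod R m) =
      PiTensorProduct.tprod R (Function.update m i (f (m i))) := by
  rw [onFactor, PiTensorProduct.map_tprod]
  congr 1
  ext j
  rcases eq_or_ne j i with rfl | h
  · simp
  · simp [h]

/-- The Leibniz action of `x ∈ L` on `⨂ M i`:
`m₁ ⊗ ⋯ ⊗ m_r ↦ ∑ i, m₁ ⊗ ⋯ ⊗ ⁅x, mᵢ⁆ ⊗ ⋯ ⊗ m_r`. -/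
noncomputable def action (R : Type*) {L ι : Type*} (M : ι → Type*) [CommRing R] [LieRing L]
    [LieAlgebra R L] [Fintype ι] [DecidableEq ι] [∀ i, AddCommGroup (M i)]
    [∀ i, Module R (M i)] [∀ i, LieRingModule L (M i)] [∀ i, LieModule R L (M i)] (x : L) :
    Module.End R (PiTensorProduct R M) :=
  ∑ i, onFactor i (LieModule.toEnd R L (M i) x)

theorem action_tprod (x : L) (m : ∀ i, M i) :
    action R M x (PiTensorProduct.tprod R m) =
      ∑ i, PiTensorProduct.tprod R (Function.update m i ⁅x, m i⁆) := by
  simp [action, LinearMap.sum_apply, onFactor_tprod]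

theorem action_add (x y : L) : action R M (x + y) = action R M x + action R M y := by
  simp only [action, map_add, onFactor, PiTensorProduct.map_update_add, Finset.sum_add_distrib]

theorem action_smul (t : R) (x : L) : action R M (t • x) = t • action R M x := by
  simp only [action, map_smul, onFactor, PiTensorProduct.map_update_smul, Finset.smul_sum]

theorem action_action_tprod (x y : L) (m : ∀ i, M i) :
    action R M x (action R M y (PiTensorProduct.tprod R m)) =
      ∑ i, (PiTensorProduct.tprod R (Function.update m i ⁅x, ⁅y, m i⁆⁆) +
        ∑ j ∈ Finset.univ.erase i, PiTensorProduct.tprod R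
          (Function.update (Function.update m i ⁅y, m i⁆) j ⁅x, m j⁆)) := by
  rw [action_tprod, map_sum]
  refine Finset.sum_congr rfl fun i _ => ?_
  rw [action_tprod, ← Finset.add_sum_erase _ _ (Finset.mem_univ i)]
  congr 1
  · simp
  · refine Finset.sum_congr rfl fun j hj => ?_
    rw [Function.update_of_ne (Finset.ne_of_mem_erase hj)]

theorem action_lie (x y : L) :
    action R M ⁅x, y⁆ = action R M x * action R M y - action R M y * action R M x := by
  refine PiTensorProduct.ext (MultilinearMap.ext fun m => ?_)
  simp only [LinearMap.compMultilinearMap_apply, LinearMap.sub_apply, Module.End.mul_apply,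
    action_action_tprod, Finset.sum_add_distrib]
  have hswap : (∑ i, ∑ j ∈ Finset.univ.erase i, PiTensorProduct.tprod R
        (Function.update (Function.update m i ⁅y, m i⁆) j ⁅x, m j⁆)) =
      ∑ i, ∑ j ∈ Finset.univ.erase i, PiTensorProduct.tprod R
        (Function.update (Function.update m i ⁅x, m i⁆) j ⁅y, m j⁆) := by
    rw [Finset.sum_comm' (t' := Finset.univ) (s' := fun j => Finset.univ.erase j)
      (by intro a b; simp [eq_comm])]
    refine Finset.sum_congr rfl fun i _ => Finset.sum_congr rfl fun j hj => ?_
    rw [Function.update_comm (Finset.ne_of_mem_erase hj)]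
  rw [hswap, add_sub_add_right_eq_sub, action_tprod, ← Finset.sum_sub_distrib]
  refine Finset.sum_congr rfl fun i _ => ?_
  rw [lie_lie, MultilinearMap.map_update_sub]

/-- The tensor product `⨂ M i` of Lie modules is a Lie module through the Leibniz action. -/
noncomputable instance : LieRingModule L (PiTensorProduct R M) where
  bracket x t := action R M x t
  add_lie x y t := by
    change action R M (x + y) t = action R M x t + action R M y t
    rw [action_add, LinearMap.add_apply]
  lie_add x s t := map_add (action R M x) s t
  leibniz_lie x y t := by
    change action R M x (action R M y t) =
      action R M ⁅x, y⁆ t + action R M y (action R M x t)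
    rw [action_lie, LinearMap.sub_apply, Module.End.mul_apply, Module.End.mul_apply,
      sub_add_cancel]

noncomputable instance : LieModule R L (PiTensorProduct R M) where
  smul_lie c x t := by
    change action R M (c • x) t = c • action R M x t
    rw [action_smul, LinearMap.smul_apply]
  lie_smul c x t := map_smul (action R M x) c t

theorem lie_tprod (x : L) (m : ∀ i, M i) :
    ⁅x, PiTensorProduct.tprod R m⁆ =
      ∑ i, PiTensorProduct.tprod R (Function.update m i ⁅x, m i⁆) :=
  action_tprod x m

end LieTensor

/-- A Lie module is noetherian if its Lie submodules satisfy the ascending chain condition. -/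
def IsLieNoetherian (R L M : Type*) [CommRing R] [LieRing L] [LieAlgebra R L]
    [AddCommGroup M] [Module R M] [LieRingModule L M] : Prop :=
  WellFoundedGT (LieSubmodule R L M)

/-! ### Polynomial vector fields -/

namespace PolyField

open MvPolynomial

/-- The Lie algebra `W_n^pol` of polynomial vector fields `∑ fⱼ ∂ⱼ` on `𝕜ⁿ`, realised as the
derivations of `𝕜[x₁, …, xₙ]`; the coefficient `fⱼ` of `D` is `D (X j)`. -/
abbrev W (𝕜 : Type*) [Field 𝕜] (n : ℕ) : Type _ :=
  Derivation 𝕜 (MvPolynomial (Fin n) 𝕜) (MvPolynomial (Fin n) 𝕜)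

variable {𝕜 : Type*} [Field 𝕜] {n : ℕ}

theorem apply_eq_sum (D : W 𝕜 n) (f : MvPolynomial (Fin n) 𝕜) :
    D f = ∑ j, D (X j) * pderiv j f := by
  have h : D = ∑ j, D (X j) • (pderiv j : W 𝕜 n) := by
    refine MvPolynomial.derivation_ext fun i => ?_
    rw [← Derivation.coeFnAddMonoidHom_apply (∑ j, D (X j) • (pderiv j : W 𝕜 n)), map_sum,
      Finset.sum_apply]
    simp [pderiv_X, Pi.single_apply]
  conv_lhs => rw [h]
  rw [← Derivation.coeFnAddMonoidHom_apply (∑ j, D (X j) • (pderiv j : W 𝕜 n)), map_sum,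
    Finset.sum_apply]
  simp

theorem pderiv_mem_pow (j : Fin n) (a : ℕ) (f : MvPolynomial (Fin n) 𝕜)
    (hf : f ∈ idealOfVars (Fin n) 𝕜 ^ (a + 1)) : pderiv j f ∈ idealOfVars (Fin n) 𝕜 ^ a := by
  rw [mem_pow_idealOfVars_iff'] at hf ⊢
  intro m hm
  rw [coeff_pderiv, hf, zero_mul]
  simpa using hm

theorem apply_mem_pow {d a : ℕ} (D : W 𝕜 n)
    (hD : ∀ j, D (X j) ∈ idealOfVars (Fin n) 𝕜 ^ (d + 1)) (f : MvPolynomial (Fin n) 𝕜)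
    (hf : f ∈ idealOfVars (Fin n) 𝕜 ^ (a + 1)) :
    D f ∈ idealOfVars (Fin n) 𝕜 ^ (d + 1 + a) := by
  rw [apply_eq_sum, pow_add]
  exact Ideal.sum_mem _ fun j _ => Ideal.mul_mem_mul (hD j) (pderiv_mem_pow j a f hf)

/-- The graded subalgebra `L_d(n) ⊆ W_n^pol`: the polynomial vector fields `∑ fⱼ ∂ⱼ` whose
coefficients `fⱼ` have only monomials of degree at least `d + 1`. -/
noncomputable def L (𝕜 : Type*) [Field 𝕜] (n d : ℕ) : LieSubalgebra 𝕜 (W 𝕜 n) where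
  carrier := {D | ∀ j, ∀ m ∈ (D (X j)).support, d + 1 ≤ m.degree}
  zero_mem' := by simp
  add_mem' {D E} hD hE := by
    simp only [Set.mem_ofPred_eq, ← mem_pow_idealOfVars_iff] at *
    exact fun j => Ideal.add_mem _ (hD j) (hE j)
  smul_mem' c D hD := by
    simp only [Set.mem_ofPred_eq, ← mem_pow_idealOfVars_iff] at *
    exact fun j => Submodule.smul_of_tower_mem _ c (hD j)
  lie_mem' {D E} hD hE := by
    simp only [Set.mem_ofPred_eq, ← mem_pow_idealOfVars_iff] at *
    intro j
    rw [Derivation.commutator_apply]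
    exact Ideal.sub_mem _
      (Ideal.pow_le_pow_right (by omega) (apply_mem_pow D hD _ (hE j)))
      (Ideal.pow_le_pow_right (by omega) (apply_mem_pow E hE _ (hD j)))

/-- The vector field `x_s^(m+1) ∂_s`. -/
noncomputable def coordField (𝕜 : Type*) [Field 𝕜] {n : ℕ} (s : Fin n) (m : ℕ) : W 𝕜 n :=
  (X s ^ (m + 1) : MvPolynomial (Fin n) 𝕜) • pderiv s

theorem coordField_lie (s t : Fin n) (a b : ℕ) :
    ⁅coordField 𝕜 s a, coordField 𝕜 t b⁆ =
      if s = t then ((b : 𝕜) - a) • coordField 𝕜 s (a + b) else 0 := by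
  refine MvPolynomial.derivation_ext fun i => ?_
  rw [Derivation.commutator_apply]
  split_ifs with h
  · subst h
    rcases eq_or_ne i s with rfl | hi
    · simp [coordField, Derivation.leibniz_pow, smul_eq_C_mul]
      ring
    · simp [coordField, pderiv_X_of_ne hi]
  · have h' : t ≠ s := fun e => h e.symm
    rcases eq_or_ne i s with rfl | hi
    · simp [coordField, Derivation.leibniz_pow, pderiv_X_of_ne h, pderiv_X_of_ne h']
    · rcases eq_or_ne i t with rfl | hj
      · simp [coordField, Derivation.leibniz_pow, pderiv_X_of_ne h, pderiv_X_of_ne h']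
      · simp [coordField, pderiv_X_of_ne hi, pderiv_X_of_ne hj]

/-- The span of the fields `x_s^(dk+1) ∂_s` with `1 ≤ s ≤ n` and `k ≥ 1`. For `d = 1` this is
`L_1^{(x_1)} ⊕ ⋯ ⊕ L_1^{(x_n)}`; for `d ≥ 1` it is the image of that Lie algebra in `L_d(n)` under
the embedding `x_s^(k+1) ∂_s ↦ d⁻¹ x_s^(dk+1) ∂_s`. -/
noncomputable def coordL (𝕜 : Type*) [Field 𝕜] (n d : ℕ) : LieSubalgebra 𝕜 (W 𝕜 n) where
  toSubmodule :=
    Submodule.span 𝕜 {D | ∃ (s : Fin n) (k : ℕ), 1 ≤ k ∧ D = coordField 𝕜 s (d * k)}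
  lie_mem' {D E} hD hE := by
    simp only [AddSubsemigroup.mem_carrier, AddSubmonoid.mem_toSubsemigroup,
      Submodule.mem_toAddSubmonoid] at *
    induction hD using Submodule.span_induction with
    | zero => simp
    | add x y _ _ hx hy => rw [add_lie]; exact Submodule.add_mem _ hx hy
    | smul c x _ hx => rw [smul_lie]; exact Submodule.smul_mem _ c hx
    | mem x hx =>
      induction hE using Submodule.span_induction with
      | zero => simp
      | add y z _ _ hy hz => rw [lie_add]; exact Submodule.add_mem _ hy hz
      | smul c y _ hy => rw [lie_smul]; exact Submodule.smul_mem _ c hy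
      | mem y hy =>
        obtain ⟨s, k, hk, rfl⟩ := hx
        obtain ⟨t, l, hl, rfl⟩ := hy
        rw [coordField_lie]
        split_ifs with h
        · refine Submodule.smul_mem _ _ (Submodule.subset_span ⟨s, k + l, by omega, ?_⟩)
          rw [mul_add]
        · exact Submodule.zero_mem _

/-! ### Representations of `gl_n` and polynomial tensor fields -/

/-- The Lie algebra `gl_n`; the matrix unit `E_ij` corresponds to the vector field `xᵢ ∂ⱼ`. -/
abbrev gl (𝕜 : Type*) [Field 𝕜] (n : ℕ) : Type _ := Matrix (Fin n) (Fin n) 𝕜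

/-- `V` is a finite-dimensional irreducible `gl_n`-module with highest weight `wt`: it has a
nonzero vector that is killed by every `E_ij` with `i < j` and on which `E_ii` acts as `wt i`. -/
structure IsIrrepOfHighestWeight (𝕜 : Type*) [Field 𝕜] (n : ℕ) (V : Type*) [AddCommGroup V]
    [Module 𝕜 V] [LieRingModule (gl 𝕜 n) V] [LieModule 𝕜 (gl 𝕜 n) V] (wt : Fin n → 𝕜) :
    Prop where
  finiteDimensional : FiniteDimensional 𝕜 V
  irreducible : LieModule.IsIrreducible 𝕜 (gl 𝕜 n) V
  exists_highestWeightVector : ∃ v : V, v ≠ 0 ∧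
    (∀ i j : Fin n, i < j → ⁅(Matrix.single i j 1 : gl 𝕜 n), v⁆ = 0) ∧
    (∀ i : Fin n, ⁅(Matrix.single i i 1 : gl 𝕜 n), v⁆ = wt i • v)

/-- The space `𝕜[x₁, …, xₙ] ⊗ V` of polynomial tensor fields on `𝕜ⁿ` with fibre `V`. -/
def TensorField (𝕜 : Type*) [Field 𝕜] (n : ℕ) (V : Type*) [AddCommGroup V] [Module 𝕜 V] :
    Type _ :=
  MvPolynomial (Fin n) 𝕜 ⊗[𝕜] V

namespace TensorField

variable {V : Type*} [AddCommGroup V] [Module 𝕜 V]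

noncomputable instance : AddCommGroup (TensorField 𝕜 n V) :=
  inferInstanceAs (AddCommGroup (MvPolynomial (Fin n) 𝕜 ⊗[𝕜] V))

noncomputable instance : Module 𝕜 (TensorField 𝕜 n V) :=
  inferInstanceAs (Module 𝕜 (MvPolynomial (Fin n) 𝕜 ⊗[𝕜] V))

/-- The tensor field `g ⊗ v`. -/
noncomputable def mk (g : MvPolynomial (Fin n) 𝕜) (v : V) : TensorField 𝕜 n V := g ⊗ₜ[𝕜] v

variable [LieRingModule (gl 𝕜 n) V] [LieModule 𝕜 (gl 𝕜 n) V]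

/-- A matrix `P` of polynomials acts on `𝕜[x₁, …, xₙ] ⊗ V` by
`g ⊗ v ↦ ∑ᵢⱼ P_ij g ⊗ E_ij v`. -/
noncomputable def matrixAction (V : Type*) [AddCommGroup V] [Module 𝕜 V]
    [LieRingModule (gl 𝕜 n) V] [LieModule 𝕜 (gl 𝕜 n) V]
    (P : Matrix (Fin n) (Fin n) (MvPolynomial (Fin n) 𝕜)) :
    Module.End 𝕜 (MvPolynomial (Fin n) 𝕜 ⊗[𝕜] V) :=
  ∑ i, ∑ j, TensorProduct.map (LinearMap.mulLeft 𝕜 (P i j))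
    (LieModule.toEnd 𝕜 (gl 𝕜 n) V (Matrix.single i j 1))

/-- The Jacobian matrix `(∂ᵢ fⱼ)` of `D = ∑ fⱼ ∂ⱼ`. -/
noncomputable def jacobian (D : W 𝕜 n) : Matrix (Fin n) (Fin n) (MvPolynomial (Fin n) 𝕜) :=
  Matrix.of fun i j => pderiv i (D (X j))

/-- The Lie derivative of tensor fields along `D = ∑ fⱼ ∂ⱼ`:
`g ⊗ v ↦ (∑ⱼ fⱼ ∂ⱼ g) ⊗ v + ∑ᵢⱼ (∂ᵢ fⱼ) g ⊗ E_ij v`. -/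
noncomputable def lieDerivative (V : Type*) [AddCommGroup V] [Module 𝕜 V]
    [LieRingModule (gl 𝕜 n) V] [LieModule 𝕜 (gl 𝕜 n) V] (D : W 𝕜 n) :
    Module.End 𝕜 (MvPolynomial (Fin n) 𝕜 ⊗[𝕜] V) :=
  TensorProduct.map (D : MvPolynomial (Fin n) 𝕜 →ₗ[𝕜] MvPolynomial (Fin n) 𝕜) LinearMap.id +
    matrixAction V (jacobian D)

theorem matrixAction_tmul (P : Matrix (Fin n) (Fin n) (MvPolynomial (Fin n) 𝕜))
    (g : MvPolynomial (Fin n) 𝕜) (v : V) :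
    matrixAction V P (g ⊗ₜ v) =
      ∑ i, ∑ j, (P i j * g) ⊗ₜ[𝕜] ⁅(Matrix.single i j 1 : gl 𝕜 n), v⁆ := by
  simp [matrixAction, LinearMap.sum_apply]

theorem matrixAction_add (P Q : Matrix (Fin n) (Fin n) (MvPolynomial (Fin n) 𝕜)) :
    matrixAction V (P + Q) = matrixAction V P + matrixAction V Q := by
  refine TensorProduct.ext' fun g v => ?_
  simp only [LinearMap.add_apply, matrixAction_tmul, Matrix.add_apply, add_mul,
    TensorProduct.add_tmul, Finset.sum_add_distrib]

theorem matrixAction_sub (P Q : Matrix (Fin n) (Fin n) (MvPolynomial (Fin n) 𝕜)) :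
    matrixAction V (P - Q) = matrixAction V P - matrixAction V Q := by
  refine TensorProduct.ext' fun g v => ?_
  simp only [LinearMap.sub_apply, matrixAction_tmul, Matrix.sub_apply, sub_mul,
    TensorProduct.sub_tmul, Finset.sum_sub_distrib]

theorem matrixAction_smul (c : 𝕜) (P : Matrix (Fin n) (Fin n) (MvPolynomial (Fin n) 𝕜)) :
    matrixAction V (c • P) = c • matrixAction V P := by
  refine TensorProduct.ext' fun g v => ?_
  simp only [LinearMap.smul_apply, matrixAction_tmul, Matrix.smul_apply, smul_mul_assoc,
    TensorProduct.smul_tmul', Finset.smul_sum]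

theorem matrixAction_zero :
    matrixAction V (0 : Matrix (Fin n) (Fin n) (MvPolynomial (Fin n) 𝕜)) = 0 := by
  refine TensorProduct.ext' fun g v => ?_
  simp [matrixAction_tmul]

theorem matrixAction_single (i j : Fin n) (a g : MvPolynomial (Fin n) 𝕜) (v : V) :
    matrixAction V (Matrix.single i j a) (g ⊗ₜ v) =
      (a * g) ⊗ₜ[𝕜] ⁅(Matrix.single i j 1 : gl 𝕜 n), v⁆ := by
  rw [matrixAction_tmul, Finset.sum_eq_single i, Finset.sum_eq_single j]
  · simp
  · intro k _ hk
    simp [hk.symm]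
  · simp
  · intro k _ hk
    simp [hk.symm]
  · simp

theorem matrixAction_lie (P Q : Matrix (Fin n) (Fin n) (MvPolynomial (Fin n) 𝕜)) :
    matrixAction V (P * Q - Q * P) =
      matrixAction V P * matrixAction V Q - matrixAction V Q * matrixAction V P := by
  induction P using Matrix.induction_on' with
  | h_zero =>
    refine TensorProduct.ext' fun g v => ?_
    simp [matrixAction_zero]
  | h_add P P' hP hP' =>
    have e : (P + P') * Q - Q * (P + P') = (P * Q - Q * P) + (P' * Q - Q * P') := by
      noncomm_ring
    rw [e, matrixAction_add, hP, hP', matrixAction_add]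
    noncomm_ring
  | h_std_basis i j a =>
    induction Q using Matrix.induction_on' with
    | h_zero =>
      refine TensorProduct.ext' fun g v => ?_
      simp [matrixAction_zero]
    | h_add Q Q' hQ hQ' =>
      have e : Matrix.single i j a * (Q + Q') - (Q + Q') * Matrix.single i j a =
          (Matrix.single i j a * Q - Q * Matrix.single i j a) +
            (Matrix.single i j a * Q' - Q' * Matrix.single i j a) := by
        noncomm_ring
      rw [e, matrixAction_add, hQ, hQ', matrixAction_add]
      noncomm_ring
    | h_std_basis k l b =>
      refine TensorProduct.ext' fun g v => ?_
      rw [LinearMap.sub_apply, Module.End.mul_apply, Module.End.mul_apply, matrixAction_single,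
        matrixAction_single, matrixAction_single, matrixAction_single, mul_left_comm b a g,
        ← TensorProduct.tmul_sub, ← lie_lie, Ring.lie_def, matrixAction_sub,
        LinearMap.sub_apply, sub_lie, TensorProduct.tmul_sub]
      congr 1
      · rcases eq_or_ne j k with rfl | h
        · rw [Matrix.single_mul_single_same, Matrix.single_mul_single_same, matrixAction_single,
            mul_one, mul_assoc]
        · rw [Matrix.single_mul_single_of_ne _ _ _ _ h, Matrix.single_mul_single_of_ne _ _ _ _ h,
            matrixAction_zero]
          simp
      · rcases eq_or_ne l i with rfl | h
        · rw [Matrix.single_mul_single_same, Matrix.single_mul_single_same, matrixAction_single,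
            mul_one, mul_assoc, mul_left_comm]
        · rw [Matrix.single_mul_single_of_ne _ _ _ _ h, Matrix.single_mul_single_of_ne _ _ _ _ h,
            matrixAction_zero]
          simp

theorem pderiv_apply (D : W 𝕜 n) (i : Fin n) (f : MvPolynomial (Fin n) 𝕜) :
    pderiv i (D f) = D (pderiv i f) + ∑ k, pderiv i (D (X k)) * pderiv k f := by
  have hc : ∀ k, pderiv i (pderiv k f) = pderiv k (pderiv i f) := fun k => by
    have h : ⁅(pderiv i : W 𝕜 n), (pderiv k : W 𝕜 n)⁆ = 0 := by
      refine MvPolynomial.derivation_ext fun j => ?_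
      simp [Derivation.commutator_apply, pderiv_X, Pi.single_apply, apply_ite]
    have := congrArg (fun E : W 𝕜 n => E f) h
    simpa [Derivation.commutator_apply, sub_eq_zero] using this
  rw [apply_eq_sum D f, apply_eq_sum D (pderiv i f), map_sum, ← Finset.sum_add_distrib]
  refine Finset.sum_congr rfl fun k _ => ?_
  rw [Derivation.leibniz, hc, smul_eq_mul, smul_eq_mul, mul_comm (pderiv k f)]

theorem jacobian_lie (D E : W 𝕜 n) :
    jacobian ⁅D, E⁆ = (jacobian E).map D - (jacobian D).map E +
      (jacobian D * jacobian E - jacobian E * jacobian D) := by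
  ext1 i j
  simp only [jacobian, Matrix.of_apply, Matrix.add_apply, Matrix.sub_apply, Matrix.map_apply,
    Matrix.mul_apply, Derivation.commutator_apply, map_sub]
  rw [pderiv_apply D i (E (X j)), pderiv_apply E i (D (X j))]
  ring

theorem map_mul_matrixAction_sub (D : W 𝕜 n)
    (P : Matrix (Fin n) (Fin n) (MvPolynomial (Fin n) 𝕜)) :
    TensorProduct.map (D : MvPolynomial (Fin n) 𝕜 →ₗ[𝕜] MvPolynomial (Fin n) 𝕜)
        (LinearMap.id : V →ₗ[𝕜] V) * matrixAction V P -
      matrixAction V P * TensorProduct.map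
        (D : MvPolynomial (Fin n) 𝕜 →ₗ[𝕜] MvPolynomial (Fin n) 𝕜) LinearMap.id =
      matrixAction V (P.map D) := by
  refine TensorProduct.ext' fun g v => ?_
  simp only [LinearMap.sub_apply, Module.End.mul_apply, matrixAction_tmul, map_sum,
    TensorProduct.map_tmul, LinearMap.id_apply, Derivation.coeFn_coe, Derivation.leibniz,
    smul_eq_mul, TensorProduct.add_tmul, Finset.sum_add_distrib, Matrix.map_apply]
  rw [add_sub_cancel_left]
  simp only [mul_comm g]

theorem lieDerivative_lie (D E : W 𝕜 n) :
    lieDerivative V ⁅D, E⁆ =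
      lieDerivative V D * lieDerivative V E - lieDerivative V E * lieDerivative V D := by
  have h : TensorProduct.map
        ((⁅D, E⁆ : W 𝕜 n) : MvPolynomial (Fin n) 𝕜 →ₗ[𝕜] MvPolynomial (Fin n) 𝕜)
        (LinearMap.id : V →ₗ[𝕜] V) =
      TensorProduct.map (D : MvPolynomial (Fin n) 𝕜 →ₗ[𝕜] MvPolynomial (Fin n) 𝕜) LinearMap.id *
        TensorProduct.map (E : MvPolynomial (Fin n) 𝕜 →ₗ[𝕜] MvPolynomial (Fin n) 𝕜)
          LinearMap.id -
      TensorProduct.map (E : MvPolynomial (Fin n) 𝕜 →ₗ[𝕜] MvPolynomial (Fin n) 𝕜) LinearMap.id *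
        TensorProduct.map (D : MvPolynomial (Fin n) 𝕜 →ₗ[𝕜] MvPolynomial (Fin n) 𝕜)
          LinearMap.id := by
    refine TensorProduct.ext' fun g v => ?_
    simp only [LinearMap.sub_apply, Module.End.mul_apply, TensorProduct.map_tmul,
      Derivation.coeFn_coe, Derivation.commutator_apply, TensorProduct.sub_tmul,
      LinearMap.id_apply]
  rw [lieDerivative, h, jacobian_lie, matrixAction_add, matrixAction_sub, matrixAction_lie,
    ← map_mul_matrixAction_sub, ← map_mul_matrixAction_sub, lieDerivative, lieDerivative]
  noncomm_ring

theorem lieDerivative_add (D E : W 𝕜 n) :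
    lieDerivative V (D + E) = lieDerivative V D + lieDerivative V E := by
  have h : jacobian (D + E) = jacobian D + jacobian E := by
    ext1 i j
    simp [jacobian]
  refine TensorProduct.ext' fun g v => ?_
  simp only [lieDerivative, h, matrixAction_add, LinearMap.add_apply, TensorProduct.map_tmul,
    Derivation.coeFn_coe, Derivation.add_apply, TensorProduct.add_tmul]
  abel

theorem lieDerivative_smul (c : 𝕜) (D : W 𝕜 n) :
    lieDerivative V (c • D) = c • lieDerivative V D := by
  have h : jacobian (c • D) = c • jacobian D := by
    ext1 i j
    simp [jacobian]
  refine TensorProduct.ext' fun g v => ?_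
  simp only [lieDerivative, h, matrixAction_smul, LinearMap.add_apply, LinearMap.smul_apply,
    TensorProduct.map_tmul, Derivation.coeFn_coe, Derivation.smul_apply,
    TensorProduct.smul_tmul', smul_add]

/-- The `W_n^pol`-module structure of the polynomial tensor fields. -/
noncomputable instance : LieRingModule (W 𝕜 n) (TensorField 𝕜 n V) where
  bracket D t := lieDerivative V D t
  add_lie D E t := by
    change lieDerivative V (D + E) t = lieDerivative V D t + lieDerivative V E t
    rw [lieDerivative_add]
    rfl
  lie_add D s t := map_add (lieDerivative V D) s t
  leibniz_lie D E t := by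
    change lieDerivative V D (lieDerivative V E t) =
      lieDerivative V ⁅D, E⁆ t + lieDerivative V E (lieDerivative V D t)
    rw [lieDerivative_lie]
    exact (sub_add_cancel _ _).symm

noncomputable instance : LieModule 𝕜 (W 𝕜 n) (TensorField 𝕜 n V) where
  smul_lie c D t := by
    change lieDerivative V (c • D) t = c • lieDerivative V D t
    rw [lieDerivative_smul]
    rfl
  lie_smul c D t := map_smul (lieDerivative V D) c t

theorem lie_mk (D : W 𝕜 n) (g : MvPolynomial (Fin n) 𝕜) (v : V) :
    ⁅D, mk g v⁆ = mk (D g) v +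
      ∑ i, ∑ j, mk (pderiv i (D (X j)) * g) ⁅(Matrix.single i j 1 : gl 𝕜 n), v⁆ := by
  change lieDerivative V D (g ⊗ₜ v) = _
  rw [lieDerivative, LinearMap.add_apply, matrixAction_tmul]
  rfl

end TensorField
end PolyField

/-! ### Chains of invariant subspaces -/

namespace InvariantChain

variable {𝕜 ι M M' : Type*} [Field 𝕜] [AddCommGroup M'] [Module 𝕜 M'] [AddCommGroup M] [Module 𝕜 M]

/-! Only the fields d⁻¹ xⱼ G(xⱼᵈ) ∂ⱼ are used, where G runs over the multiples of z u² for one fixed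
nonzero polynomial u. For the first two subalgebras u = 1; a subalgebra of finite codimension
contains such fields for some u, with d = 1. The Jacobian of such a field has only the entry (j, j),
so weight bases of the fibres and residues of exponents mod d exhibit the tensor product as a finite
sum of images of polynomial rings in the variables x_(s,j). These variables are points of a line,
coloured by j: the field z G(z) ∂ of colour j moves all points of that colour and acts on twisted
densities f z^b (dz/z)^l. It remains to prove the chain condition for these representations
(`accAbove_bot`), by induction on the number of points.

Modulo a power of the discriminant, the product of all differences of points of equal colour and of
all x u(x), only representations with fewer points occur: on a diagonal two points merge, and over a
zero of x u(x) a point acts trivially (`accAbove_multiples_discr_pow`).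

Away from the discriminant the points can be separated. Two fields are applied per point, recorded
by generating variables y, y', and combined by a polynomial that vanishes to high order where slots
of different points meet. Only colour-preserving permutations survive, and a factor (y - y')² at a
point of weight l yields the scalar 2l(1 - l). Without weights 0 and 1, an invariant subspace is
thus, up to powers of the discriminant, a module over the colour-symmetric polynomials, over which
the whole polynomial ring is noetherian. At weight 0 one obtains the Euler operator x∂ + b instead
(`exists_discr_pow_mul_mem`); its kernel comes from fewer points. Weight 1 is reduced to weight 0 by
the twisted de Rham differential, again x∂ + b (`accAbove_update_one`).

An invariant chain is then controlled by three chains: its part in the kernels of the Euler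
operators, the modules `core` over symmetric polynomials, and the reduction modulo a power of the
discriminant (`accAbove_of_ne_one`). -/

/-- The subspace `N` is stable under all operators `ρ i`. -/
def Invariant (ρ : ι → Module.End 𝕜 M) (N : Submodule 𝕜 M) : Prop :=
  ∀ i, ∀ x ∈ N, ρ i x ∈ N

/-- Ascending chains of `ρ`-invariant subspaces that contain `K` stabilise. -/
def AccAbove (ρ : ι → Module.End 𝕜 M) (K : Submodule 𝕜 M) : Prop :=
  ∀ N : ℕ → Submodule 𝕜 M, Monotone N → (∀ m, K ≤ N m) → (∀ m, Invariant ρ (N m)) →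
    ∃ m₀, ∀ m, m₀ ≤ m → N m ≤ N m₀

variable {ρ : ι → Module.End 𝕜 M} {ρ' : ι → Module.End 𝕜 M'}

theorem Invariant.sup {N K : Submodule 𝕜 M} (hN : Invariant ρ N) (hK : Invariant ρ K) :
    Invariant ρ (N ⊔ K) := by
  intro i x hx
  obtain ⟨y, hy, z, hz, rfl⟩ := Submodule.mem_sup.1 hx
  rw [map_add]
  exact Submodule.add_mem_sup (hN i y hy) (hK i z hz)

theorem Invariant.inf {N K : Submodule 𝕜 M} (hN : Invariant ρ N) (hK : Invariant ρ K) :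
    Invariant ρ (N ⊓ K) := fun i x hx => ⟨hN i x hx.1, hK i x hx.2⟩

theorem accAbove_top : AccAbove ρ ⊤ := fun _ _ h _ => ⟨0, fun _ _ => le_top.trans (h 0)⟩

theorem AccAbove.mono {K K' : Submodule 𝕜 M} (h : AccAbove ρ K) (hK : K ≤ K') : AccAbove ρ K' :=
  fun N hN hKN hI => h N hN (fun m => hK.trans (hKN m)) hI

theorem invariant_sup_range {K : Submodule 𝕜 M} (hK : Invariant ρ K) (f : M' →ₗ[𝕜] M)
    (hf : ∀ i x, ρ i (f x) - f (ρ' i x) ∈ K) : Invariant ρ (K ⊔ LinearMap.range f) := by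
  intro i x hx
  obtain ⟨y, hy, _, ⟨z, rfl⟩, rfl⟩ := Submodule.mem_sup.1 hx
  rw [map_add, ← sub_add_cancel (ρ i (f z)) (f (ρ' i z)), ← add_assoc]
  exact Submodule.add_mem_sup (K.add_mem (hK i y hy) (hf i z)) ⟨_, rfl⟩

/-- Extension of chain conditions along a map that is equivariant modulo `K`. -/
theorem AccAbove.of_sup_range {K : Submodule 𝕜 M} (hK : Invariant ρ K) (f : M' →ₗ[𝕜] M)
    (hf : ∀ i x, ρ i (f x) - f (ρ' i x) ∈ K) (h' : AccAbove ρ' ⊥)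
    (h : AccAbove ρ (K ⊔ LinearMap.range f)) : AccAbove ρ K := by
  intro N hN hKN hI
  have hI' := invariant_sup_range hK f hf
  -- As for modules, `N m` is determined by its preimage under `f` and its image modulo `K ⊔ range
  -- f`.
  obtain ⟨a, ha⟩ := h' (fun m => (N m).comap f) (fun i j hij => Submodule.comap_mono (hN hij))
    (fun _ => bot_le) (fun m i x hx => by
      have h1 := (N m).sub_mem (hI m i _ hx) (hKN m (hf i x))
      simpa using h1)
  obtain ⟨e, he⟩ := h (fun m => N m ⊔ (K ⊔ LinearMap.range f))
    (fun i j hij => sup_le_sup_right (hN hij) _) (fun _ => le_sup_right)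
    (fun m => (hI m).sup hI')
  refine ⟨max a e, fun m hm x hx => ?_⟩
  have hx' := he m (le_of_max_le_right hm) (Submodule.mem_sup_left hx)
  obtain ⟨y, hy, z, hz, rfl⟩ := Submodule.mem_sup.1 hx'
  obtain ⟨k, hk, _, ⟨t, rfl⟩, rfl⟩ := Submodule.mem_sup.1 hz
  have hy' : y ∈ N (max a e) := hN (le_max_right a e) hy
  have hk' : k ∈ N (max a e) := hKN _ hk
  have hft : f t ∈ N m := by
    have := (N m).sub_mem hx ((N m).add_mem (hN hm hy') (hN hm hk'))
    simpa [← add_assoc] using this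
  have hmemN : t ∈ (N a).comap f := ha m (le_of_max_le_left hm) hft
  exact Submodule.add_mem _ hy' (Submodule.add_mem _ hk' (hN (le_max_left a e) hmemN))

/-- Adding `A` to a subspace above `K` does not affect the chain condition. -/
def Negligible (ρ : ι → Module.End 𝕜 M) (K A : Submodule 𝕜 M) : Prop :=
  ∀ K', K ≤ K' → Invariant ρ K' →
    Invariant ρ (K' ⊔ A) ∧ (AccAbove ρ (K' ⊔ A) → AccAbove ρ K')

/-- All representations with fewer points are discarded through this: equivariance is only needed
modulo `K`. -/
theorem negligible_range {K : Submodule 𝕜 M} (f : M' →ₗ[𝕜] M)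
    (hf : ∀ i x, ρ i (f x) - f (ρ' i x) ∈ K) (h' : AccAbove ρ' ⊥) :
    Negligible ρ K (LinearMap.range f) := fun _ hK hI =>
  ⟨invariant_sup_range hI f fun i x => hK (hf i x),
    AccAbove.of_sup_range hI f (fun i x => hK (hf i x)) h'⟩

theorem negligible_bot {K : Submodule 𝕜 M} : Negligible ρ K ⊥ := fun K' _ hI => by
  rw [sup_bot_eq]; exact ⟨hI, id⟩

/-- Since negligibility quantifies over every invariant `K'` above `K`, the subspaces can be added
one after another. -/
theorem negligible_sup {K : Submodule 𝕜 M} {α : Type*} (s : Finset α) (A : α → Submodule 𝕜 M)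
    (h : ∀ a ∈ s, Negligible ρ K (A a)) : Negligible ρ K (s.sup A) := by
  classical
  induction s using Finset.induction_on with
  | empty => exact negligible_bot
  | insert a s _ ih =>
    intro K' hK hI
    rw [Finset.sup_insert, ← sup_assoc]
    obtain ⟨h1, h2⟩ := h a (Finset.mem_insert_self a s) K' hK hI
    obtain ⟨h3, h4⟩ := ih (fun b hb => h b (Finset.mem_insert_of_mem hb)) (K' ⊔ A a)
      (hK.trans le_sup_left) h1
    exact ⟨h3, fun h5 => h2 (h4 h5)⟩

/-- M/(K₁ ∩ K₂) embeds into M/K₁ ⊕ M/K₂; concretely, N is controlled by N + K₁ and (N ∩ K₁) + K₂. -/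
theorem AccAbove.inf {K₁ K₂ : Submodule 𝕜 M} (h₁ : AccAbove ρ K₁) (h₂ : AccAbove ρ K₂)
    (i₁ : Invariant ρ K₁) (i₂ : Invariant ρ K₂) : AccAbove ρ (K₁ ⊓ K₂) := by
  intro N hN hK hI
  obtain ⟨a, ha⟩ := h₁ (fun m => N m ⊔ K₁) (fun i j hij => sup_le_sup_right (hN hij) _)
    (fun _ => le_sup_right) (fun m => (hI m).sup i₁)
  obtain ⟨e, he⟩ := h₂ (fun m => (N m ⊓ K₁) ⊔ K₂)
    (fun i j hij => sup_le_sup_right (inf_le_inf_right _ (hN hij)) _)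
    (fun _ => le_sup_right) (fun m => ((hI m).inf i₁).sup i₂)
  refine ⟨max a e, fun m hm x hx => ?_⟩
  obtain ⟨y, hy, z, hz, rfl⟩ := Submodule.mem_sup.1
    (ha m (le_of_max_le_left hm) (Submodule.mem_sup_left hx))
  have hy' : y ∈ N (max a e) := hN (le_max_left a e) hy
  have hzm : z ∈ N m := by simpa using (N m).sub_mem hx (hN hm hy')
  obtain ⟨y', hy2, z', hz', rfl⟩ := Submodule.mem_sup.1
    (he m (le_of_max_le_right hm) (Submodule.mem_sup_left ⟨hzm, hz⟩))
  refine Submodule.add_mem _ hy' (Submodule.add_mem _ (hN (le_max_right a e) hy2.1)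
    (hK _ ⟨?_, hz'⟩))
  simpa using K₁.sub_mem hz hy2.2

theorem AccAbove.finset_inf {α : Type*} (s : Finset α) (K : α → Submodule 𝕜 M)
    (h : ∀ a ∈ s, AccAbove ρ (K a)) (hI : ∀ a ∈ s, Invariant ρ (K a)) :
    AccAbove ρ (s.inf K) ∧ Invariant ρ (s.inf K) := by
  classical
  induction s using Finset.induction_on with
  | empty => exact ⟨accAbove_top, fun _ _ _ => trivial⟩
  | insert a s _ ih =>
    rw [Finset.inf_insert]
    obtain ⟨h1, h2⟩ := ih (fun b hb => h b (Finset.mem_insert_of_mem hb))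
      (fun b hb => hI b (Finset.mem_insert_of_mem hb))
    have ha := Finset.mem_insert_self a s
    exact ⟨(h a ha).inf h1 (hI a ha) h2, (hI a ha).inf h2⟩

/-- The chain condition for invariant subspaces gives noetherianity of a Lie module. -/
theorem isLieNoetherian_of_accAbove {L : Type*} [LieRing L] [LieAlgebra 𝕜 L] [LieRingModule L M]
    [LieModule 𝕜 L M] (x : ι → L) (hρ : ∀ i m, ρ i m = ⁅x i, m⁆) (h : AccAbove ρ ⊥) :
    IsLieNoetherian 𝕜 L M := by
  rw [IsLieNoetherian, wellFoundedGT_iff_monotone_chain_condition]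
  intro N
  obtain ⟨a, ha⟩ := h (fun m => (N m).toSubmodule)
    (fun i j hij => LieSubmodule.toSubmodule_le_toSubmodule (N i) (N j) |>.2 (N.monotone hij))
    (fun _ => bot_le) (fun m i y hy => by rw [hρ]; exact (N m).lie_mem hy)
  exact ⟨a, fun m hm => le_antisymm (N.monotone hm)
    ((LieSubmodule.toSubmodule_le_toSubmodule _ _).1 (ha m hm))⟩

end InvariantChain

/-! ### Tensor fields at several coloured points of the line -/

namespace PointRep

open MvPolynomial InvariantChain

set_option linter.unusedSectionVars false

variable {𝕜 P C : Type*} [Field 𝕜] [Fintype P] [DecidableEq P] [DecidableEq C]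

/-- The test function `z u² g`; it gives rise to the vector field `z² u² g ∂_z`. -/
noncomputable def test (u g : Polynomial 𝕜) : Polynomial 𝕜 := Polynomial.X * u ^ 2 * g

/-- The vector field `∑ xᵢ G(xᵢ) ∂ᵢ`, the sum being over the points `i` of colour `s`, where `G`
is the test function of `g`. -/
noncomputable def vf (u : Polynomial 𝕜) (c : P → C) (s : C) (g : Polynomial 𝕜) :
    Derivation 𝕜 (MvPolynomial P 𝕜) (MvPolynomial P 𝕜) :=
  mkDerivation 𝕜 fun i => if c i = s then X i * Polynomial.aeval (X i) (test u g) else 0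

/-- The zeroth order part `b G + l z G'` of the action on one point. -/
noncomputable def pointPot (l b : 𝕜) (G : Polynomial 𝕜) : Polynomial 𝕜 :=
  Polynomial.C b * G + Polynomial.C l * (Polynomial.X * Polynomial.derivative G)

/-- The zeroth order part of the action. -/
noncomputable def pot (u : Polynomial 𝕜) (c : P → C) (l b : P → 𝕜) (s : C) (g : Polynomial 𝕜) :
    MvPolynomial P 𝕜 :=
  ∑ i, if c i = s then Polynomial.aeval (X i) (pointPot (l i) (b i) (test u g)) else 0

/-- The action of the vector field `x² u² g ∂` of colour `s` on the tensor fields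
`∏ xᵢ^(bᵢ - lᵢ) (dxᵢ)^(lᵢ)` at the points. -/
noncomputable def op (u : Polynomial 𝕜) (c : P → C) (l b : P → 𝕜) (sg : C × Polynomial 𝕜) :
    Module.End 𝕜 (MvPolynomial P 𝕜) :=
  (vf u c sg.1 sg.2 : MvPolynomial P 𝕜 →ₗ[𝕜] MvPolynomial P 𝕜) +
    LinearMap.mulLeft 𝕜 (pot u c l b sg.1 sg.2)

variable {u : Polynomial 𝕜} {c : P → C} {l b : P → 𝕜}

theorem op_apply (s : C) (g : Polynomial 𝕜) (f : MvPolynomial P 𝕜) :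
    op u c l b (s, g) f = vf u c s g f + pot u c l b s g * f := rfl

theorem op_mul (s : C) (g : Polynomial 𝕜) (a f : MvPolynomial P 𝕜) :
    op u c l b (s, g) (a * f) = vf u c s g a * f + a * op u c l b (s, g) f := by
  simp only [op_apply, Derivation.leibniz, smul_eq_mul]
  ring

theorem vf_X (s : C) (g : Polynomial 𝕜) (i : P) : vf u c s g (X i) =
    if c i = s then X i * Polynomial.aeval (X i) (test u g) else 0 := by
  simp [vf]

theorem vf_aeval_X (s : C) (g : Polynomial 𝕜) (i : P) (p : Polynomial 𝕜) :
    vf u c s g (Polynomial.aeval (X i) p) =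
      if c i = s then Polynomial.aeval (X i)
        (Polynomial.derivative p * (Polynomial.X * test u g)) else 0 := by
  rw [Derivation.map_aeval, vf_X]
  split_ifs <;> simp

/-- The multiples of `q` as a linear subspace. -/
noncomputable def multiples (q : MvPolynomial P 𝕜) : Submodule 𝕜 (MvPolynomial P 𝕜) :=
  (Ideal.span {q}).restrictScalars 𝕜

theorem mem_multiples {q f : MvPolynomial P 𝕜} : f ∈ multiples q ↔ q ∣ f := by
  rw [multiples, Submodule.restrictScalars_mem, Ideal.mem_span_singleton]

theorem multiples_one : multiples (1 : MvPolynomial P 𝕜) = ⊤ :=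
  eq_top_iff.2 fun _ _ => mem_multiples.2 (one_dvd _)

/-- The operators have first order with symbol `vf`, so on q h the only term that is not visibly a
multiple of q is `vf q * h`. -/
theorem invariant_multiples {q : MvPolynomial P 𝕜} (hq : ∀ s g, q ∣ vf u c s g q) :
    Invariant (op u c l b) (multiples q) := by
  rintro ⟨s, g⟩ f hf
  obtain ⟨h, rfl⟩ := mem_multiples.1 hf
  rw [mem_multiples, op_mul]
  exact dvd_add ((hq s g).mul_right _) (dvd_mul_right _ _)

theorem dvd_vf_mul {p q : MvPolynomial P 𝕜} {s : C} {g : Polynomial 𝕜} (hp : p ∣ vf u c s g p)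
    (hq : q ∣ vf u c s g q) : p * q ∣ vf u c s g (p * q) := by
  rw [Derivation.leibniz, smul_eq_mul, smul_eq_mul]
  exact dvd_add (mul_dvd_mul_left _ hq) (by rw [mul_comm p]; exact mul_dvd_mul_left _ hp)

theorem dvd_vf_pow {q : MvPolynomial P 𝕜} {s : C} {g : Polynomial 𝕜}
    (hq : q ∣ vf u c s g q) (a : ℕ) : q ^ a ∣ vf u c s g (q ^ a) := by
  induction a with
  | zero => simp
  | succ a ih => rw [pow_succ]; exact dvd_vf_mul ih hq

theorem dvd_vf_prod {α : Type*} (t : Finset α) (q : α → MvPolynomial P 𝕜) {s : C}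
    {g : Polynomial 𝕜} (hq : ∀ a ∈ t, q a ∣ vf u c s g (q a)) :
    ∏ a ∈ t, q a ∣ vf u c s g (∏ a ∈ t, q a) := by
  classical
  induction t using Finset.induction_on with
  | empty => simp
  | insert a t ha ih =>
    rw [Finset.prod_insert ha]
    exact dvd_vf_mul (hq a (Finset.mem_insert_self a t))
      (ih fun b hb => hq b (Finset.mem_insert_of_mem hb))

/-- Points of equal colour are moved by the same one-variable function p, and x - y divides p(x) -
p(y). -/
theorem sub_dvd_vf_sub {i j : P} (hc : c i = c j) (s : C) (g : Polynomial 𝕜) :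
    (X i - X j : MvPolynomial P 𝕜) ∣ vf u c s g (X i - X j) := by
  rw [map_sub, vf_X, vf_X, ← hc]
  split_ifs
  · have := Polynomial.sub_dvd_eval_sub (X i : MvPolynomial P 𝕜) (X j)
      ((Polynomial.X * test u g).map (algebraMap 𝕜 (MvPolynomial P 𝕜)))
    rw [Polynomial.eval_map_algebraMap, Polynomial.eval_map_algebraMap] at this
    simpa using this
  · simp

/-- With v = z u the moving field is v² g ∂, which vanishes on the zeros of v. -/
theorem aeval_dvd_vf_aeval (i : P) (s : C) (g : Polynomial 𝕜) :
    (Polynomial.aeval (X i) (Polynomial.X * u) : MvPolynomial P 𝕜) ∣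
      vf u c s g (Polynomial.aeval (X i) (Polynomial.X * u)) := by
  rw [vf_aeval_X]
  split_ifs
  · refine map_dvd _ ⟨Polynomial.derivative (Polynomial.X * u) * (Polynomial.X * u * g), ?_⟩
    rw [test]
    ring
  · simp

theorem vf_pow_of_eq_mul {q Q : MvPolynomial P 𝕜} {s : C} {g : Polynomial 𝕜}
    (hq : vf u c s g q = q * Q) (a : ℕ) : vf u c s g (q ^ a) = q ^ a * (a * Q) := by
  induction a with
  | zero => simp
  | succ a ih =>
    rw [pow_succ, Derivation.leibniz, ih, hq, smul_eq_mul, smul_eq_mul]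
    push_cast
    ring

/-! #### Removing a point -/

/-- Polynomials in the coordinates of the points other than `i`. -/
noncomputable def incl (𝕜 : Type*) [Field 𝕜] {P : Type*} (i : P) :
    MvPolynomial {j : P // j ≠ i} 𝕜 →ₐ[𝕜] MvPolynomial P 𝕜 :=
  rename Subtype.val

theorem vf_incl (i : P) (s : C) (g : Polynomial 𝕜) (h : MvPolynomial {j : P // j ≠ i} 𝕜) :
    vf u c s g (incl 𝕜 i h) = incl 𝕜 i (vf u (fun j : {j // j ≠ i} => c j) s g h) := by
  induction h using MvPolynomial.induction_on with
  | C a => simp [incl, ← algebraMap_eq]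
  | add p q hp hq => simp only [map_add, hp, hq]
  | mul_X p j hp =>
    simp only [map_mul, Derivation.leibniz, map_add, smul_eq_mul, hp]
    congr 2
    simp only [incl, rename_X, vf_X]
    split_ifs
    · simp [← Polynomial.aeval_algHom_apply]
    · simp

/-- Multiplication by `m` as a map from the representation with the point `i` removed. -/
noncomputable def mulIncl (i : P) (m : MvPolynomial P 𝕜) :
    MvPolynomial {j : P // j ≠ i} 𝕜 →ₗ[𝕜] MvPolynomial P 𝕜 :=
  LinearMap.mulLeft 𝕜 m ∘ₗ (incl 𝕜 i).toLinearMap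

theorem mulIncl_apply (i : P) (m : MvPolynomial P 𝕜) (h : MvPolynomial {j : P // j ≠ i} 𝕜) :
    mulIncl i m h = m * incl 𝕜 i h := rfl

/-- The defect of equivariance is a single factor times `incl 𝕜 i h`, so every comparison with fewer
points is a check on that factor. The parameters `l'`, `b'` stay free because merging two points
changes them. -/
theorem op_mulIncl_sub (i : P) (m : MvPolynomial P 𝕜) (s : C) (g : Polynomial 𝕜)
    (l' b' : {j : P // j ≠ i} → 𝕜) (h : MvPolynomial {j : P // j ≠ i} 𝕜) :
    op u c l b (s, g) (mulIncl i m h) -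
        mulIncl i m (op u (fun j : {j // j ≠ i} => c j) l' b' (s, g) h) =
      (vf u c s g m + (pot u c l b s g -
        incl 𝕜 i (pot u (fun j : {j // j ≠ i} => c j) l' b' s g)) * m) * incl 𝕜 i h := by
  simp only [mulIncl_apply, op_apply, Derivation.leibniz, smul_eq_mul, vf_incl, map_add, map_mul]
  ring

theorem incl_pot (i : P) (s : C) (g : Polynomial 𝕜) (l' b' : {j : P // j ≠ i} → 𝕜) :
    incl 𝕜 i (pot u (fun j : {j // j ≠ i} => c j) l' b' s g) =
      ∑ j : {j : P // j ≠ i}, if c j = s then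
        Polynomial.aeval (X (j : P)) (pointPot (l' j) (b' j) (test u g)) else 0 := by
  simp only [pot, map_sum]
  refine Finset.sum_congr rfl fun j _ => ?_
  split_ifs
  · rw [← Polynomial.aeval_algHom_apply]; simp [incl]
  · simp

theorem pot_sub_incl_pot (i : P) (s : C) (g : Polynomial 𝕜) :
    pot u c l b s g - incl 𝕜 i (pot u (fun j : {j // j ≠ i} => c j) (fun j => l j)
        (fun j => b j) s g) =
      if c i = s then Polynomial.aeval (X i) (pointPot (l i) (b i) (test u g)) else 0 := by
  rw [incl_pot, pot, Fintype.sum_eq_add_sum_subtype_ne _ i, add_sub_cancel_right]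

theorem monomial_eq_mul_incl (i : P) (m : P →₀ ℕ) (x : 𝕜) : (monomial m x : MvPolynomial P 𝕜) =
    X i ^ m i * incl 𝕜 i (monomial (m.subtypeDomain (· ≠ i)) x) := by
  rw [incl, rename_monomial, X_pow_eq_monomial, monomial_mul, one_mul]
  congr 2
  refine Finsupp.ext fun k => ?_
  rcases eq_or_ne k i with rfl | hk
  · rw [Finsupp.add_apply, Finsupp.single_eq_same, Finsupp.mapDomain_of_notMem_range]
    · simp
    · simp
  · have := Finsupp.mapDomain_apply (Subtype.val_injective) (m.subtypeDomain (· ≠ i)) ⟨k, hk⟩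
    rw [Finsupp.add_apply, Finsupp.single_eq_of_ne hk, zero_add]
    exact this.symm

theorem exists_eq_incl_add {i j : P} (hij : i ≠ j) (f : MvPolynomial P 𝕜) :
    ∃ h q, f = incl 𝕜 j h + (X i - X j) * q := by
  induction f using MvPolynomial.induction_on with
  | C a => exact ⟨C a, 0, by simp [incl]⟩
  | add f f' hf hf' =>
    obtain ⟨h, q, rfl⟩ := hf
    obtain ⟨h', q', rfl⟩ := hf'
    exact ⟨h + h', q + q', by rw [map_add]; ring⟩
  | mul_X f k hf =>
    obtain ⟨h, q, rfl⟩ := hf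
    rcases eq_or_ne k j with rfl | hk
    · exact ⟨h * X ⟨i, hij⟩, q * X k - incl 𝕜 k h, by
        rw [map_mul, incl, rename_X]; ring⟩
    · exact ⟨h * X ⟨k, hk⟩, q * X k, by
        rw [map_mul, incl, rename_X]; ring⟩

/-- Order two is needed: the action on (xᵢ - xⱼ)^a must be known modulo (xᵢ - xⱼ)^(a+1), and the
linear coefficient produces the shift of the weights there. -/
theorem aeval_eq_taylor (p : Polynomial 𝕜) (i j : P) :
    ∃ k : MvPolynomial P 𝕜, Polynomial.aeval (X j) p = Polynomial.aeval (X i) p -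
      Polynomial.aeval (X i) (Polynomial.derivative p) * (X i - X j) + k * (X i - X j) ^ 2 := by
  obtain ⟨k, hk⟩ := Polynomial.binomExpansion
    (p.map (algebraMap 𝕜 (MvPolynomial P 𝕜))) (X i) (X j - X i)
  rw [Polynomial.derivative_map, Polynomial.eval_map_algebraMap, Polynomial.eval_map_algebraMap,
    Polynomial.eval_map_algebraMap, add_sub_cancel] at hk
  exact ⟨k, by rw [hk]; ring⟩

theorem sub_dvd_aeval_sub (p : Polynomial 𝕜) (i j : P) : (X i - X j : MvPolynomial P 𝕜) ∣
    Polynomial.aeval (X i) p - Polynomial.aeval (X j) p := by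
  have := Polynomial.sub_dvd_eval_sub (X i : MvPolynomial P 𝕜) (X j)
    (p.map (algebraMap 𝕜 (MvPolynomial P 𝕜)))
  rwa [Polynomial.eval_map_algebraMap, Polynomial.eval_map_algebraMap] at this

theorem pderiv_incl (i : P) (h : MvPolynomial {j : P // j ≠ i} 𝕜) :
    pderiv i (incl 𝕜 i h) = 0 := by
  induction h using MvPolynomial.induction_on with
  | C a => simp [incl]
  | add p q hp hq => simp only [map_add, hp, hq, add_zero]
  | mul_X p j hp =>
    rw [map_mul, Derivation.leibniz, hp, incl, rename_X, pderiv_X_of_ne j.2]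
    simp

/-! ### Filtrations along the components of the discriminant -/

/-- The points `j ≠ i` and the chain condition for their representations. -/
def AccRemove (u : Polynomial 𝕜) (c : P → C) (i : P) : Prop :=
  ∀ l' b' : {j : P // j ≠ i} → 𝕜, AccAbove (op u (fun j : {j // j ≠ i} => c j) l' b') ⊥

theorem negligible_mulIncl (i : P) (hacc : AccRemove u c i) {K : Submodule 𝕜 (MvPolynomial P 𝕜)}
    (m : MvPolynomial P 𝕜) (l' b' : {j : P // j ≠ i} → 𝕜)
    (h : ∀ s g f, (vf u c s g m + (pot u c l b s g -
        incl 𝕜 i (pot u (fun j : {j // j ≠ i} => c j) l' b' s g)) * m) * incl 𝕜 i f ∈ K) :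
    Negligible (op u c l b) K (LinearMap.range (mulIncl i m)) :=
  negligible_range (mulIncl i m) (fun ⟨s, g⟩ x => by rw [op_mulIncl_sub]; exact h s g _)
    (hacc _ _)

/-- The representation is modified along the divisor of `v(xᵢ)` only by finitely many copies of
the representation with the point `i` removed. -/
theorem accAbove_multiples_aeval_pow (hu : u ≠ 0) (i : P) (hacc : AccRemove u c i) (a : ℕ) :
    AccAbove (op u c l b) (multiples (Polynomial.aeval (X i) (Polynomial.X * u) ^ a)) := by
  set v : Polynomial 𝕜 := Polynomial.X * u with hv
  have hv0 : v ≠ 0 := mul_ne_zero Polynomial.X_ne_zero hu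
  induction a with
  | zero => rw [pow_zero, multiples_one]; exact accAbove_top
  | succ a ih =>
    -- The multiples of v^a modulo v^(a+1) are spanned by v^a xᵢ^t h with t < deg v and h free of
    -- xᵢ. The point i acts by zero on this quotient: the field is v² g ∂, and G and z G' are both
    -- divisible by v because u enters the test function squared.
    have hN := negligible_sup (ρ := op u c l b)
      (K := multiples ((Polynomial.aeval (X i) v : MvPolynomial P 𝕜) ^ (a + 1)))
      (Finset.range v.natDegree)
      (fun t => LinearMap.range (mulIncl i (Polynomial.aeval (X i) (v ^ a * Polynomial.X ^ t))))
      (fun t _ => negligible_mulIncl i hacc _ (fun j => l j) (fun j => b j) fun s g f => by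
        rw [mem_multiples]
        refine Dvd.dvd.mul_right ?_ (incl 𝕜 _ f)
        rw [pot_sub_incl_pot, vf_aeval_X]
        split_ifs
        · rw [← map_mul, ← map_add, ← map_pow]
          refine map_dvd _ (dvd_add ?_ ?_)
          · rw [Polynomial.derivative_mul, Polynomial.derivative_pow]
            rcases a with _ | a
            · refine ⟨Polynomial.derivative (Polynomial.X ^ t) * (v * g), ?_⟩
              simp [test, hv]; ring
            · refine ⟨(Polynomial.C (((a + 1 : ℕ) : 𝕜)) * Polynomial.derivative v * 
                Polynomial.X ^ t + v * Polynomial.derivative (Polynomial.X ^ t)) * g, ?_⟩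
              simp only [test, hv, Nat.add_sub_cancel]; ring
          · rw [pow_succ]
            have h1 : v ∣ pointPot (l i) (b i) (test u g) := by
              refine ⟨Polynomial.C (b i) * (u * g) + Polynomial.C (l i) * (u * g +
                Polynomial.C 2 * Polynomial.X * Polynomial.derivative u * g +
                Polynomial.X * u * Polynomial.derivative g), ?_⟩
              simp only [pointPot, test, hv, Polynomial.derivative_mul, Polynomial.derivative_pow,
                Polynomial.derivative_X]
              simp
              ring
            rw [mul_comm (v ^ a)]
            exact mul_dvd_mul h1 (dvd_mul_right _ _)
        · simp)
    refine (hN _ le_rfl (invariant_multiples fun s g =>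
      dvd_vf_pow (aeval_dvd_vf_aeval i s g) _)).2 (ih.mono fun f hf => ?_)
    obtain ⟨f, rfl⟩ := mem_multiples.1 hf
    induction f using MvPolynomial.induction_on' with
    | add p q hp hq =>
      rw [mul_add]
      exact Submodule.add_mem _ (hp (mem_multiples.2 (dvd_mul_right _ _)))
        (hq (mem_multiples.2 (dvd_mul_right _ _)))
    | monomial m x =>
      -- Division by v in the variable xᵢ: the quotient part is absorbed by v^(a+1), and the
      -- remainder is distributed over the powers xᵢ^t.
      have hdiv : (Polynomial.X ^ m i : Polynomial 𝕜) =
          v * (Polynomial.X ^ m i / v) + Polynomial.X ^ m i % v :=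
        (EuclideanDomain.div_add_mod _ _).symm
      have hdeg : (Polynomial.X ^ m i % v).degree < (v.natDegree : WithBot ℕ) := by
        rw [← Polynomial.degree_eq_natDegree hv0]
        exact EuclideanDomain.mod_lt _ hv0
      have hsum : Polynomial.X ^ m i % v = ∑ t ∈ Finset.range v.natDegree,
          Polynomial.C ((Polynomial.X ^ m i % v).coeff t) * Polynomial.X ^ t := by
        simp only [Polynomial.C_mul_X_pow_eq_monomial]
        by_cases h0 : Polynomial.X ^ m i % v = 0
        · simp [h0]
        · exact Polynomial.as_sum_range' _ _ ((Polynomial.natDegree_lt_iff_degree_lt h0).2 hdeg)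
      rw [monomial_eq_mul_incl i, ← mul_assoc]
      have hX : (X i : MvPolynomial P 𝕜) ^ m i =
          Polynomial.aeval (X i) (Polynomial.X ^ m i : Polynomial 𝕜) := by
        simp
      rw [hX, ← map_pow, ← map_pow, ← map_mul, hdiv, mul_add, map_add, add_mul]
      refine Submodule.add_mem_sup (mem_multiples.2 (Dvd.dvd.mul_right ?_ _)) ?_
      · exact map_dvd (Polynomial.aeval (X i))
          (Dvd.intro (Polynomial.X ^ m i / v) (by rw [pow_succ]; ring))
      · rw [hsum, Finset.mul_sum, map_sum, Finset.sum_mul]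
        refine Submodule.sum_mem _ fun t ht => ?_
        have hle := Finset.le_sup (f := fun t => LinearMap.range
          (mulIncl i (Polynomial.aeval (X i : MvPolynomial P 𝕜) (v ^ a * Polynomial.X ^ t)))) ht
        refine hle ⟨(Polynomial.X ^ m i % v).coeff t •
          monomial (m.subtypeDomain (· ≠ i)) x, ?_⟩
        rw [map_smul, mulIncl_apply, mul_left_comm, map_mul _ (Polynomial.C _),
          Polynomial.aeval_C, mul_assoc, ← Algebra.smul_def]

/-- The representation is modified along the diagonal `xᵢ = xⱼ` only by copies of representations
in which the two points are merged. -/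
theorem accAbove_multiples_sub_pow {i j : P} (hij : i ≠ j) (hc : c i = c j)
    (hacc : AccRemove u c j) (a : ℕ) :
    AccAbove (op u c l b) (multiples ((X i - X j : MvPolynomial P 𝕜) ^ a)) := by
  induction a with
  | zero => rw [pow_zero, multiples_one]; exact accAbove_top
  | succ a ih =>
    -- On the diagonal the parameters of i and j add up. The factor (xᵢ - xⱼ)^a is scaled to leading
    -- order by a (zG)' = a (G + z G'), which adds a to both `b` and `l`.
    have hN := negligible_mulIncl (l := l) (b := b)
      (K := multiples ((X i - X j : MvPolynomial P 𝕜) ^ (a + 1))) j hacc ((X i - X j) ^ a)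
      (fun k => if (k : P) = i then l i + l j + a else l k)
      (fun k => if (k : P) = i then b i + b j + a else b k) fun s g f => by
        rw [mem_multiples]
        refine Dvd.dvd.mul_right ?_ (incl 𝕜 _ f)
        have hpot : pot u c l b s g - incl 𝕜 j (pot u (fun j : {k // k ≠ j} => c j)
            (fun k => if (k : P) = i then l i + l j + a else l k)
            (fun k => if (k : P) = i then b i + b j + a else b k) s g) =
            (if c j = s then Polynomial.aeval (X j) (pointPot (l j) (b j) (test u g)) else 0) -
            (if c i = s then
              Polynomial.aeval (X i) (pointPot (l j + a) (b j + a) (test u g)) else 0) := by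
          rw [incl_pot, pot, Fintype.sum_eq_add_sum_subtype_ne _ j, add_sub_assoc,
            ← Finset.sum_sub_distrib, Finset.sum_eq_single ⟨i, hij⟩]
          · simp only [if_true]
            rw [← hc]
            split_ifs
            · simp [pointPot]; ring
            · simp
          · rintro ⟨k, hk⟩ - hki
            have : k ≠ i := fun h => hki (Subtype.ext h)
            simp [this]
          · simp
        rw [hpot, ← hc]
        split_ifs with hs
        · obtain ⟨k, hk⟩ := aeval_eq_taylor (Polynomial.X * test u g) i j
          obtain ⟨k', hk'⟩ := sub_dvd_aeval_sub (pointPot (l j) (b j) (test u g)) i j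
          have hd : vf u c s g (X i - X j) = (X i - X j) *
              (Polynomial.aeval (X i) (Polynomial.derivative (Polynomial.X * test u g)) -
                k * (X i - X j)) := by
            rw [map_sub, vf_X, vf_X, ← hc, if_pos hs, if_pos hs]
            simp only [map_mul, Polynomial.aeval_X] at hk ⊢
            rw [hk]
            ring
          have hp : Polynomial.aeval (X i) (pointPot (l j + a) (b j + a) (test u g)) =
              Polynomial.aeval (X i : MvPolynomial P 𝕜) (pointPot (l j) (b j) (test u g)) +
              (a : MvPolynomial P 𝕜) * Polynomial.aeval (X i)
                (Polynomial.derivative (Polynomial.X * test u g)) := by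
            simp [pointPot]
            ring
          rw [vf_pow_of_eq_mul hd, hp]
          -- `k` is the Taylor error in moving the difference, `k'` the difference quotient of the
          -- zeroth order part at j.
          refine ⟨-(a * k + k'), ?_⟩
          rw [sub_eq_iff_eq_add.1 hk']
          ring
        · have h0 : vf u c s g (X i - X j) = 0 := by
            rw [map_sub, vf_X, vf_X, ← hc, if_neg hs, if_neg hs, sub_zero]
          rw [Derivation.leibniz_pow, h0]
          simp
    refine (hN _ le_rfl (invariant_multiples fun s g =>
      dvd_vf_pow (sub_dvd_vf_sub hc s g) _)).2 (ih.mono fun f hf => ?_)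
    obtain ⟨f, rfl⟩ := mem_multiples.1 hf
    obtain ⟨h, q, rfl⟩ := exists_eq_incl_add hij f
    rw [mul_add, ← mul_assoc, ← pow_succ, add_comm (_ * _)]
    exact Submodule.add_mem_sup (mem_multiples.2 (dvd_mul_right _ _)) ⟨h, rfl⟩

/-! ### Euler operators and the weights 0 and 1 -/

/-- The operator `xᵢ ∂ᵢ + bᵢ`. -/
noncomputable def eul (b : P → 𝕜) (i : P) : Module.End 𝕜 (MvPolynomial P 𝕜) :=
  LinearMap.mulLeft 𝕜 (X i) ∘ₗ
      (pderiv i : Derivation 𝕜 (MvPolynomial P 𝕜) (MvPolynomial P 𝕜)).toLinearMap +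
    b i • LinearMap.id

theorem eul_apply (i : P) (f : MvPolynomial P 𝕜) : eul b i f = X i * pderiv i f + b i • f := rfl

theorem eul_monomial (i : P) (m : P →₀ ℕ) (x : 𝕜) :
    eul b i (monomial m x) = ((m i : 𝕜) + b i) • monomial m x := by
  rw [eul_apply, add_smul]
  congr 1
  rw [pderiv_monomial]
  rcases Nat.eq_zero_or_pos (m i) with h | h
  · simp [h]
  · rw [X, monomial_mul, smul_monomial, add_tsub_cancel_of_le]
    · congr 1; simp [mul_comm]
    · exact Finsupp.single_le_iff.2 h

theorem coeff_eul (i : P) (m : P →₀ ℕ) (f : MvPolynomial P 𝕜) :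
    coeff m (eul b i f) = ((m i : 𝕜) + b i) * coeff m f := by
  induction f using MvPolynomial.induction_on' with
  | add p q hp hq => rw [map_add, coeff_add, coeff_add, hp, hq, mul_add]
  | monomial m' x =>
    rw [eul_monomial, coeff_smul, coeff_monomial, smul_eq_mul]
    split_ifs with h
    · rw [h]
    · simp

/-- The kernel of `xᵢ ∂ᵢ + bᵢ` is negligible if `lᵢ = 0`. -/
theorem negligible_ker_eul [CharZero 𝕜] (i : P) (hl : l i = 0) (hacc : AccRemove u c i) :
    Negligible (op u c l b) ⊥ (LinearMap.ker (eul b i)) := by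
  -- Monomials are eigenvectors, so a kernel exists only if bᵢ = -a for a natural number a, and it
  -- is then xᵢ^a times the polynomials in the other points. There the point i acts by (a + bᵢ) G =
  -- 0, as lᵢ = 0.
  by_cases hb : ∃ a : ℕ, (a : 𝕜) + b i = 0
  · obtain ⟨a, ha⟩ := hb
    have : LinearMap.ker (eul b i) = LinearMap.range (mulIncl i (X i ^ a : MvPolynomial P 𝕜)) := by
      refine le_antisymm (fun f hf => ?_) ?_
      · rw [f.as_sum]
        refine Submodule.sum_mem _ fun m hm => ?_
        have hc := congrArg (coeff m) (LinearMap.mem_ker.1 hf)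
        rw [coeff_eul, coeff_zero] at hc
        have hm' : m i = a := by
          have h1 := (mul_eq_zero.1 hc).resolve_right (mem_support_iff.1 hm)
          exact_mod_cast (add_right_cancel (h1.trans ha.symm) : (m i : 𝕜) = a)
        rw [monomial_eq_mul_incl i, hm']
        exact ⟨_, rfl⟩
      · rintro _ ⟨h, rfl⟩
        induction h using MvPolynomial.induction_on' with
        | add p q hp hq => rw [map_add]; exact Submodule.add_mem _ hp hq
        | monomial m x =>
          rw [LinearMap.mem_ker, mulIncl_apply, incl, rename_monomial, X_pow_eq_monomial,
            monomial_mul, eul_monomial, Finsupp.add_apply, Finsupp.single_eq_same,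
            Finsupp.mapDomain_of_notMem_range _ _ (by simp), add_zero, ha, zero_smul]
    rw [this]
    refine negligible_mulIncl i hacc _ (fun j => l j) (fun j => b j) fun s g f => ?_
    rw [Submodule.mem_bot, pot_sub_incl_pot, ← Polynomial.aeval_X_pow (R := 𝕜), vf_aeval_X]
    split_ifs
    · have hb' : b i = -a := (neg_eq_of_add_eq_zero_right ha).symm
      rw [← map_mul, ← map_add]
      rcases a with _ | a
      · simp [pointPot, hl, hb']
      · simp [pointPot, hl, hb']
        left; ring
    · simp
  · push Not at hb
    have : LinearMap.ker (eul b i) = ⊥ := by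
      refine (Submodule.eq_bot_iff _).2 fun f hf => MvPolynomial.ext _ _ fun m => ?_
      have hc := congrArg (coeff m) (LinearMap.mem_ker.1 hf)
      rw [coeff_eul, coeff_zero] at hc
      exact (mul_eq_zero.1 hc).resolve_left (hb _)
    rw [this]
    exact negligible_bot

/-- `xᵢ ∂ᵢ + bᵢ` intertwines the representations with `lᵢ = 0` and `lᵢ = 1`. -/
theorem op_eul (i : P) (hl : l i = 0) (s : C) (g : Polynomial 𝕜) (f : MvPolynomial P 𝕜) :
    op u c (Function.update l i 1) b (s, g) (eul b i f) = eul b i (op u c l b (s, g) f) := by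
  -- Three discrepancies cancel: raising lᵢ adds z G' to the potential, differentiating the
  -- potential gives bᵢ z G', and commuting the field past xᵢ∂ᵢ gives -z G' xᵢ∂ᵢ.
  have hpot : pot u c (Function.update l i 1) b s g = pot u c l b s g +
      if c i = s then Polynomial.aeval (X i)
        (Polynomial.X * Polynomial.derivative (test u g)) else 0 := by
    rw [pot, pot, Fintype.sum_eq_add_sum_subtype_ne _ i,
      Fintype.sum_eq_add_sum_subtype_ne (fun j => if c j = s then Polynomial.aeval (X j)
        (pointPot (l j) (b j) (test u g)) else 0) i, add_right_comm]
    congr 1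
    · split_ifs
      · simp [pointPot, hl]
      · simp
    · refine Finset.sum_congr rfl fun j _ => ?_
      rw [Function.update_of_ne j.2]
  have hder : X i * pderiv i (pot u c l b s g) = if c i = s then b i • Polynomial.aeval (X i)
        (Polynomial.X * Polynomial.derivative (test u g)) else 0 := by
    rw [pot, map_sum, Finset.sum_eq_single i]
    · split_ifs
      · rw [Derivation.map_aeval]
        simp [pointPot, hl, smul_eq_C_mul, ← algebraMap_eq]
        ring
      · simp
    · intro j _ hj
      split_ifs
      · rw [Derivation.map_aeval, pderiv_X_of_ne hj, smul_zero]
      · simp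
    · simp
  have hcomm : vf u c s g (X i * pderiv i f) = X i * pderiv i (vf u c s g f) -
      if c i = s then Polynomial.aeval (X i)
        (Polynomial.X * Polynomial.derivative (test u g)) * (X i * pderiv i f) else 0 := by
    have h : ⁅vf u c s g, ((X i : MvPolynomial P 𝕜) • pderiv i :
        Derivation 𝕜 (MvPolynomial P 𝕜) (MvPolynomial P 𝕜))⁆ = -((if c i = s then
        Polynomial.aeval (X i) (Polynomial.X * Polynomial.derivative (test u g)) else 0 :
          MvPolynomial P 𝕜) • (X i : MvPolynomial P 𝕜) • (pderiv i :
            Derivation 𝕜 (MvPolynomial P 𝕜) (MvPolynomial P 𝕜))) := by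
      refine MvPolynomial.derivation_ext fun j => ?_
      rw [Derivation.commutator_apply]
      rcases eq_or_ne j i with rfl | hj
      · simp only [Derivation.smul_apply, Derivation.neg_apply, pderiv_X_self, smul_eq_mul,
          mul_one, vf_X]
        split_ifs
        · simp only [Derivation.leibniz, Derivation.map_aeval, pderiv_X_self, smul_eq_mul, map_mul,
            Polynomial.aeval_X]
          ring
        · simp
      · simp only [Derivation.smul_apply, Derivation.neg_apply, pderiv_X_of_ne hj, smul_eq_mul,
          mul_zero, vf_X, map_zero]
        split_ifs
        · simp [Derivation.leibniz, Derivation.map_aeval, pderiv_X_of_ne hj]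
        all_goals simp
    have := congrArg (fun D => D f) h
    simp only [Derivation.commutator_apply, Derivation.smul_apply, Derivation.neg_apply,
      smul_eq_mul] at this
    rw [sub_eq_iff_eq_add.1 this]
    split_ifs <;> ring
  rw [op_apply, op_apply, eul_apply, eul_apply, hpot, map_add, hcomm, map_add, Derivation.leibniz,
    Derivation.map_smul, smul_eq_mul, smul_eq_mul, mul_add (X i), mul_add (X i),
    mul_left_comm (X i) f, hder]
  split_ifs
  · simp only [smul_eq_C_mul]; ring
  · simp only [smul_eq_C_mul]; ring

/-- Weights `lᵢ = 1` can be replaced by `lᵢ = 0`. -/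
theorem accAbove_update_one [CharZero 𝕜] (i : P) (hl : l i = 0) (hacc : AccRemove u c i)
    (h : AccAbove (op u c l b) ⊥) : AccAbove (op u c (Function.update l i 1) b) ⊥ := by
  have h1 : Negligible (op u c (Function.update l i 1) b) ⊥ (LinearMap.range (eul b i)) :=
    negligible_range (eul b i) (fun ⟨s, g⟩ f => by
      rw [Submodule.mem_bot, op_eul i hl, sub_self]) h
  have hbot : Invariant (op u c (Function.update l i 1) b) ⊥ := fun _ x hx => by
    rw [Submodule.mem_bot] at hx ⊢; rw [hx, map_zero]
  obtain ⟨h2, h3⟩ := h1 ⊥ le_rfl hbot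
  refine h3 ?_
  rw [bot_sup_eq] at h2 ⊢
  have hmem (m : P →₀ ℕ) (x : 𝕜) (hm : (m i : 𝕜) + b i ≠ 0) :
      monomial m x ∈ LinearMap.range (eul b i) :=
    ⟨((m i : 𝕜) + b i)⁻¹ • monomial m x, by
      rw [map_smul, eul_monomial, smul_smul, inv_mul_cancel₀ hm, one_smul]⟩
  by_cases hb : ∃ a : ℕ, (a : 𝕜) + b i = 0
  · obtain ⟨a, ha⟩ := hb
    -- The cokernel is represented by xᵢ^a h with h free of xᵢ. The point i acts trivially on it:
    -- the defect of equivariance is the Euler image of G(xᵢ) xᵢ^a h.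
    refine (negligible_mulIncl i hacc (X i ^ a) (fun j => Function.update l i 1 j) (fun j => b j)
      ?_ _
      le_rfl h2).2
      (accAbove_top.mono fun f _ => ?_)
    · intro s g f
      rw [pot_sub_incl_pot, ← Polynomial.aeval_X_pow (R := 𝕜), vf_aeval_X]
      split_ifs
      · refine ⟨Polynomial.aeval (X i) (test u g * Polynomial.X ^ a) * incl 𝕜 i f, ?_⟩
        rw [eul_apply, Derivation.leibniz, pderiv_incl, Derivation.map_aeval, pderiv_X_self,
          smul_zero, zero_add, smul_eq_C_mul, ← algebraMap_eq, ← Polynomial.aeval_C (X i)]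
        have he : Polynomial.X * Polynomial.derivative (test u g * Polynomial.X ^ a) +
            Polynomial.C (b i) * (test u g * Polynomial.X ^ a) =
            Polynomial.derivative (Polynomial.X ^ a) * (Polynomial.X * test u g) +
            pointPot 1 (b i) (test u g) * Polynomial.X ^ a := by
          simp [pointPot]
          ring
        simp only [Function.update_self]
        rw [← map_mul, ← map_add, ← he]
        simp only [smul_eq_mul, mul_one, map_add, map_mul, Polynomial.aeval_X]
        ring
      · simp
    · rw [f.as_sum]
      refine Submodule.sum_mem _ fun m _ => ?_
      by_cases hm : m i = a
      · refine Submodule.mem_sup_right ?_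
        rw [monomial_eq_mul_incl i, hm]
        exact ⟨_, rfl⟩
      · refine Submodule.mem_sup_left (hmem _ _ fun h => hm ?_)
        exact_mod_cast (add_right_cancel (h.trans ha.symm) : (m i : 𝕜) = a)
  · push Not at hb
    refine accAbove_top.mono fun f _ => ?_
    rw [f.as_sum]
    exact Submodule.sum_mem _ fun m _ => hmem _ _ (hb _)

/-! ### Polarised operators -/

/-- Polynomials in the coordinates of the points and in two auxiliary variables per point. -/
abbrev Polar (P 𝕜 : Type*) [Field 𝕜] : Type _ := MvPolynomial (P ⊕ (P × Bool)) 𝕜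

/-- The coordinate of a point. -/
noncomputable def px (i : P) : Polar P 𝕜 := X (Sum.inl i)

/-- The auxiliary variable of a slot. -/
noncomputable def py (a : P × Bool) : Polar P 𝕜 := X (Sum.inr a)

/-- Polynomials in the coordinates of the points. -/
noncomputable def inX : MvPolynomial P 𝕜 →ₐ[𝕜] Polar P 𝕜 := rename Sum.inl

/-- Polynomials in the auxiliary variables. -/
noncomputable def inY : MvPolynomial (P × Bool) 𝕜 →ₐ[𝕜] Polar P 𝕜 := rename Sum.inr

/-- The substitution of `xᵢ` for the auxiliary variable of the slot `a`. -/
noncomputable def sub (a : P × Bool) (i : P) : Polar P 𝕜 →ₐ[𝕜] Polar P 𝕜 :=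
  aeval (Sum.elim px fun e => if e = a then px i else py e)

/-- The derivation `xᵢ ∂ᵢ + t y_a ∂_{y_a}`. -/
noncomputable def der (t : 𝕜) (a : P × Bool) (i : P) : Derivation 𝕜 (Polar P 𝕜) (Polar P 𝕜) :=
  mkDerivation 𝕜 (Sum.elim (fun j => if j = i then px i else 0)
    fun a' => if a' = a then t • py a else 0)

theorem sub_px (a : P × Bool) (i j : P) : sub (𝕜 := 𝕜) a i (px j) = px j := by
  simp [sub, px]

theorem sub_py (a a' : P × Bool) (i : P) :
    sub (𝕜 := 𝕜) a i (py a') = if a' = a then px i else py a' := by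
  simp [sub, py]

theorem sub_inX (a : P × Bool) (i : P) (f : MvPolynomial P 𝕜) : sub a i (inX f) = inX f := by
  have h : (sub (𝕜 := 𝕜) a i).comp inX = inX := by
    ext j
    simp [sub, inX, px]
  exact DFunLike.congr_fun h f

theorem der_px (t : 𝕜) (a : P × Bool) (i j : P) :
    der t a i (px j) = if j = i then px i else 0 := by
  simp [der, px]

theorem der_py (t : 𝕜) (a a' : P × Bool) (i : P) :
    der t a i (py a') = if a' = a then t • py a else 0 := by
  simp [der, py]

theorem der_inX (t : 𝕜) (a : P × Bool) (i : P) (f : MvPolynomial P 𝕜) :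
    der t a i (inX f) = inX (X i * pderiv i f) := by
  induction f using MvPolynomial.induction_on with
  | C x => simp [inX, ← algebraMap_eq]
  | add p q hp hq => simp only [map_add, hp, hq, mul_add]
  | mul_X p j hp =>
    have hX (k : P) : inX (X k : MvPolynomial P 𝕜) = px k := by simp [inX, px]
    rw [map_mul, Derivation.leibniz, hp, Derivation.leibniz, hX, der_px]
    rcases eq_or_ne j i with rfl | h
    · simp only [if_true, pderiv_X_self, smul_eq_mul, map_mul, map_add, hX, map_one]
      ring
    · simp only [if_neg h, pderiv_X_of_ne h, smul_eq_mul, map_mul, map_add, hX, map_zero]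
      ring

/-- The operator `xᵢ ∂ᵢ + bᵢ` twisted by the variable of the slot `a`, followed by the substitution
of `xᵢ` for that variable. -/
noncomputable def polar (u : Polynomial 𝕜) (l b : P → 𝕜) (a : P × Bool) (i : P) :
    Module.End 𝕜 (Polar P 𝕜) :=
  (sub a i).toLinearMap ∘ₗ ((der (l i) a i).toLinearMap + b i • LinearMap.id) ∘ₗ
    LinearMap.mulLeft 𝕜 (Polynomial.aeval (py a) (Polynomial.X * u ^ 2))

theorem polar_def (a : P × Bool) (i : P) (H : Polar P 𝕜) : polar u l b a i H =
    sub a i (der (l i) a i (Polynomial.aeval (py a) (Polynomial.X * u ^ 2) * H) +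
      b i • (Polynomial.aeval (py a) (Polynomial.X * u ^ 2) * H)) := rfl

theorem polar_apply (a : P × Bool) (i : P) (H : Polar P 𝕜) : polar u l b a i H =
    Polynomial.aeval (px i) (Polynomial.X * u ^ 2) * sub a i (der (l i) a i H + b i • H) +
    l i • Polynomial.aeval (px i)
      (Polynomial.X * Polynomial.derivative (Polynomial.X * u ^ 2)) * sub a i H := by
  have hs (p : Polynomial 𝕜) : sub a i (Polynomial.aeval (py a) p) =
      Polynomial.aeval (px i : Polar P 𝕜) p := by
    rw [← Polynomial.aeval_algHom_apply, sub_py, if_pos rfl]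
  rw [polar_def, Derivation.leibniz, Derivation.map_aeval, der_py, if_pos rfl]
  simp only [map_add, map_smul, smul_eq_mul, map_mul, hs, sub_py, if_true, Polynomial.aeval_X,
    mul_add, smul_mul_assoc, mul_smul_comm]
  rw [add_right_comm, mul_comm (sub a i H),
    mul_comm _ (px i : Polar P 𝕜)]

theorem polar_of_eq_zero {i : P} (hl : l i = 0) (a : P × Bool) (H : Polar P 𝕜) :
    polar u l b a i H =
      Polynomial.aeval (px i) (Polynomial.X * u ^ 2) * sub a i (der 0 a i H + b i • H) := by
  rw [polar_apply, hl, zero_smul, zero_mul, add_zero]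

/-- A factor `(y - y')²` at a point of weight `lᵢ`. -/
theorem polar_polar_sq (p i : P) (H : Polar P 𝕜) :
    polar u l b (p, false) i (polar u l b (p, true) i ((py (p, false) - py (p, true)) ^ 2 * H)) =
      (2 * l i * (1 - l i)) • (Polynomial.aeval (px i) (Polynomial.X * u) ^ 4) *
        sub (p, false) i (sub (p, true) i H) := by
  have hX : (Polynomial.aeval (px i : Polar P 𝕜)) (Polynomial.X * u) ^ 4 =
      px i ^ 2 * Polynomial.aeval (px i) (Polynomial.X * u ^ 2) ^ 2 := by
    simp only [map_mul, map_pow, Polynomial.aeval_X]; ring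
  rw [hX]
  set w : Polar P 𝕜 := Polynomial.aeval (px i) (Polynomial.X * u ^ 2) with hw
  have hsw : sub (p, false) i w = w := by
    rw [hw, ← Polynomial.aeval_algHom_apply, sub_px]
  -- Each operator must remove one factor of (y - y')², otherwise the final substitution gives 0.
  -- The first contributes -2 l x, the second turns y - x into (l - 1) x.
  rw [polar_apply (p, true), polar_apply (p, false)]
  simp only [Derivation.leibniz, Derivation.leibniz_pow, map_sub, der_py, sub_py,
    map_add, map_mul, map_pow, map_smul, smul_eq_mul, ← hw, hsw]
  simp [smul_eq_C_mul, sub_py, sub_px, der_px, der_py]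
  ring_nf
  simp only [map_ofNat]
  ring

/-- A factor `y (y - y')` at a point of weight `0`. -/
theorem polar_polar_of_eq_zero (p : P) {i : P} (hl : l i = 0) (H : Polar P 𝕜) :
    polar u l b (p, false) i (polar u l b (p, true) i
        (py (p, false) * (py (p, false) - py (p, true)) * H)) =
      (-1 : 𝕜) • (Polynomial.aeval (px i) (Polynomial.X * u) ^ 4) *
        sub (p, false) i (sub (p, true) i (der 0 (p, true) i H + b i • H)) := by
  have hX : (Polynomial.aeval (px i : Polar P 𝕜)) (Polynomial.X * u) ^ 4 =
      px i ^ 2 * Polynomial.aeval (px i) (Polynomial.X * u ^ 2) ^ 2 := by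
    simp only [map_mul, map_pow, Polynomial.aeval_X]; ring
  rw [hX]
  set w : Polar P 𝕜 := Polynomial.aeval (px i) (Polynomial.X * u ^ 2) with hw
  have hsw : sub (p, false) i w = w := by
    rw [hw, ← Polynomial.aeval_algHom_apply, sub_px]
  -- At weight 0 the first operator does not differentiate y', so it acts on `H`. The second must
  -- then spend its derivative on y - x, which becomes -x.
  rw [polar_of_eq_zero hl (p, true), polar_of_eq_zero hl (p, false)]
  simp only [Derivation.leibniz, map_sub, der_py, sub_py,
    map_add, map_mul, map_smul, smul_eq_mul, ← hw, hsw]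
  simp [smul_eq_C_mul, sub_py, sub_px, der_px, der_py, ← algebraMap_eq]
  ring

/-- A power of `Z` decreases by at most one. -/
theorem pow_dvd_polar (a : P × Bool) (i : P) {Z H : Polar P 𝕜} {m : ℕ} (h : Z ^ (m + 1) ∣ H) :
    sub a i Z ^ m ∣ polar u l b a i H := by
  obtain ⟨H, rfl⟩ := h
  have h1 : Z ^ m ∣ Z ^ (m + 1) * H := (pow_dvd_pow Z (Nat.le_succ m)).mul_right H
  have h2 : Z ^ m ∣ der (l i) a i (Z ^ (m + 1) * H) := by
    rw [Derivation.leibniz, Derivation.leibniz_pow, Nat.add_sub_cancel, smul_eq_mul, smul_eq_mul]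
    refine dvd_add ((pow_dvd_pow Z (Nat.le_succ m)).mul_right _) (Dvd.dvd.mul_left ?_ _)
    rw [nsmul_eq_mul]
    exact Dvd.dvd.mul_left (dvd_mul_right _ _) _
  rw [polar_apply, ← map_pow, smul_eq_C_mul, smul_eq_C_mul]
  exact dvd_add (Dvd.dvd.mul_left (map_dvd _ (dvd_add h2 (h1.mul_left _))) _)
    (Dvd.dvd.mul_left (map_dvd _ h1) _)

theorem derivation_eq_sum (D : Derivation 𝕜 (MvPolynomial P 𝕜) (MvPolynomial P 𝕜))
    (f : MvPolynomial P 𝕜) : D f = ∑ j, D (X j) * pderiv j f := by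
  have h : D = ∑ j, D (X j) • (pderiv j :
      Derivation 𝕜 (MvPolynomial P 𝕜) (MvPolynomial P 𝕜)) := by
    refine MvPolynomial.derivation_ext fun i => ?_
    rw [← Derivation.coeFnAddMonoidHom_apply (∑ j, D (X j) • _), map_sum, Finset.sum_apply]
    simp [pderiv_X, Pi.single_apply]
  conv_lhs => rw [h]
  rw [← Derivation.coeFnAddMonoidHom_apply (∑ j, D (X j) • _), map_sum, Finset.sum_apply]
  simp

theorem op_eq_sum (s : C) (g : Polynomial 𝕜) (f : MvPolynomial P 𝕜) : op u c l b (s, g) f =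
    ∑ i, if c i = s then Polynomial.aeval (X i) (test u g) * (X i * pderiv i f) +
      Polynomial.aeval (X i) (pointPot (l i) (b i) (test u g)) * f else 0 := by
  rw [op_apply, derivation_eq_sum, pot, Finset.sum_mul, ← Finset.sum_add_distrib]
  refine Finset.sum_congr rfl fun i _ => ?_
  rw [vf_X]
  split_ifs <;> ring

/-- The operator `polar u l b a i`, if `i` has the colour of the slot `a`. -/
noncomputable def cpolar (u : Polynomial 𝕜) (c : P → C) (l b : P → 𝕜) (a : P × Bool) (i : P) :
    Module.End 𝕜 (Polar P 𝕜) :=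
  if c i = c a.1 then polar u l b a i else 0

/-- The span of the products of elements of `N` and polynomials in the auxiliary variables. -/
noncomputable def polarSpan (N : Submodule 𝕜 (MvPolynomial P 𝕜)) : Submodule 𝕜 (Polar P 𝕜) :=
  Submodule.span 𝕜 {H | ∃ n ∈ N, ∃ m : P × Bool →₀ ℕ, H = inX n * inY (monomial m 1)}

theorem inX_mul_inY_mem {N : Submodule 𝕜 (MvPolynomial P 𝕜)} {n : MvPolynomial P 𝕜} (hn : n ∈ N)
    (F : MvPolynomial (P × Bool) 𝕜) : inX n * inY F ∈ polarSpan N := by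
  induction F using MvPolynomial.induction_on' with
  | add p q hp hq => rw [map_add, mul_add]; exact Submodule.add_mem _ hp hq
  | monomial m x =>
    have : (monomial m x : MvPolynomial (P × Bool) 𝕜) = x • monomial m 1 := by
      rw [smul_monomial, smul_eq_mul, mul_one]
    rw [this, map_smul, mul_smul_comm]
    exact Submodule.smul_mem _ _ (Submodule.subset_span ⟨n, hn, m, rfl⟩)

theorem sub_inY_of_notMem (a : P × Bool) (i : P) (m : P × Bool →₀ ℕ) (hm : m a = 0) (t x : 𝕜) :
    sub a i (inY (monomial m x)) = inY (monomial m x) ∧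
      der t a i (inY (monomial m x)) = 0 := by
  induction m using Finsupp.induction with
  | zero => simp [inY, ← algebraMap_eq]
  | single_add a' e m' h1 h2 ih =>
    have ha : a' ≠ a := by
      rintro rfl
      simp [h2] at hm
    have hm' : m' a = 0 := by
      simpa [ha] using hm
    have hy : inY (X a' : MvPolynomial (P × Bool) 𝕜) = py a' := by simp [inY, py]
    rw [monomial_single_add, map_mul, map_pow, map_mul, map_pow, hy, Derivation.leibniz,
      Derivation.leibniz_pow, sub_py, der_py, if_neg ha, if_neg ha, (ih hm').1, (ih hm').2]
    simp

/-- The auxiliary variable is a generating variable for test functions: on n y_a^k times the other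
slots, the sum over the points of the right colour is `op` for g = z^k applied to n. -/
theorem sum_cpolar_mem {N : Submodule 𝕜 (MvPolynomial P 𝕜)} (hN : Invariant (op u c l b) N)
    (a : P × Bool) {H : Polar P 𝕜} (hH : H ∈ polarSpan N) :
    (∑ i, cpolar u c l b a i) H ∈ polarSpan N := by
  induction hH using Submodule.span_induction with
  | zero => rw [map_zero]; exact zero_mem _
  | add _ _ _ _ h1 h2 => rw [map_add]; exact add_mem h1 h2
  | smul x _ _ h => rw [map_smul]; exact Submodule.smul_mem _ _ h
  | mem H h =>
    obtain ⟨n, hn, m, rfl⟩ := h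
    have hy : inY (X a : MvPolynomial (P × Bool) 𝕜) = py a := by simp [inY, py]
    have hx (i : P) : inX (X i : MvPolynomial P 𝕜) = px i := by simp [inX, px]
    have hm : inY (monomial m (1 : 𝕜)) = py a ^ m a * inY (monomial (m.erase a) 1) := by
      rw [← hy, ← map_pow, ← map_mul, ← monomial_single_add, Finsupp.single_add_erase]
    have key : (∑ i, cpolar u c l b a i) (inX n * inY (monomial m 1)) =
        inX (op u c l b (c a.1, Polynomial.X ^ m a) n) * inY (monomial (m.erase a) 1) := by
      rw [op_eq_sum, map_sum, Finset.sum_mul, LinearMap.sum_apply]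
      refine Finset.sum_congr rfl fun i _ => ?_
      rw [cpolar]
      split_ifs
      · obtain ⟨h1, h2⟩ := sub_inY_of_notMem a i (m.erase a) Finsupp.erase_same (l i) (1 : 𝕜)
        have hI (p : Polynomial 𝕜) : inX (Polynomial.aeval (X i) p) =
            Polynomial.aeval (px i : Polar P 𝕜) p := by
          rw [← Polynomial.aeval_algHom_apply, hx]
        have hs (p : Polynomial 𝕜) : sub a i (Polynomial.aeval (py a) p) =
            Polynomial.aeval (px i : Polar P 𝕜) p := by
          rw [← Polynomial.aeval_algHom_apply, sub_py, if_pos rfl]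
        have hp : Polynomial.aeval (py a) (Polynomial.X * u ^ 2) *
            (inX n * (py a ^ m a * inY (monomial (m.erase a) 1))) =
            Polynomial.aeval (py a) (test u (Polynomial.X ^ m a)) * (inX n *
              inY (monomial (m.erase a) 1)) := by
          simp only [test, map_mul, map_pow, Polynomial.aeval_X]; ring
        rw [hm, polar_def, hp]
        simp only [Derivation.leibniz, Derivation.map_aeval, der_py, if_true, h2, der_inX, map_add,
          map_mul, smul_eq_mul, sub_inX, h1, hs, hI, sub_py, pointPot,
          Polynomial.aeval_C, Polynomial.aeval_X, mul_zero, zero_add, hx, Algebra.smul_def]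
        simp only [sub_px, AlgHom.commutes]
        ring
      · simp
    rw [key]
    exact inX_mul_inY_mem (hN _ _ hn) _

/-- Setting the auxiliary variables to zero. -/
noncomputable def dropY : Polar P 𝕜 →ₐ[𝕜] MvPolynomial P 𝕜 := aeval (Sum.elim X 0)

theorem dropY_inX (f : MvPolynomial P 𝕜) : dropY (inX f) = f := by
  have h : (dropY (P := P) (𝕜 := 𝕜)).comp inX = AlgHom.id 𝕜 _ := by
    ext j
    simp [dropY, inX]
  exact DFunLike.congr_fun h f

theorem dropY_inY (F : MvPolynomial (P × Bool) 𝕜) :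
    dropY (inY F : Polar P 𝕜) = MvPolynomial.C (constantCoeff F) := by
  rw [dropY, inY, aeval_rename, Sum.elim_comp_inr, aeval_zero]
  rfl

theorem dropY_mem {N : Submodule 𝕜 (MvPolynomial P 𝕜)} {H : Polar P 𝕜} (hH : H ∈ polarSpan N) :
    dropY H ∈ N := by
  induction hH using Submodule.span_induction with
  | zero => rw [map_zero]; exact zero_mem _
  | add _ _ _ _ h1 h2 => rw [map_add]; exact add_mem h1 h2
  | smul x _ _ h => rw [map_smul]; exact Submodule.smul_mem _ _ h
  | mem H h =>
    obtain ⟨n, hn, m, rfl⟩ := h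
    rw [map_mul, dropY_inX, dropY_inY, mul_comm, ← smul_eq_C_mul]
    exact N.smul_mem _ hn

/-! ### Products of polarised operators over all points -/

/-- The operator that processes the two slots of `p` with the points `x.1` and `x.2`. -/
noncomputable def block (u : Polynomial 𝕜) (c : P → C) (l b : P → 𝕜) (p : P) (x : P × P) :
    Module.End 𝕜 (Polar P 𝕜) :=
  cpolar u c l b (p, false) x.1 * cpolar u c l b (p, true) x.2

theorem sum_block (p : P) : ∑ x, block u c l b p x =
    (∑ i, cpolar u c l b (p, false) i) * ∑ i, cpolar u c l b (p, true) i := by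
  rw [Fintype.sum_prod_type, Finset.sum_mul_sum]
  rfl

theorem list_prod_sum_block_mem {N : Submodule 𝕜 (MvPolynomial P 𝕜)}
    (hN : Invariant (op u c l b) N) (L : List P) {H : Polar P 𝕜} (hH : H ∈ polarSpan N) :
    (L.map fun p => ∑ x, block u c l b p x).prod H ∈ polarSpan N := by
  induction L with
  | nil => exact hH
  | cons p L ih =>
    rw [List.map_cons, List.prod_cons, sum_block]
    exact sum_cpolar_mem hN _ (sum_cpolar_mem hN _ ih)

theorem ofFn_prod_sum {R A : Type*} [Semiring R] [Fintype A] {n : ℕ} (f : Fin n → A → R) :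
    (List.ofFn fun k => ∑ x, f k x).prod =
      ∑ φ : Fin n → A, (List.ofFn fun k => f k (φ k)).prod := by
  induction n with
  | zero => simp
  | succ n ih =>
    rw [List.ofFn_succ, List.prod_cons, ih, Finset.sum_mul_sum, ← Fintype.sum_prod_type',
      ← (Fin.consEquiv fun _ => A).sum_comp]
    refine Finset.sum_congr rfl fun x _ => ?_
    simp [List.ofFn_succ, Fin.consEquiv]

/-- A term of the expansion chooses a pair of points for every p. The order of the factors is kept,
as they need not commute. -/
theorem list_prod_sum {R A : Type*} [Semiring R] [Fintype A] (f : P → A → R) {L : List P}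
    (hL : L.Nodup) (hL' : ∀ p, p ∈ L) :
    (L.map fun p => ∑ x, f p x).prod = ∑ φ : P → A, (L.map fun p => f p (φ p)).prod := by
  have h (g : P → R) : L.map g = List.ofFn fun k => g (L.get k) := by
    conv_lhs => rw [← List.ofFn_get L, List.map_ofFn]
    rfl
  rw [h, ofFn_prod_sum,
    ← ((hL.getEquivOfForallMemList L hL').arrowCongr (Equiv.refl A)).symm.sum_comp]
  refine Finset.sum_congr rfl fun φ _ => ?_
  rw [h]
  rfl

/-- The point assigned to a slot. -/
def slotPoint (φ : P → P × P) (a : P × Bool) : P := cond a.2 (φ a.1).2 (φ a.1).1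

/-- The substitution for the two slots of `p`. -/
noncomputable def subBlock (φ : P → P × P) (p : P) : Polar P 𝕜 →ₐ[𝕜] Polar P 𝕜 :=
  (sub (p, false) (φ p).1).comp (sub (p, true) (φ p).2)

/-- The substitution for the slots of all `p ∈ L`. -/
noncomputable def subList (φ : P → P × P) : List P → (Polar P 𝕜 →ₐ[𝕜] Polar P 𝕜)
  | [] => AlgHom.id 𝕜 _
  | p :: L => (subBlock φ p).comp (subList φ L)

theorem subBlock_px (φ : P → P × P) (p i : P) : subBlock (𝕜 := 𝕜) φ p (px i) = px i := by
  simp [subBlock, sub_px]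

theorem subBlock_inX (φ : P → P × P) (p : P) (f : MvPolynomial P 𝕜) :
    subBlock (𝕜 := 𝕜) φ p (inX f) = inX f := by
  simp [subBlock, sub_inX]

theorem subBlock_py (φ : P → P × P) (p : P) (a : P × Bool) :
    subBlock (𝕜 := 𝕜) φ p (py a) = if a.1 = p then px (slotPoint φ a) else py a := by
  obtain ⟨q, t⟩ := a
  by_cases h : q = p
  · subst h
    cases t <;> simp [subBlock, sub_py, slotPoint, sub_px]
  · simp [subBlock, sub_py, h]

theorem subList_px (φ : P → P × P) (L : List P) (i : P) :
    subList (𝕜 := 𝕜) φ L (px i) = px i := by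
  induction L with
  | nil => rfl
  | cons p L ih => rw [subList, AlgHom.comp_apply, ih, subBlock_px]

theorem subList_inX (φ : P → P × P) (L : List P) (f : MvPolynomial P 𝕜) :
    subList (𝕜 := 𝕜) φ L (inX f) = inX f := by
  induction L with
  | nil => rfl
  | cons p L ih => rw [subList, AlgHom.comp_apply, ih, subBlock_inX]

theorem subList_py (φ : P → P × P) (L : List P) (a : P × Bool) :
    subList (𝕜 := 𝕜) φ L (py a) = if a.1 ∈ L then px (slotPoint φ a) else py a := by
  induction L with
  | nil => rfl
  | cons p L ih =>
    rw [subList, AlgHom.comp_apply, ih, apply_ite (subBlock φ p), subBlock_px, subBlock_py]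
    by_cases h : a.1 = p <;> by_cases h' : a.1 ∈ L <;> simp [h, h']

theorem pow_dvd_cpolar (a : P × Bool) (i : P) {Z H : Polar P 𝕜} {m : ℕ} (h : Z ^ (m + 1) ∣ H) :
    sub a i Z ^ m ∣ cpolar u c l b a i H := by
  rw [cpolar]
  split_ifs
  · exact pow_dvd_polar a i h
  · exact dvd_zero _

theorem pow_dvd_block (φ : P → P × P) (p : P) {Z H : Polar P 𝕜} {m : ℕ} (h : Z ^ (m + 2) ∣ H) :
    subBlock φ p Z ^ m ∣ block u c l b p (φ p) H := by
  rw [block, Module.End.mul_apply, subBlock, AlgHom.comp_apply]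
  exact pow_dvd_cpolar _ _ (pow_dvd_cpolar (m := m + 1) _ _ h)

/-- Each block consists of two first order operators and so costs at most two powers, while `Z` is
carried along by the substitutions. -/
theorem pow_dvd_list_prod_block (φ : P → P × P) (L : List P) {Z H : Polar P 𝕜} {m : ℕ}
    (h : Z ^ (m + 2 * L.length) ∣ H) :
    subList φ L Z ^ m ∣ (L.map fun p => block u c l b p (φ p)).prod H := by
  induction L generalizing m with
  | nil => exact h
  | cons p L ih =>
    rw [List.map_cons, List.prod_cons, Module.End.mul_apply, subList, AlgHom.comp_apply]
    refine pow_dvd_block φ p (ih (m := m + 2) ?_)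
    rwa [List.length_cons, mul_add, mul_one, add_comm (2 * _), ← add_assoc] at h

/-- One power outlives all 2|L| operators, and the substitution then turns y_a - y_a' into zero. -/
theorem list_prod_block_eq_zero_of_slotPoint_eq (φ : P → P × P) (L : List P) (hL : ∀ p, p ∈ L)
    {a a' : P × Bool} (ha : slotPoint φ a = slotPoint φ a') {H : Polar P 𝕜}
    (h : (py a - py a') ^ (1 + 2 * L.length) ∣ H) :
    (L.map fun p => block u c l b p (φ p)).prod H = 0 := by
  have := pow_dvd_list_prod_block (u := u) (c := c) (l := l) (b := b) φ L h
  rwa [map_sub, subList_py, subList_py, if_pos (hL _), if_pos (hL _), ha, sub_self, pow_one,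
    zero_dvd_iff] at this

theorem list_prod_block_eq_zero_of_color_ne (φ : P → P × P) (L : List P) (hL : ∀ p, p ∈ L)
    {a : P × Bool} (ha : c (slotPoint φ a) ≠ c a.1) :
    (L.map fun p => block u c l b p (φ p)).prod = 0 := by
  refine List.prod_eq_zero (List.mem_map.2 ⟨a.1, hL _, ?_⟩)
  obtain ⟨p, t⟩ := a
  change block u c l b p (φ p) = 0
  cases t
  · have h : cpolar u c l b (p, false) (φ p).1 = 0 := if_neg ha
    rw [block, h, zero_mul]
  · have h : cpolar u c l b (p, true) (φ p).2 = 0 := if_neg ha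
    rw [block, h, mul_zero]

open Classical in
/-- The scalar contributed by a slot pair processed at a point of weight `t`. -/
noncomputable def blockScalar (t : 𝕜) : 𝕜 := if t = 0 then -1 else 2 * t * (1 - t)

/-- The polynomial `(xᵢ u(xᵢ))⁴`. -/
noncomputable def blockPoly (u : Polynomial 𝕜) (i : P) : MvPolynomial P 𝕜 :=
  Polynomial.aeval (X i) (Polynomial.X * u) ^ 4

theorem inX_blockPoly (i : P) : inX (blockPoly u i) =
    (Polynomial.aeval (px i : Polar P 𝕜) (Polynomial.X * u)) ^ 4 := by
  rw [blockPoly, map_pow, ← Polynomial.aeval_algHom_apply]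
  simp [inX, px]

/-- A square (y - y')² absorbs both derivatives of its block, which is left as a multiplication and
a substitution. Blocks of other points do not touch the slots of p. -/
theorem list_prod_block_sq {τ : P → P} (hτ : ∀ p, c (τ p) = c p) (L : List P) (hL : L.Nodup)
    (J : Polar P 𝕜) :
    (L.map fun p => block u c l b p (τ p, τ p)).prod
        ((L.map fun p => (py (p, false) - py (p, true)) ^ 2).prod * J) =
      inX ((L.map fun p => (2 * l (τ p) * (1 - l (τ p))) • blockPoly u (τ p)).prod) *
        subList (fun p => (τ p, τ p)) L J := by
  induction L generalizing J with
  | nil => simp [subList]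
  | cons p L ih =>
    have hp : p ∉ L := (List.nodup_cons.1 hL).1
    simp only [List.map_cons, List.prod_cons, Module.End.mul_apply]
    rw [mul_assoc, mul_left_comm, ih (List.nodup_cons.1 hL).2, map_mul (subList _ L),
      map_pow (subList _ L), map_sub (subList _ L), subList_py, subList_py, if_neg hp, if_neg hp,
      mul_left_comm, block, Module.End.mul_apply, cpolar, cpolar, if_pos (hτ p), if_pos (hτ p),
      polar_polar_sq, subList, AlgHom.comp_apply,
      map_mul (sub (p, true) _), sub_inX, map_mul (sub (p, false) _), sub_inX, map_mul inX,
      map_smul, inX_blockPoly, subBlock, AlgHom.comp_apply]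
    ring

/-- The derivation `xᵢ ∂ᵢ` of the polarised ring. -/
noncomputable def eulX (i : P) : Derivation 𝕜 (Polar P 𝕜) (Polar P 𝕜) :=
  mkDerivation 𝕜 (Sum.elim (fun j => if j = i then px i else 0) 0)

theorem der_zero (a : P × Bool) (i : P) : der (0 : 𝕜) a i = eulX i := by
  rw [der, eulX]
  congr 2
  ext a'
  simp

theorem eulX_px (i j : P) : eulX (𝕜 := 𝕜) i (px j) = if j = i then px i else 0 := by
  simp [eulX, px]

theorem eulX_py (i : P) (a : P × Bool) : eulX (𝕜 := 𝕜) i (py a) = 0 := by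
  simp [eulX, py]

theorem eulX_inX (i : P) (f : MvPolynomial P 𝕜) : eulX i (inX f) = inX (X i * pderiv i f) := by
  rw [← der_zero (i, false), der_inX]

theorem eulX_inY (i : P) (F : MvPolynomial (P × Bool) 𝕜) : eulX i (inY F) = 0 := by
  induction F using MvPolynomial.induction_on with
  | C x => simp [inY, ← algebraMap_eq]
  | add p q hp hq => simp only [map_add, hp, hq, add_zero]
  | mul_X p a hp =>
    have hy : inY (X a : MvPolynomial (P × Bool) 𝕜) = py a := by simp [inY, py]
    rw [map_mul, Derivation.leibniz, hp, hy, eulX_py, smul_zero, smul_zero, add_zero]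

/-- Substituting points different from i creates no new dependence on xᵢ. -/
theorem eulX_subBlock (φ : P → P × P) (p i : P) (hi : (φ p).1 ≠ i) (hi' : (φ p).2 ≠ i)
    (H : Polar P 𝕜) : eulX i (subBlock φ p H) = subBlock φ p (eulX i H) := by
  induction H using MvPolynomial.induction_on with
  | C x => simp [← algebraMap_eq]
  | add p q hp hq => simp only [map_add, hp, hq]
  | mul_X H j hp =>
    rw [map_mul, Derivation.leibniz, Derivation.leibniz, hp, map_add, smul_eq_mul, smul_eq_mul,
      smul_eq_mul, smul_eq_mul, map_mul, map_mul]
    congr 2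
    rcases j with j | ⟨q, t⟩
    · change eulX i (subBlock φ p (px j)) = subBlock φ p (eulX i (px j))
      rw [subBlock_px, eulX_px]
      split_ifs
      · rw [subBlock_px]
      · rw [map_zero]
    · change eulX i (subBlock φ p (py (q, t))) = subBlock φ p (eulX i (py (q, t)))
      rw [subBlock_py, eulX_py, map_zero]
      split_ifs with h
      · have h : q = p := h
        subst h
        cases t <;> simp [slotPoint, eulX_px, hi, hi']
      · exact eulX_py _ _

theorem eulX_subList (φ : P → P × P) (L : List P) (i : P)
    (hi : ∀ p ∈ L, (φ p).1 ≠ i ∧ (φ p).2 ≠ i) (H : Polar P 𝕜) :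
    eulX i (subList φ L H) = subList φ L (eulX i H) := by
  induction L with
  | nil => rfl
  | cons p L ih =>
    have h := hi p List.mem_cons_self
    rw [subList, AlgHom.comp_apply, AlgHom.comp_apply, eulX_subBlock φ p i h.1 h.2,
      ih fun q hq => hi q (List.mem_cons_of_mem _ hq)]

theorem pderiv_list_prod_blockPoly (L : List P) (t : P → 𝕜) (τ : P → P) (i : P)
    (hi : ∀ p ∈ L, τ p ≠ i) :
    pderiv i ((L.map fun p => t p • blockPoly u (τ p)).prod) = 0 := by
  induction L with
  | nil => simp
  | cons p L ih =>
    have h := hi p List.mem_cons_self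
    rw [List.map_cons, List.prod_cons, Derivation.leibniz,
      ih fun q hq => hi q (List.mem_cons_of_mem _ hq), Derivation.map_smul, blockPoly,
      Derivation.leibniz_pow, Derivation.map_aeval, pderiv_X_of_ne h]
    simp

/-- Each block leaves one Euler operator, which has to pass the factors produced by the blocks
applied before it. As τ is injective these do not involve x_(τ p), and `hJ` says the same of `J`;
hence all Euler operators accumulate on f. -/
theorem list_prod_block_lin {τ : P → P} (hτ : ∀ p, c (τ p) = c p) (hinj : Function.Injective τ)
    (L : List P) (hL : L.Nodup) (hl : ∀ p ∈ L, l (τ p) = 0)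
    (J : Polar P 𝕜) (hJ : ∀ p ∈ L, eulX (τ p) J = 0) (f : MvPolynomial P 𝕜) :
    (L.map fun p => block u c l b p (τ p, τ p)).prod
        ((L.map fun p => py (p, false) * (py (p, false) - py (p, true))).prod * (J * inX f)) =
      inX ((L.map fun p => (-1 : 𝕜) • blockPoly u (τ p)).prod) *
        (subList (fun p => (τ p, τ p)) L J * inX ((L.map fun p => eul b (τ p)).prod f)) := by
  induction L generalizing J with
  | nil => simp [subList]
  | cons p L ih =>
    obtain ⟨hp, hL'⟩ := List.nodup_cons.1 hL
    have hmem {q : P} (hq : q ∈ L) : q ∈ p :: L := List.mem_cons_of_mem _ hq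
    have hne {q : P} (hq : q ∈ L) : τ q ≠ τ p := fun h => hp (hinj h ▸ hq)
    simp only [List.map_cons, List.prod_cons, Module.End.mul_apply]
    set z : Polar P 𝕜 := py (p, false) * (py (p, false) - py (p, true)) with hz
    have hsz : subList (fun p => (τ p, τ p)) L z = z := by
      rw [hz, map_mul, map_sub, subList_py, subList_py, if_neg hp, if_neg hp]
    have hez (i : P) : eulX i z = 0 := by
      rw [hz, Derivation.leibniz, map_sub, eulX_py, eulX_py]; simp
    have e1 : z * (L.map fun p => py (p, false) * (py (p, false) - py (p, true))).prod *
        (J * inX f) = (L.map fun p => py (p, false) * (py (p, false) - py (p, true))).prod *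
        ((z * J) * inX f) := by ring
    rw [e1, ih hL' (fun q hq => hl q (hmem hq)) (z * J) fun q hq => by
      rw [Derivation.leibniz, hez, hJ q (hmem hq)]; simp, map_mul (subList _ L), hsz]
    have e2 (A B D : Polar P 𝕜) : A * (z * B * D) = z * (A * B * D) := by ring
    rw [e2, block, Module.End.mul_apply, cpolar, cpolar, if_pos (hτ p), if_pos (hτ p), hz,
      polar_polar_of_eq_zero p (hl p List.mem_cons_self), der_zero]
    have h1 : eulX (τ p) (inX ((L.map fun p => (-1 : 𝕜) • blockPoly u (τ p)).prod) *
        subList (fun p => (τ p, τ p)) L J) = 0 := by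
      rw [Derivation.leibniz, eulX_inX, pderiv_list_prod_blockPoly L _ τ _ fun q hq => hne hq,
        eulX_subList _ _ _ fun q hq => ⟨hne hq, hne hq⟩, hJ p List.mem_cons_self]
      simp
    rw [Derivation.leibniz, h1, smul_zero, add_zero, eulX_inX, smul_eq_mul, ← mul_smul_comm,
      ← mul_add, ← map_smul, ← map_add, ← eul_apply, map_mul (sub (p, true) _),
      map_mul (sub (p, true) _), map_mul (sub (p, false) _), map_mul (sub (p, false) _), sub_inX,
      sub_inX, sub_inX, sub_inX, map_mul inX, map_smul, inX_blockPoly, subList,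
      AlgHom.comp_apply, subBlock, AlgHom.comp_apply]
    ring

/-! ### The separating element and the surviving terms -/

/-- The polynomials that are symmetric under the permutations of points of the same colour. -/
noncomputable def colorSym (𝕜 : Type*) [Field 𝕜] (c : P → C) :
    Subalgebra 𝕜 (MvPolynomial P 𝕜) where
  carrier := {f | ∀ σ : Equiv.Perm P, (∀ i, c (σ i) = c i) → rename σ f = f}
  mul_mem' hf hg σ hσ := by rw [map_mul, hf σ hσ, hg σ hσ]
  add_mem' hf hg σ hσ := by rw [map_add, hf σ hσ, hg σ hσ]
  algebraMap_mem' x σ _ := AlgHom.commutes _ x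

/-- The product of the differences of points of the same colour. -/
noncomputable def diagPoly (𝕜 : Type*) [Field 𝕜] (c : P → C) : MvPolynomial P 𝕜 :=
  ∏ p : P × P, if p.1 ≠ p.2 ∧ c p.1 = c p.2 then X p.1 - X p.2 else 1

/-- The equation of the locus where the points are not generic. -/
noncomputable def discr (u : Polynomial 𝕜) (c : P → C) : MvPolynomial P 𝕜 :=
  diagPoly 𝕜 c * ∏ i, Polynomial.aeval (X i) (Polynomial.X * u)

open Classical in
/-- The points of weight `0`. -/
noncomputable def zeroPoints (l : P → 𝕜) : List P := (Finset.univ.filter fun i => l i = 0).toList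

open Classical in
/-- The points of nonzero weight. -/
noncomputable def otherPoints (l : P → 𝕜) : List P := (Finset.univ.filter fun i => l i ≠ 0).toList

theorem mem_zeroPoints {i : P} : i ∈ zeroPoints l ↔ l i = 0 := by simp [zeroPoints]

theorem mem_otherPoints {i : P} : i ∈ otherPoints l ↔ l i ≠ 0 := by simp [otherPoints]

theorem nodup_zeroPoints : (zeroPoints l).Nodup := Finset.nodup_toList _

theorem nodup_otherPoints : (otherPoints l).Nodup := Finset.nodup_toList _

theorem nodup_append : (zeroPoints l ++ otherPoints l).Nodup :=
  List.nodup_append'.2 ⟨nodup_zeroPoints, nodup_otherPoints, fun _ h h' =>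
    mem_otherPoints.1 h' (mem_zeroPoints.1 h)⟩

theorem mem_append (i : P) : i ∈ zeroPoints l ++ otherPoints l := by
  rw [List.mem_append, mem_zeroPoints, mem_otherPoints]
  exact em _

/-- The product of the operators `xᵢ ∂ᵢ + bᵢ` over the points of weight `0`. -/
noncomputable def eulProd (l b : P → 𝕜) : Module.End 𝕜 (MvPolynomial P 𝕜) :=
  ((zeroPoints l).map fun i => eul b i).prod

theorem coeff_list_prod_eul (L : List P) (m : P →₀ ℕ) (f : MvPolynomial P 𝕜) :
    coeff m ((L.map fun i => eul b i).prod f) =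
      (L.map fun i => (m i : 𝕜) + b i).prod * coeff m f := by
  induction L with
  | nil => simp
  | cons i L ih =>
    rw [List.map_cons, List.prod_cons, Module.End.mul_apply, coeff_eul, ih, List.map_cons,
      List.prod_cons, mul_assoc]

/-- The Euler operators are simultaneously diagonal on monomials, so their order is immaterial, and
τ permutes the points of weight 0. -/
theorem list_prod_eul_comp {τ : P → P} (hinj : Function.Injective τ)
    (hτ : ∀ p, l p = 0 → l (τ p) = 0) (f : MvPolynomial P 𝕜) :
    ((zeroPoints l).map fun p => eul b (τ p)).prod f = eulProd l b f := by
  have hperm : ((zeroPoints l).map τ).Perm (zeroPoints l) := by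
    refine (List.subperm_of_subset (nodup_zeroPoints.map hinj) fun i hi => ?_).perm_of_length_le
      (by rw [List.length_map])
    obtain ⟨p, hp, rfl⟩ := List.mem_map.1 hi
    exact mem_zeroPoints.2 (hτ p (mem_zeroPoints.1 hp))
  ext m
  have h : (zeroPoints l).map (fun p => eul b (τ p)) = ((zeroPoints l).map τ).map (eul b) := by
    rw [List.map_map]; rfl
  rw [h, eulProd, coeff_list_prod_eul, coeff_list_prod_eul, (hperm.map _).prod_eq]

/-- The common exponent of the differences of slots. -/
noncomputable def crossExp (l : P → 𝕜) : ℕ := 1 + 2 * (zeroPoints l ++ otherPoints l).length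

/-- The product of the differences of slots that belong to different points. -/
noncomputable def cross (c : P → C) (l : P → 𝕜) : MvPolynomial (P × Bool) 𝕜 :=
  ∏ p : P × P, if p.1 ≠ p.2 ∧ c p.1 = c p.2 then
    ∏ t : Bool × Bool, (X (p.1, t.1) - X (p.2, t.2)) ^ crossExp l else 1

theorem pow_dvd_cross {a a' : P × Bool} (ha : a.1 ≠ a'.1) (hc : c a.1 = c a'.1) :
    (X a - X a') ^ crossExp l ∣ (cross c l : MvPolynomial (P × Bool) 𝕜) := by
  have h1 := Finset.dvd_prod_of_mem (fun t : Bool × Bool =>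
    (X (a.1, t.1) - X (a'.1, t.2) : MvPolynomial (P × Bool) 𝕜) ^ crossExp l)
    (Finset.mem_univ (a.2, a'.2))
  have h2 := Finset.dvd_prod_of_mem (fun p : P × P => if p.1 ≠ p.2 ∧ c p.1 = c p.2 then
    ∏ t : Bool × Bool, (X (p.1, t.1) - X (p.2, t.2) : MvPolynomial (P × Bool) 𝕜) ^ crossExp l
      else 1) (Finset.mem_univ (a.1, a'.1))
  simp only [if_pos (And.intro ha hc)] at h2
  exact h1.trans h2

/-- An ordered pair of points carries four pairs of slots, whence the 4; τ only permutes the ordered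
pairs of distinct points of equal colour. -/
theorem aeval_cross {τ : P → P} (hτ : ∀ p, c (τ p) = c p) (hinj : Function.Injective τ) :
    aeval (fun a : P × Bool => (X (τ a.1) : MvPolynomial P 𝕜)) (cross c l) =
      diagPoly 𝕜 c ^ (4 * crossExp l) := by
  set τe : Equiv.Perm P := Equiv.ofBijective τ (Finite.injective_iff_bijective.1 hinj)
  rw [cross, diagPoly, map_prod, ← Finset.prod_pow]
  conv_rhs => rw [← (τe.prodCongr τe).prod_comp]
  refine Finset.prod_congr rfl fun p _ => ?_
  have h : (τ p.1 ≠ τ p.2 ∧ c (τ p.1) = c (τ p.2)) ↔ (p.1 ≠ p.2 ∧ c p.1 = c p.2) := by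
    rw [hinj.ne_iff, hτ, hτ]
  change _ = (if τ p.1 ≠ τ p.2 ∧ c (τ p.1) = c (τ p.2) then
    (X (τ p.1) - X (τ p.2) : MvPolynomial P 𝕜) else 1) ^ _
  simp only [h]
  split_ifs
  · simp only [Fintype.prod_prod_type, Fintype.prod_bool, map_mul, map_pow, map_sub, aeval_X]
    ring
  · simp

theorem aeval_rename_of_mem {s : MvPolynomial P 𝕜} (hs : s ∈ colorSym 𝕜 c) {τ : P → P}
    (hτ : ∀ p, c (τ p) = c p) (hinj : Function.Injective τ) :
    aeval (fun a : P × Bool => (X (τ a.1) : MvPolynomial P 𝕜))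
      (rename (fun p => (p, false)) s) = s := by
  have h := hs (Equiv.ofBijective τ (Finite.injective_iff_bijective.1 hinj)) hτ
  conv_rhs => rw [← h]
  rw [aeval_rename, rename_eq_aeval]
  rfl

theorem subList_subList_inY {τ : P → P} (F : MvPolynomial (P × Bool) 𝕜) :
    subList (fun p => (τ p, τ p)) (zeroPoints l) (subList (fun p => (τ p, τ p)) (otherPoints l)
      (inY F)) = inX (aeval (fun a : P × Bool => X (τ a.1)) F) := by
  have h : ((subList (𝕜 := 𝕜) (fun p => (τ p, τ p)) (zeroPoints l)).comp
      (subList (fun p => (τ p, τ p)) (otherPoints l))).comp inY =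
      inX.comp (aeval (fun a : P × Bool => X (τ a.1))) := by
    refine MvPolynomial.algHom_ext fun a => ?_
    have hy : inY (X a : MvPolynomial (P × Bool) 𝕜) = py a := by simp [inY, py]
    have hx : inX (X (τ a.1) : MvPolynomial P 𝕜) = px (τ a.1) := by simp [inX, px]
    have hp : slotPoint (fun p => (τ p, τ p)) a = τ a.1 := by
      obtain ⟨p, t⟩ := a; cases t <;> rfl
    rw [AlgHom.comp_apply, AlgHom.comp_apply, AlgHom.comp_apply, hy, aeval_X, hx, subList_py]
    split_ifs with h
    · rw [subList_px, hp]
    · rw [subList_py, if_pos, hp]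
      exact ((List.mem_append.1 (mem_append (l := l) a.1)).resolve_right h)
  exact DFunLike.congr_fun h F

theorem list_prod_eq_prod {R : Type*} [CommMonoid R] (g : P → R) :
    ((zeroPoints l).map g).prod * ((otherPoints l).map g).prod = ∏ i, g i := by
  rw [← List.prod_append, ← List.map_append, ← List.prod_toFinset _ nodup_append]
  congr 1
  ext i
  simp only [List.mem_toFinset, Finset.mem_univ, iff_true]
  exact mem_append i

/-- The polarised element to which the operators are applied. -/
noncomputable def polarElt (c : P → C) (l : P → 𝕜) (s f : MvPolynomial P 𝕜) : Polar P 𝕜 :=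
  ((otherPoints l).map fun p => (py (p, false) - py (p, true)) ^ 2).prod *
    (((zeroPoints l).map fun p => py (p, false) * (py (p, false) - py (p, true))).prod *
      (inY (cross c l * rename (fun p => (p, false)) s) * inX f))

theorem polarElt_mem {N : Submodule 𝕜 (MvPolynomial P 𝕜)} {f : MvPolynomial P 𝕜} (hf : f ∈ N)
    (s : MvPolynomial P 𝕜) : polarElt c l s f ∈ polarSpan N := by
  have hy (a : P × Bool) : py a = inY (X a : MvPolynomial (P × Bool) 𝕜) := by simp [inY, py]
  have h : polarElt c l s f = inX f * inY
      (((otherPoints l).map fun p => (X (p, false) - X (p, true)) ^ 2).prod *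
      (((zeroPoints l).map fun p => X (p, false) * (X (p, false) - X (p, true))).prod *
      (cross c l * rename (fun p => (p, false)) s))) := by
    rw [polarElt, map_mul inY (List.prod _), map_mul inY (List.prod _), map_list_prod,
      map_list_prod, List.map_map, List.map_map, mul_comm (inX f), mul_assoc, mul_assoc]
    simp only [Function.comp_def, map_mul, map_sub, map_pow, hy]
  rw [h]
  exact inX_mul_inY_mem hf _

/-- The contribution of the identity permutation. -/
noncomputable def diagValue (u : Polynomial 𝕜) (c : P → C) (l b : P → 𝕜)
    (s f : MvPolynomial P 𝕜) : MvPolynomial P 𝕜 :=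
  (∏ i, blockScalar (l i) • blockPoly u i) *
    (diagPoly 𝕜 c ^ (4 * crossExp l) * s * eulProd l b f)

/-- Composition applies the blocks of nonzero weight first; they do not affect the factors in the
slots of the points of weight 0. -/
theorem list_prod_block_polarElt {τ : P → P} (hτ : ∀ p, c (τ p) = c p) (s f : MvPolynomial P 𝕜) :
    ((zeroPoints l ++ otherPoints l).map fun p => block u c l b p (τ p, τ p)).prod
        (polarElt c l s f) =
      ((zeroPoints l).map fun p => block u c l b p (τ p, τ p)).prod
        (((zeroPoints l).map fun p => py (p, false) * (py (p, false) - py (p, true))).prod *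
          ((inX ((otherPoints l).map fun p =>
              (2 * l (τ p) * (1 - l (τ p))) • blockPoly u (τ p)).prod *
            subList (fun p => (τ p, τ p)) (otherPoints l)
              (inY (cross c l * rename (fun p => (p, false)) s))) * inX f)) := by
  rw [List.map_append, List.prod_append, Module.End.mul_apply, polarElt,
    list_prod_block_sq hτ _ nodup_otherPoints]
  congr 1
  have h : subList (𝕜 := 𝕜) (fun p => (τ p, τ p)) (otherPoints l)
      ((zeroPoints l).map fun p => py (p, false) * (py (p, false) - py (p, true))).prod =
      ((zeroPoints l).map fun p => py (p, false) * (py (p, false) - py (p, true))).prod := by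
    rw [map_list_prod, List.map_map]
    congr 1
    refine List.map_congr_left fun p hp => ?_
    have hp' : p ∉ otherPoints l := fun h => mem_otherPoints.1 h (mem_zeroPoints.1 hp)
    simp [subList_py, hp']
  rw [map_mul (subList _ _), map_mul (subList _ _), h, subList_inX]
  ring

/-- Such a p contributes the scalar 2l(1 - l) at l = `l (τ p)` = 0. -/
theorem list_prod_block_polarElt_eq_zero {τ : P → P} (hτ : ∀ p, c (τ p) = c p)
    (s f : MvPolynomial P 𝕜) {p : P} (hp : l p ≠ 0)
    (hp' : l (τ p) = 0) :
    ((zeroPoints l ++ otherPoints l).map fun p => block u c l b p (τ p, τ p)).prod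
        (polarElt c l s f) = 0 := by
  have h : ((otherPoints l).map fun p =>
      (2 * l (τ p) * (1 - l (τ p))) • blockPoly u (τ p)).prod = 0 :=
    List.prod_eq_zero (List.mem_map.2 ⟨p, mem_otherPoints.2 hp, by simp [hp']⟩)
  rw [list_prod_block_polarElt hτ, h, map_zero, zero_mul, zero_mul, mul_zero, map_zero]

theorem list_prod_block_polarElt_eq {τ : P → P} (hτ : ∀ p, c (τ p) = c p)
    (hinj : Function.Injective τ) {s : MvPolynomial P 𝕜} (hs : s ∈ colorSym 𝕜 c)
    (f : MvPolynomial P 𝕜) (hl : ∀ p, l p ≠ 0 → l (τ p) ≠ 0) :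
    ((zeroPoints l ++ otherPoints l).map fun p => block u c l b p (τ p, τ p)).prod
        (polarElt c l s f) = inX (diagValue u c l b s f) := by
  have hl' : ∀ p, l p = 0 → l (τ p) = 0 := by
    intro p hp
    by_contra h
    -- τ maps the finite set of points of nonzero weight injectively into itself, hence onto it, so
    -- a point of weight 0 cannot be sent there.
    have hmaps : Set.MapsTo τ {p | l p ≠ 0} {p | l p ≠ 0} := hl
    obtain ⟨⟨q, hq⟩, hqp⟩ := Finite.injective_iff_surjective.1
      (hmaps.restrict_inj.2 hinj.injOn) ⟨τ p, h⟩
    have : q = p := hinj (Subtype.ext_iff.1 hqp)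
    exact hq (this ▸ hp)
  rw [list_prod_block_polarElt hτ, list_prod_block_lin hτ hinj _ nodup_zeroPoints
    (fun p hp => hl' p (mem_zeroPoints.1 hp)), list_prod_eul_comp hinj hl']
  · rw [map_mul (subList _ _), subList_inX, subList_subList_inY, map_mul (aeval _),
      aeval_cross hτ hinj, aeval_rename_of_mem hs hτ hinj]
    have h0 : ((zeroPoints l).map fun p => (-1 : 𝕜) • blockPoly u (τ p)) =
        (zeroPoints l).map fun p => blockScalar (l (τ p)) • blockPoly u (τ p) :=
      List.map_congr_left fun p hp => by
        rw [blockScalar, if_pos (hl' p (mem_zeroPoints.1 hp))]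
    have h1 : ((otherPoints l).map fun p => (2 * l (τ p) * (1 - l (τ p))) • blockPoly u (τ p)) =
        (otherPoints l).map fun p => blockScalar (l (τ p)) • blockPoly u (τ p) :=
      List.map_congr_left fun p hp => by
        rw [blockScalar, if_neg (hl p (mem_otherPoints.1 hp))]
    have h2 : ((zeroPoints l).map fun p => blockScalar (l (τ p)) • blockPoly u (τ p)).prod *
        ((otherPoints l).map fun p => blockScalar (l (τ p)) • blockPoly u (τ p)).prod =
        ∏ i, blockScalar (l i) • blockPoly u i := by
      rw [list_prod_eq_prod fun p => blockScalar (l (τ p)) • blockPoly u (τ p)]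
      exact (Equiv.ofBijective τ (Finite.injective_iff_bijective.1 hinj)).prod_comp
        fun i => blockScalar (l i) • blockPoly u i
    rw [h0, h1, diagValue, ← h2, map_mul inX, map_mul inX]
    simp only [map_mul]
    ring
  · intro p hp
    have hne (q : P) (hq : q ∈ otherPoints l) : τ q ≠ τ p := fun h => by
      rw [hinj h] at hq
      exact mem_otherPoints.1 hq (mem_zeroPoints.1 hp)
    have h1 : pderiv (τ p) ((otherPoints l).map fun p =>
        (2 * l (τ p) * (1 - l (τ p))) • blockPoly u (τ p)).prod = 0 :=
      pderiv_list_prod_blockPoly (otherPoints l) (fun p => 2 * l (τ p) * (1 - l (τ p))) τ (τ p) hne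
    have h2 (F : MvPolynomial (P × Bool) 𝕜) :
        eulX (τ p) (subList (fun p => (τ p, τ p)) (otherPoints l) (inY F)) = 0 := by
      rw [eulX_subList _ _ _ fun q hq => ⟨hne q hq, hne q hq⟩, eulX_inY, map_zero]
    rw [Derivation.leibniz, h2, eulX_inX, h1, mul_zero, map_zero, smul_zero, smul_zero, add_zero]

/-- A term survives only if colours match and slots of different points stay apart. The first slots
then define an injective, hence bijective τ, and the second slot of p can go only to τ p. By
symmetry of all ingredients the value does not depend on τ. -/
theorem list_prod_block_eq_zero_or {s : MvPolynomial P 𝕜}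
    (hs : s ∈ colorSym 𝕜 c) (f : MvPolynomial P 𝕜) (φ : P → P × P) :
    ((zeroPoints l ++ otherPoints l).map fun p => block u c l b p (φ p)).prod
        (polarElt c l s f) = 0 ∨
    ((zeroPoints l ++ otherPoints l).map fun p => block u c l b p (φ p)).prod
        (polarElt c l s f) = inX (diagValue u c l b s f) := by
  by_cases hcol : ∀ a : P × Bool, c (slotPoint φ a) = c a.1
  swap
  · obtain ⟨a, ha⟩ := not_forall.1 hcol
    left
    rw [list_prod_block_eq_zero_of_color_ne φ _ mem_append ha, LinearMap.zero_apply]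
  by_cases hcross : ∃ a a' : P × Bool, a.1 ≠ a'.1 ∧ slotPoint φ a = slotPoint φ a'
  · obtain ⟨a, a', hne, he⟩ := hcross
    left
    refine list_prod_block_eq_zero_of_slotPoint_eq φ _ mem_append he ?_
    have hy (a : P × Bool) : py a = inY (X a : MvPolynomial (P × Bool) 𝕜) := by simp [inY, py]
    have h1 : (py a - py a' : Polar P 𝕜) ^ crossExp l ∣ inY (cross c l) := by
      rw [hy, hy, ← map_sub, ← map_pow]
      exact map_dvd inY (pow_dvd_cross hne (by rw [← hcol, ← hcol, he]))
    rw [polarElt, map_mul inY]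
    exact ((((h1.mul_right _).mul_right _).mul_left _).mul_left _)
  · push Not at hcross
    set τ : P → P := fun p => (φ p).1
    have hinj : Function.Injective τ := fun p q h => by
      by_contra hpq
      exact hcross (p, false) (q, false) hpq h
    have hφ : φ = fun p => (τ p, τ p) := by
      funext p
      obtain ⟨q, hq⟩ := Finite.injective_iff_surjective.1 hinj (φ p).2
      have hqp : q = p := by
        by_contra hqp
        exact hcross (q, false) (p, true) hqp hq
      rw [hqp] at hq
      exact Prod.ext rfl hq.symm
    have hτ (p : P) : c (τ p) = c p := hcol (p, false)
    rw [hφ]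
    by_cases h : ∃ p, l p ≠ 0 ∧ l (τ p) = 0
    · obtain ⟨p, hp, hp'⟩ := h
      exact Or.inl (list_prod_block_polarElt_eq_zero hτ s f hp hp')
    · push Not at h
      exact Or.inr (list_prod_block_polarElt_eq hτ hinj hs f h)

/-- All nonzero terms coincide, so the whole sum is a multiple of one value by the number of
survivors. The identity survives, and a positive integer is invertible in characteristic 0. -/
theorem diagValue_mem [CharZero 𝕜] {N : Submodule 𝕜 (MvPolynomial P 𝕜)}
    (hN : Invariant (op u c l b) N) {f : MvPolynomial P 𝕜} (hf : f ∈ N) {s : MvPolynomial P 𝕜}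
    (hs : s ∈ colorSym 𝕜 c) : diagValue u c l b s f ∈ N := by
  classical
  have hmem := dropY_mem (list_prod_sum_block_mem hN (zeroPoints l ++ otherPoints l)
    (polarElt_mem (c := c) (l := l) hf s))
  rw [list_prod_sum _ nodup_append mem_append, LinearMap.sum_apply] at hmem
  set F : (P → P × P) → Polar P 𝕜 := fun φ =>
    ((zeroPoints l ++ otherPoints l).map fun p => block u c l b p (φ p)).prod (polarElt c l s f)
  have hF (φ : P → P × P) : F φ =
      if F φ = inX (diagValue u c l b s f) then inX (diagValue u c l b s f) else 0 := by
    split_ifs with h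
    · exact h
    · exact (list_prod_block_eq_zero_or hs f φ).resolve_right h
  have hid : F (fun p => (p, p)) = inX (diagValue u c l b s f) :=
    list_prod_block_polarElt_eq (τ := id) (fun _ => rfl) Function.injective_id hs f fun _ h => h
  have hsum : ∑ φ, F φ = ((Finset.univ.filter fun φ =>
      F φ = inX (diagValue u c l b s f)).card : 𝕜) • inX (diagValue u c l b s f) := by
    rw [Finset.sum_congr rfl fun φ _ => hF φ, Finset.sum_ite, Finset.sum_const_zero, add_zero,
      Finset.sum_const, Nat.cast_smul_eq_nsmul]
  have hcard : ((Finset.univ.filter fun φ =>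
      F φ = inX (diagValue u c l b s f)).card : 𝕜) ≠ 0 :=
    Nat.cast_ne_zero.2 (Finset.card_ne_zero_of_mem (Finset.mem_filter.2 ⟨Finset.mem_univ _, hid⟩))
  change dropY (∑ φ, F φ) ∈ N at hmem
  rw [hsum, map_smul, dropY_inX] at hmem
  exact (Submodule.smul_mem_iff _ hcard).1 hmem

theorem prod_aeval_mem_colorSym (p : Polynomial 𝕜) :
    ∏ i, Polynomial.aeval (X i : MvPolynomial P 𝕜) p ∈ colorSym 𝕜 c := by
  intro σ _
  simp only [map_prod, ← Polynomial.aeval_algHom_apply, rename_X]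
  exact Equiv.prod_comp σ fun i => Polynomial.aeval (X i : MvPolynomial P 𝕜) p

/-- Invariant subspaces contain, up to a power of the discriminant, the module over the
symmetric polynomials generated by the images of `eulProd`. -/
theorem exists_discr_pow_mul_mem [CharZero 𝕜] (hl1 : ∀ i, l i ≠ 1) :
    ∃ q, ∀ N : Submodule 𝕜 (MvPolynomial P 𝕜), Invariant (op u c l b) N → ∀ f ∈ N,
      ∀ s ∈ colorSym 𝕜 c, discr u c ^ q * s * eulProd l b f ∈ N := by
  refine ⟨4 * crossExp l, fun N hN f hf s hs => ?_⟩
  -- 2l(1 - l) vanishes only at 0 and 1; weight 0 carries the scalar -1 instead, and weight 1 is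
  -- excluded.
  have hscal : ∏ i, blockScalar (l i) ≠ 0 := Finset.prod_ne_zero_iff.2 fun i _ => by
    rw [blockScalar]
    split_ifs with h
    · exact neg_ne_zero.2 one_ne_zero
    · exact mul_ne_zero (mul_ne_zero two_ne_zero h) (sub_ne_zero.2 (hl1 i).symm)
  -- The blocks supply only the fourth power of ∏ xᵢ u(xᵢ); the rest of the discriminant power is
  -- symmetric and is put into the multiplier s.
  have hcr : 4 * crossExp l = 4 + 4 * (crossExp l - 1) := by
    have : 1 ≤ crossExp l := by rw [crossExp]; omega
    omega
  set v : MvPolynomial P 𝕜 := ∏ i, Polynomial.aeval (X i) (Polynomial.X * u) with hv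
  have h := diagValue_mem hN hf ((colorSym 𝕜 c).mul_mem
    ((colorSym 𝕜 c).pow_mem (prod_aeval_mem_colorSym (Polynomial.X * u)) (4 * (crossExp l - 1))) hs)
  have hb : ∏ i, blockScalar (l i) • blockPoly u i = (∏ i, blockScalar (l i)) • v ^ 4 := by
    simp only [Finset.prod_smul, blockPoly, hv, Finset.prod_pow]
  rw [diagValue, hb, smul_mul_assoc] at h
  have h' := (Submodule.smul_mem_iff _ hscal).1 h
  have e : discr u c ^ (4 * crossExp l) * s * eulProd l b f = v ^ 4 * (diagPoly 𝕜 c ^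
      (4 * crossExp l) * (v ^ (4 * (crossExp l - 1)) * s) * eulProd l b f) := by
    have : v ^ (4 * crossExp l) = v ^ 4 * v ^ (4 * (crossExp l - 1)) := by rw [← pow_add, ← hcr]
    rw [discr, ← hv, mul_pow, this]
    ring
  rw [e]
  exact h'

/-! ### Divisibility by powers of the discriminant -/

/-- Factors are grouped by associates. One group is, up to a unit, a power of `p k` with exponent at
most `s.card * a`, and different groups are coprime. -/
theorem prod_pow_dvd_of_pow_dvd {R α : Type*} [CommMonoidWithZero R] [DecompositionMonoid R]
    {p : α → R} (hp : ∀ i j, Associated (p i) (p j) ∨ IsRelPrime (p i) (p j)) {m : R} {a N : ℕ}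
    (s : Finset α) (hN : s.card * a ≤ N) (hm : ∀ i ∈ s, p i ^ N ∣ m) : ∏ i ∈ s, p i ^ a ∣ m := by
  classical
  induction s using Finset.strongInduction with
  | H s ih =>
    rcases s.eq_empty_or_nonempty with rfl | ⟨k, hk⟩
    · exact one_dvd _
    rw [← Finset.prod_filter_mul_prod_filter_not s fun i => Associated (p k) (p i)]
    refine IsRelPrime.mul_dvd ?_ ?_ ?_
    · refine IsRelPrime.prod_left fun i hi => IsRelPrime.prod_right fun j hj => IsRelPrime.pow ?_
      refine (hp i j).resolve_left fun h => (Finset.mem_filter.1 hj).2 ?_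
      exact (Finset.mem_filter.1 hi).2.trans h
    · have h1 : ∏ i ∈ s with Associated (p k) (p i), p i ^ a ∣
          ∏ i ∈ s with Associated (p k) (p i), p k ^ a :=
        Finset.prod_dvd_prod_of_dvd _ _ fun i hi =>
          pow_dvd_pow_of_dvd (Finset.mem_filter.1 hi).2.symm.dvd a
      rw [Finset.prod_const, ← pow_mul, mul_comm] at h1
      refine h1.trans ((pow_dvd_pow _ ?_).trans (hm k hk))
      exact (Nat.mul_le_mul_right a (Finset.card_filter_le _ _)).trans hN
    · have hss : (s.filter fun i => ¬ Associated (p k) (p i)) ⊂ s :=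
        Finset.filter_ssubset.2 ⟨k, hk, fun h => h (Associated.refl _)⟩
      exact ih _ hss ((Nat.mul_le_mul_right a (Finset.card_le_card hss.1)).trans hN)
        fun i hi => hm i (Finset.mem_filter.1 hi).1

/-- The substitution xⱼ ↦ xᵢ maps into a domain, and its kernel is generated by the difference. -/
theorem prime_X_sub_X {i j : P} (hij : i ≠ j) : Prime (X i - X j : MvPolynomial P 𝕜) := by
  set φ : MvPolynomial P 𝕜 →ₐ[𝕜] MvPolynomial {k // k ≠ j} 𝕜 :=
    aeval fun k => if h : k = j then X ⟨i, hij⟩ else X ⟨k, h⟩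
  have h1 : φ (X i - X j) = 0 := by simp [φ, hij]
  have h2 : φ.comp (incl 𝕜 j) = AlgHom.id 𝕜 _ := by
    ext1 k
    simp [φ, incl, k.2]
  have h3 (f : MvPolynomial P 𝕜) (hf : φ f = 0) : X i - X j ∣ f := by
    obtain ⟨h, q, rfl⟩ := exists_eq_incl_add hij f
    have h4 : φ (incl 𝕜 j h) = h := DFunLike.congr_fun h2 h
    rw [map_add, map_mul, h1, zero_mul, add_zero, h4] at hf
    rw [hf, map_zero, zero_add]
    exact dvd_mul_right _ _
  have h5 {f : MvPolynomial P 𝕜} (hf : X i - X j ∣ f) : φ f = 0 := by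
    obtain ⟨q, rfl⟩ := hf
    rw [map_mul, h1, zero_mul]
  refine ⟨sub_ne_zero.2 fun h => hij (X_injective h), fun h => ?_, fun f g h => ?_⟩
  · have := h5 h.dvd (f := 1)
    simp at this
  · have := h5 h
    rw [map_mul] at this
    exact (mul_eq_zero.1 this).imp (h3 f) (h3 g)

/-- All points are moved to one point. -/
noncomputable def collapse : MvPolynomial P 𝕜 →ₐ[𝕜] Polynomial 𝕜 := aeval fun _ => Polynomial.X

theorem collapse_aeval (i : P) (p : Polynomial 𝕜) :
    collapse (Polynomial.aeval (X i : MvPolynomial P 𝕜) p) = p := by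
  rw [← Polynomial.aeval_algHom_apply]
  simp [collapse]

theorem degreeOf_aeval_X {i k : P} (hk : k ≠ i) (p : Polynomial 𝕜) :
    degreeOf k (Polynomial.aeval (X i : MvPolynomial P 𝕜) p) = 0 := by
  refine Nat.le_zero.1 ?_
  rw [Polynomial.aeval_eq_sum_range]
  refine (degreeOf_sum_le k _ _).trans (Finset.sup_le fun a _ => ?_)
  rw [smul_eq_C_mul]
  exact (degreeOf_C_mul_le _ _ _).trans (degreeOf_X_pow_of_ne a hk).le

/-- Divisors of a nonzero polynomial in xᵢ alone involve no other variable, so a common divisor is a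
constant. -/
theorem isRelPrime_aeval_X {i j : P} (hij : i ≠ j) {p : Polynomial 𝕜} (hp : p ≠ 0) :
    IsRelPrime (Polynomial.aeval (X i : MvPolynomial P 𝕜) p) (Polynomial.aeval (X j) p) := by
  have h0 (i : P) : Polynomial.aeval (X i : MvPolynomial P 𝕜) p ≠ 0 := fun h => hp (by
    rw [← collapse_aeval i p, h, map_zero])
  have hdeg {i k : P} (hk : k ≠ i) {d : MvPolynomial P 𝕜}
      (hd : d ∣ Polynomial.aeval (X i : MvPolynomial P 𝕜) p) : degreeOf k d = 0 := by
    obtain ⟨e, he⟩ := hd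
    have hne := h0 i
    rw [he] at hne
    have := degreeOf_aeval_X hk p
    rw [he, degreeOf_mul_eq (left_ne_zero_of_mul hne) (right_ne_zero_of_mul hne)] at this
    omega
  intro d hi hj
  have hd : d ≠ 0 := fun h => h0 i (zero_dvd_iff.1 (h ▸ hi))
  have hv : d.vars = ∅ := by
    refine Finset.eq_empty_of_forall_notMem fun k hk => ?_
    rw [mem_vars_iff_degreeOf_ne_zero] at hk
    rcases eq_or_ne k i with rfl | h
    · exact hk (hdeg hij hj)
    · exact hk (hdeg h hi)
  rw [vars_eq_empty_iff_eq_C] at hv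
  rw [hv] at hd ⊢
  exact (IsUnit.mk0 _ fun h => hd (by rw [h, C_0])).map MvPolynomial.C

/-- The factors of the discriminant. -/
noncomputable def discrFactor (u : Polynomial 𝕜) (c : P → C) : (P × P) ⊕ P → MvPolynomial P 𝕜 :=
  Sum.elim (fun p => if p.1 ≠ p.2 ∧ c p.1 = c p.2 then X p.1 - X p.2 else 1)
    fun i => Polynomial.aeval (X i) (Polynomial.X * u)

theorem prod_discrFactor : ∏ k, discrFactor u c k = discr u c := by
  rw [Fintype.prod_sum_type]
  rfl

theorem associated_or_isRelPrime_discrFactor (hu : u ≠ 0) (k k' : (P × P) ⊕ P) :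
    Associated (discrFactor u c k) (discrFactor u c k') ∨
      IsRelPrime (discrFactor u c k) (discrFactor u c k') := by
  have hv : Polynomial.X * u ≠ 0 := mul_ne_zero Polynomial.X_ne_zero hu
  have hmix (p : P × P) (i : P) :
      IsRelPrime (discrFactor u c (Sum.inl p)) (discrFactor u c (Sum.inr i)) := by
    simp only [discrFactor, Sum.elim_inl, Sum.elim_inr]
    split_ifs with h
    -- Collapsing all points to one kills the difference but sends v(xᵢ) to v ≠ 0.
    · refine (prime_X_sub_X h.1).irreducible.isRelPrime_iff_not_dvd.2 fun ⟨q, hq⟩ => hv ?_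
      rw [← collapse_aeval i (Polynomial.X * u), hq, map_mul, map_sub]
      simp [collapse]
    · exact isRelPrime_one_left
  rcases k with p | i <;> rcases k' with p' | j
  · simp only [discrFactor, Sum.elim_inl]
    split_ifs with h h'
    · refine (prime_X_sub_X h.1).irreducible.dvd_or_isRelPrime.imp_left fun hd => ?_
      exact (prime_X_sub_X h.1).associated_of_dvd (prime_X_sub_X h'.1) hd
    · exact Or.inr isRelPrime_one_right
    · exact Or.inr isRelPrime_one_left
    · exact Or.inr isRelPrime_one_left
  · exact Or.inr (hmix p j)
  · exact Or.inr (hmix p' i).symm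
  · rcases eq_or_ne i j with rfl | h
    · exact Or.inl (Associated.refl _)
    · exact Or.inr (isRelPrime_aeval_X h hv)

theorem discrFactor_dvd_vf (k : (P × P) ⊕ P) (s : C) (g : Polynomial 𝕜) :
    discrFactor u c k ∣ vf u c s g (discrFactor u c k) := by
  rcases k with p | i
  · simp only [discrFactor, Sum.elim_inl]
    split_ifs with h
    · exact sub_dvd_vf_sub h.2 s g
    · exact one_dvd _
  · exact aeval_dvd_vf_aeval i s g

theorem discr_dvd_vf (s : C) (g : Polynomial 𝕜) : discr u c ∣ vf u c s g (discr u c) := by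
  rw [← prod_discrFactor]
  exact dvd_vf_prod _ _ fun k _ => discrFactor_dvd_vf k s g

theorem accAbove_multiples_discrFactor_pow (hu : u ≠ 0) (hacc : ∀ i, AccRemove u c i)
    (k : (P × P) ⊕ P) (a : ℕ) :
    AccAbove (op u c l b) (multiples (discrFactor u c k ^ a)) := by
  rcases k with p | i
  · simp only [discrFactor, Sum.elim_inl]
    split_ifs with h
    · exact accAbove_multiples_sub_pow h.1 h.2 (hacc _) a
    · rw [one_pow, multiples_one]; exact accAbove_top
  · exact accAbove_multiples_aeval_pow hu i (hacc i) a

/-- The components are treated separately and intersected. Factors may be associated, for instance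
the two orders of a pair, so each exponent is inflated by the number of factors. -/
theorem accAbove_multiples_discr_pow (hu : u ≠ 0) (hacc : ∀ i, AccRemove u c i) (a : ℕ) :
    AccAbove (op u c l b) (multiples (discr u c ^ a)) := by
  have h := AccAbove.finset_inf (ρ := op u c l b) Finset.univ
    (fun k => multiples (discrFactor u c k ^ (Fintype.card ((P × P) ⊕ P) * a)))
    (fun k _ => accAbove_multiples_discrFactor_pow hu hacc k _)
    (fun k _ => invariant_multiples fun s g => dvd_vf_pow (discrFactor_dvd_vf k s g) _)
  refine h.1.mono fun f hf => ?_
  rw [Submodule.mem_finsetInf] at hf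
  rw [mem_multiples, ← prod_discrFactor, ← Finset.prod_pow]
  exact prod_pow_dvd_of_pow_dvd (associated_or_isRelPrime_discrFactor hu) _ le_rfl
    fun k hk => mem_multiples.1 (hf k hk)

/-! ### Finiteness over the colour-symmetric polynomials -/

theorem diagPoly_mem_colorSym : diagPoly 𝕜 c ∈ colorSym 𝕜 c := by
  intro σ hσ
  rw [diagPoly, map_prod]
  conv_rhs => rw [← (σ.prodCongr σ).prod_comp]
  refine Finset.prod_congr rfl fun p _ => ?_
  have h : (σ p.1 ≠ σ p.2 ∧ c (σ p.1) = c (σ p.2)) ↔ (p.1 ≠ p.2 ∧ c p.1 = c p.2) := by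
    rw [σ.injective.ne_iff, hσ, hσ]
  change _ = if σ p.1 ≠ σ p.2 ∧ c (σ p.1) = c (σ p.2) then
    (X (σ p.1) - X (σ p.2) : MvPolynomial P 𝕜) else 1
  simp only [h]
  split_ifs <;> simp

theorem discr_mem_colorSym : discr u c ∈ colorSym 𝕜 c :=
  (colorSym 𝕜 c).mul_mem diagPoly_mem_colorSym (prod_aeval_mem_colorSym _)

theorem rename_vf {σ : Equiv.Perm P} (hσ : ∀ i, c (σ i) = c i) (s : C) (g : Polynomial 𝕜)
    (f : MvPolynomial P 𝕜) : rename σ (vf u c s g f) = vf u c s g (rename σ f) := by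
  induction f using MvPolynomial.induction_on with
  | C x => simp [← algebraMap_eq]
  | add p q hp hq => simp only [map_add, hp, hq]
  | mul_X f j hf =>
    simp only [Derivation.leibniz, smul_eq_mul, map_mul (rename σ), map_add (rename σ), hf,
      rename_X, vf_X, hσ]
    congr 2
    split_ifs
    · simp [← Polynomial.aeval_algHom_apply]
    · simp

theorem vf_mem_colorSym (s : C) (g : Polynomial 𝕜) {f : MvPolynomial P 𝕜}
    (hf : f ∈ colorSym 𝕜 c) : vf u c s g f ∈ colorSym 𝕜 c := fun σ hσ => by
  rw [rename_vf hσ, hf σ hσ]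

/-- -xᵢ is a root of ∏ (X + x_k), whose coefficients are elementary symmetric polynomials. -/
instance isIntegral_colorSym : Algebra.IsIntegral (colorSym 𝕜 c) (MvPolynomial P 𝕜) := by
  have hX (i : P) : IsIntegral (colorSym 𝕜 c) (X i : MvPolynomial P 𝕜) := by
    have he (n : ℕ) : esymm P 𝕜 n ∈ colorSym 𝕜 c := fun σ _ => rename_esymm _ _ n σ
    set q : Polynomial (colorSym 𝕜 c) := ∑ j ∈ Finset.range (Fintype.card P + 1),
      Polynomial.C ⟨esymm P 𝕜 j, he j⟩ * Polynomial.X ^ (Fintype.card P - j) with hq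
    have hmap : q.map (algebraMap (colorSym 𝕜 c) (MvPolynomial P 𝕜)) =
        ∏ i, (Polynomial.X + Polynomial.C (X i)) := by
      rw [prod_C_add_X_eq_sum_esymm, hq, Polynomial.map_sum]
      simp only [Polynomial.map_mul, Polynomial.map_C, Polynomial.map_pow, Polynomial.map_X]
      rfl
    have hmon : q.Monic := by
      refine (Function.Injective.monic_map_iff (f := algebraMap (colorSym 𝕜 c) (MvPolynomial P 𝕜))
        Subtype.val_injective).2 ?_
      rw [hmap]
      exact Polynomial.monic_prod_of_monic _ _ fun i _ => Polynomial.monic_X_add_C _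
    have hneg : IsIntegral (colorSym 𝕜 c) (-X i : MvPolynomial P 𝕜) := by
      refine ⟨q, hmon, ?_⟩
      rw [← Polynomial.eval_map, hmap, Polynomial.eval_prod]
      exact Finset.prod_eq_zero (Finset.mem_univ i) (by simp)
    simpa using hneg.neg
  refine ⟨fun f => ?_⟩
  induction f using MvPolynomial.induction_on with
  | C x => exact isIntegral_algebraMap (x := algebraMap 𝕜 (colorSym 𝕜 c) x)
  | add p q hp hq => exact hp.add hq
  | mul_X p i hp => exact hp.mul (hX i)

/-- By Artin–Tate the symmetric subalgebra is finitely generated over 𝕜, hence a noetherian ring,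
and the polynomial ring is finite over it. -/
instance isNoetherian_colorSym : IsNoetherian (colorSym 𝕜 c) (MvPolynomial P 𝕜) := by
  have hft : Algebra.FiniteType (colorSym 𝕜 c) (MvPolynomial P 𝕜) :=
    Algebra.FiniteType.of_restrictScalars_finiteType 𝕜 _ _
  have hfin : Module.Finite (colorSym 𝕜 c) (MvPolynomial P 𝕜) := Algebra.IsIntegral.finite
  have hfg : (⊤ : Subalgebra 𝕜 (colorSym 𝕜 c)).FG :=
    fg_of_fg_of_fg 𝕜 (colorSym 𝕜 c) (MvPolynomial P 𝕜) Algebra.FiniteType.out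
      Module.Finite.fg_top Subtype.val_injective
  have : Algebra.FiniteType 𝕜 (colorSym 𝕜 c) := ⟨hfg⟩
  have : IsNoetherianRing (colorSym 𝕜 c) := Algebra.FiniteType.isNoetherianRing 𝕜 _
  exact isNoetherian_of_isNoetherianRing_of_finite _ _

theorem coeff_eulProd (m : P →₀ ℕ) (f : MvPolynomial P 𝕜) : coeff m (eulProd l b f) =
    ((zeroPoints l).map fun i => (m i : 𝕜) + b i).prod * coeff m f :=
  coeff_list_prod_eul _ m f

/-- The product is diagonal on monomials, and a monomial killed by it is killed by one of its
factors. -/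
theorem ker_eulProd_le (f : MvPolynomial P 𝕜) (hf : eulProd l b f = 0) :
    f ∈ (zeroPoints l).toFinset.sup fun i => LinearMap.ker (eul b i) := by
  rw [f.as_sum]
  refine Submodule.sum_mem _ fun m hm => ?_
  have h := congrArg (coeff m) hf
  rw [coeff_eulProd, coeff_zero] at h
  have h0 := (mul_eq_zero.1 h).resolve_right (mem_support_iff.1 hm)
  obtain ⟨i, hi, h0⟩ := List.mem_map.1 (List.prod_eq_zero_iff.1 h0)
  refine Finset.le_sup (f := fun i => LinearMap.ker (eul b i)) (List.mem_toFinset.2 hi) ?_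
  rw [LinearMap.mem_ker]
  ext m'
  rw [coeff_eul, coeff_monomial, coeff_zero]
  split_ifs with h
  · rw [← h, h0, zero_mul]
  · rw [mul_zero]

/-! ### Iterated commutators with a multiplication -/

/-- The commutator with the multiplication by `F`. -/
noncomputable def adMul (F : MvPolynomial P 𝕜) :
    Module.End 𝕜 (Module.End 𝕜 (MvPolynomial P 𝕜)) :=
  LinearMap.mulRight 𝕜 (LinearMap.mulLeft 𝕜 F) - LinearMap.mulLeft 𝕜 (LinearMap.mulLeft 𝕜 F)

theorem adMul_apply (F : MvPolynomial P 𝕜) (T : Module.End 𝕜 (MvPolynomial P 𝕜)) :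
    adMul F T = T * LinearMap.mulLeft 𝕜 F - LinearMap.mulLeft 𝕜 F * T := rfl

theorem adMul_mul (F : MvPolynomial P 𝕜) (T T' : Module.End 𝕜 (MvPolynomial P 𝕜)) :
    adMul F (T * T') = adMul F T * T' + T * adMul F T' := by
  simp only [adMul_apply, sub_mul, mul_sub, mul_assoc]
  abel

theorem adMul_eul (F : MvPolynomial P 𝕜) (i : P) :
    adMul F (eul b i) = LinearMap.mulLeft 𝕜 (X i * pderiv i F) := by
  refine LinearMap.ext fun f => ?_
  rw [adMul_apply, LinearMap.sub_apply, Module.End.mul_apply, Module.End.mul_apply,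
    LinearMap.mulLeft_apply, LinearMap.mulLeft_apply, LinearMap.mulLeft_apply, eul_apply,
    eul_apply, Derivation.leibniz, smul_eq_mul, smul_eq_mul, smul_eq_C_mul, smul_eq_C_mul]
  ring

theorem adMul_pow_mul_mulLeft (F h : MvPolynomial P 𝕜) (k : ℕ)
    (T : Module.End 𝕜 (MvPolynomial P 𝕜)) :
    (adMul F ^ k) (T * LinearMap.mulLeft 𝕜 h) = (adMul F ^ k) T * LinearMap.mulLeft 𝕜 h := by
  induction k generalizing T with
  | zero => rfl
  | succ k ih =>
    have h0 : adMul F (LinearMap.mulLeft 𝕜 h) = 0 := by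
      refine LinearMap.ext fun f => ?_
      simp only [adMul_apply, LinearMap.sub_apply, Module.End.mul_apply, LinearMap.mulLeft_apply,
        LinearMap.zero_apply]
      ring
    rw [pow_succ, Module.End.mul_apply, adMul_mul, h0, mul_zero, add_zero, ih]
    rfl

/-- The commutator of an Euler operator with F is a multiplication, which commutes with F; so each
Euler factor raises the order of nilpotency by at most one. -/
theorem adMul_pow_mul_eul (F : MvPolynomial P 𝕜) (i : P) (k : ℕ)
    {T : Module.End 𝕜 (MvPolynomial P 𝕜)} (hT : (adMul F ^ k) T = 0) :
    (adMul F ^ (k + 1)) (T * eul b i) = 0 := by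
  induction k generalizing T with
  | zero =>
    have hT : T = 0 := hT
    rw [hT, zero_mul, map_zero]
  | succ k ih =>
    rw [pow_succ, Module.End.mul_apply, adMul_mul, map_add, ih (T := adMul F T) hT, adMul_eul,
      adMul_pow_mul_mulLeft, hT, zero_mul, add_zero]

theorem exists_adMul_pow_eulProd (F : MvPolynomial P 𝕜) :
    ∃ k, (adMul F ^ k) (eulProd l b) = 0 := by
  have h (L : List P) : ∃ k, (adMul F ^ k) ((L.map fun i => eul b i).prod) = 0 := by
    induction L using List.reverseRecOn with
    | nil => exact ⟨1, by rw [pow_one, adMul_apply]; simp⟩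
    | append_singleton L i ih =>
      obtain ⟨k, hk⟩ := ih
      refine ⟨k + 1, ?_⟩
      rw [List.map_append, List.prod_append, List.map_singleton, List.prod_singleton]
      exact adMul_pow_mul_eul F i k hk
  exact h _

/-! ### The module over symmetric polynomials inside an invariant subspace -/

/-- The elements whose symmetric multiples lie in `N` up to a power of the discriminant. -/
noncomputable def core (u : Polynomial 𝕜) (c : P → C) (N : Submodule 𝕜 (MvPolynomial P 𝕜)) :
    Submodule (colorSym 𝕜 c) (MvPolynomial P 𝕜) where
  carrier := {g | ∃ q, ∀ s ∈ colorSym 𝕜 c, discr u c ^ q * s * g ∈ N}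
  zero_mem' := ⟨0, fun s _ => by rw [mul_zero]; exact N.zero_mem⟩
  add_mem' := by
    rintro g g' ⟨q, hq⟩ ⟨q', hq'⟩
    refine ⟨q + q', fun s hs => ?_⟩
    have h1 := hq _ ((colorSym 𝕜 c).mul_mem ((colorSym 𝕜 c).pow_mem
      (discr_mem_colorSym (u := u)) q') hs)
    have h2 := hq' _ ((colorSym 𝕜 c).mul_mem ((colorSym 𝕜 c).pow_mem
      (discr_mem_colorSym (u := u)) q) hs)
    have e : discr u c ^ (q + q') * s * (g + g') =
        discr u c ^ q * (discr u c ^ q' * s) * g + discr u c ^ q' * (discr u c ^ q * s) * g' := by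
      ring
    rw [e]
    exact N.add_mem h1 h2
  smul_mem' := by
    rintro ⟨a, ha⟩ g ⟨q, hq⟩
    refine ⟨q, fun s hs => ?_⟩
    have := hq _ ((colorSym 𝕜 c).mul_mem hs ha)
    rwa [← mul_assoc, mul_assoc _ a g] at this

variable {N : Submodule 𝕜 (MvPolynomial P 𝕜)}

theorem mem_core {g : MvPolynomial P 𝕜} :
    g ∈ core u c N ↔ ∃ q, ∀ s ∈ colorSym 𝕜 c, discr u c ^ q * s * g ∈ N := Iff.rfl

theorem core_mono {N' : Submodule 𝕜 (MvPolynomial P 𝕜)} (h : N ≤ N') :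
    core u c N ≤ core u c N' := fun _ ⟨q, hq⟩ => ⟨q, fun s hs => h (hq s hs)⟩

theorem mul_mem_core {a g : MvPolynomial P 𝕜} (ha : a ∈ colorSym 𝕜 c) (hg : g ∈ core u c N) :
    a * g ∈ core u c N := (core u c N).smul_mem (⟨a, ha⟩ : colorSym 𝕜 c) hg

theorem mem_core_of_discr_pow_mul_mem {g : MvPolynomial P 𝕜} (k : ℕ)
    (h : discr u c ^ k * g ∈ core u c N) : g ∈ core u c N := by
  obtain ⟨q, hq⟩ := h
  refine ⟨q + k, fun s hs => ?_⟩
  have := hq s hs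
  rwa [show discr u c ^ q * s * (discr u c ^ k * g) = discr u c ^ (q + k) * s * g by ring] at this

/-- By Leibniz the correction term is the derivative of E^(q+1) s times f, where E is the
discriminant. It is E^q times a symmetric multiple of f, hence in `N`: one extra power of E pays for
the differentiation. -/
theorem op_mem_core (hN : Invariant (op u c l b) N) (s : C) (g : Polynomial 𝕜)
    {f : MvPolynomial P 𝕜} (hf : f ∈ core u c N) : op u c l b (s, g) f ∈ core u c N := by
  obtain ⟨q, hq⟩ := hf
  refine ⟨q + 1, fun a ha => ?_⟩
  have hE : discr u c ∈ colorSym 𝕜 c := discr_mem_colorSym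
  have h1 := hN (s, g) _ (hq _ ((colorSym 𝕜 c).mul_mem hE ha))
  have h2 := hq _ ((colorSym 𝕜 c).add_mem ((colorSym 𝕜 c).mul_mem
    ((colorSym 𝕜 c).smul_mem (vf_mem_colorSym (u := u) s g hE) ((q : 𝕜) + 1)) ha)
    ((colorSym 𝕜 c).mul_mem hE (vf_mem_colorSym (u := u) s g ha)))
  rw [op_mul] at h1
  have e : vf u c s g (discr u c ^ q * (discr u c * a)) = discr u c ^ q *
      (((q : 𝕜) + 1) • vf u c s g (discr u c) * a + discr u c * vf u c s g a) := by
    rw [← mul_assoc, ← pow_succ, Derivation.leibniz, Derivation.leibniz_pow, smul_eq_C_mul]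
    simp only [smul_eq_mul, nsmul_eq_mul, Nat.add_sub_cancel, map_add, map_natCast, map_one]
    push_cast
    ring
  rw [e] at h1
  have := N.sub_mem h1 h2
  rwa [add_sub_cancel_left, ← mul_assoc, ← pow_succ] at this

theorem eulProd_mem_core_of_mem [CharZero 𝕜] (hl : ∀ i, l i ≠ 1)
    (hN : Invariant (op u c l b) N) {f : MvPolynomial P 𝕜} (hf : f ∈ N) :
    eulProd l b f ∈ core u c N := by
  obtain ⟨q, hq⟩ := exists_discr_pow_mul_mem (u := u) (c := c) (b := b) hl
  exact ⟨q, hq N hN f hf⟩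

/-- Here g itself need not lie in `N`, only F^(j+1) g does, so `eulProd` is known to be in the core
on those elements. As `eulProd` has finite order as a differential operator, some iterated
commutator with F vanishes. Expanded on g, it consists of core elements and ±F^k `eulProd` g; the
power of F can then be cancelled in the core. -/
theorem eulProd_mem_core [CharZero 𝕜] (hl : ∀ i, l i ≠ 1) (hN : Invariant (op u c l b) N)
    {g : MvPolynomial P 𝕜} (hg : g ∈ core u c N) : eulProd l b g ∈ core u c N := by
  obtain ⟨q, hq⟩ := hg
  have hE : discr u c ^ (q + 1) ∈ colorSym 𝕜 c := (colorSym 𝕜 c).pow_mem discr_mem_colorSym _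
  set F := discr u c ^ (q + 1) with hF
  obtain ⟨k, hk⟩ := exists_adMul_pow_eulProd (l := l) (b := b) F
  have hmem (j : ℕ) : eulProd l b (F ^ (j + 1) * g) ∈ core u c N := by
    refine eulProd_mem_core_of_mem hl hN ?_
    have := hq _ ((colorSym 𝕜 c).mul_mem (discr_mem_colorSym (u := u))
      ((colorSym 𝕜 c).pow_mem hE j))
    rwa [show discr u c ^ q * (discr u c * F ^ j) = F ^ (j + 1) by rw [hF]; ring] at this
  have key (k : ℕ) : ∀ j, (adMul F ^ k) (eulProd l b) (F ^ j * g) -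
      (-1) ^ k * F ^ k * eulProd l b (F ^ j * g) ∈ core u c N := by
    induction k with
    | zero => intro j; simp
    | succ k ih =>
      intro j
      have h1 := ih (j + 1)
      have h2 := mul_mem_core hE (ih j)
      have h3 := mul_mem_core ((colorSym 𝕜 c).mul_mem ((colorSym 𝕜 c).pow_mem
        ((colorSym 𝕜 c).neg_mem (colorSym 𝕜 c).one_mem) k) ((colorSym 𝕜 c).pow_mem hE k)) (hmem j)
      have h4 := (core u c N).sub_mem ((core u c N).add_mem h1 h3) h2
      rw [pow_succ', Module.End.mul_apply, adMul_apply, LinearMap.sub_apply, Module.End.mul_apply,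
        Module.End.mul_apply, LinearMap.mulLeft_apply, LinearMap.mulLeft_apply, ← mul_assoc,
        ← pow_succ']
      convert h4 using 1
      ring
  have h := key k 0
  rw [hk, LinearMap.zero_apply, zero_sub, pow_zero, one_mul, ← neg_mul] at h
  have h' := mul_mem_core ((colorSym 𝕜 c).pow_mem
    ((colorSym 𝕜 c).neg_mem (colorSym 𝕜 c).one_mem) (k + 1)) h
  refine mem_core_of_discr_pow_mul_mem ((q + 1) * k) ?_
  convert h' using 1
  rw [pow_mul, ← hF, ← mul_assoc]
  congr 1
  rw [mul_neg, ← mul_assoc, ← pow_add, ← neg_mul, show k + 1 + k = 2 * k + 1 by ring, pow_succ,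
    pow_mul]
  simp

/-- `eulProd` is diagonal, so the product of 1 - t⁻¹ `eulProd` over its nonzero eigenvalues t
occurring in f projects f to the kernel. What is removed lies in the core, since `eulProd` maps both
`N` and the core there. -/
theorem exists_sub_mem_core [CharZero 𝕜] (hl : ∀ i, l i ≠ 1) (hN : Invariant (op u c l b) N)
    {f : MvPolynomial P 𝕜} (hf : f ∈ N) : ∃ h, f - h ∈ core u c N ∧ eulProd l b h = 0 := by
  classical
  set w : (P →₀ ℕ) → 𝕜 := fun m => ((zeroPoints l).map fun i => (m i : 𝕜) + b i).prod
  have hw (m : P →₀ ℕ) (f : MvPolynomial P 𝕜) : coeff m (eulProd l b f) = w m * coeff m f :=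
    coeff_eulProd m f
  have key (s : Finset 𝕜) (hs : ∀ t ∈ s, t ≠ 0) : ∃ h, f - h ∈ core u c N ∧
      eulProd l b h ∈ core u c N ∧
      ∀ m, coeff m h = (∏ t ∈ s, (1 - t⁻¹ * w m)) * coeff m f := by
    induction s using Finset.induction_on with
    | empty =>
      exact ⟨f, by rw [sub_self]; exact zero_mem _, eulProd_mem_core_of_mem hl hN hf, by simp⟩
    | insert t s ht ih =>
      obtain ⟨h, h1, h2, h3⟩ := ih fun t ht => hs t (Finset.mem_insert_of_mem ht)
      have hsm {f : MvPolynomial P 𝕜} (hf : f ∈ core u c N) : t⁻¹ • f ∈ core u c N := by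
        rw [← algebraMap_smul (colorSym 𝕜 c)]
        exact (core u c N).smul_mem _ hf
      refine ⟨h - t⁻¹ • eulProd l b h, ?_, ?_, fun m => ?_⟩
      · rw [← sub_add]
        exact (core u c N).add_mem h1 (hsm h2)
      · rw [map_sub, map_smul]
        exact (core u c N).sub_mem h2 (hsm (eulProd_mem_core hl hN h2))
      · rw [coeff_sub, coeff_smul, hw, h3, Finset.prod_insert ht, smul_eq_mul]
        ring
  obtain ⟨h, h1, -, h3⟩ := key ((f.support.image w).erase 0) fun t ht => (Finset.mem_erase.1 ht).1
  refine ⟨h, h1, ?_⟩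
  ext m
  rw [hw, h3, coeff_zero]
  by_cases hm : coeff m f = 0
  · rw [hm, mul_zero, mul_zero]
  by_cases h0 : w m = 0
  · rw [h0, zero_mul]
  rw [Finset.prod_eq_zero (i := w m) (Finset.mem_erase.2 ⟨h0, Finset.mem_image_of_mem _
    (mem_support_iff.2 hm)⟩) (by rw [inv_mul_cancel₀ h0, sub_self]), zero_mul, mul_zero]

/-- The core has finitely many generators over the symmetric polynomials, so one exponent serves for
all its elements. -/
theorem exists_forall_discr_pow_mul_mem (N : Submodule 𝕜 (MvPolynomial P 𝕜)) :
    ∃ q, ∀ g ∈ core u c N, discr u c ^ q * g ∈ N := by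
  obtain ⟨s, hs⟩ := (isNoetherian_def.1 (isNoetherian_colorSym (𝕜 := 𝕜) (c := c))) (core u c N)
  have hE (a : ℕ) : discr u c ^ a ∈ colorSym 𝕜 c := (colorSym 𝕜 c).pow_mem discr_mem_colorSym _
  have hsub : ∀ g ∈ s, g ∈ core u c N := fun g hg => hs ▸ Submodule.subset_span hg
  choose! e he using fun g hg => mem_core.1 (hsub g hg)
  have key : ∀ g ∈ core u c N, ∀ a ∈ colorSym 𝕜 c, discr u c ^ (s.sup e) * a * g ∈ N := by
    intro g hg
    rw [← hs] at hg
    induction hg using Submodule.span_induction with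
    | zero => intro a _; rw [mul_zero]; exact N.zero_mem
    | add g g' _ _ h h' => intro a ha; rw [mul_add]; exact N.add_mem (h a ha) (h' a ha)
    | smul t g _ h =>
      intro a ha
      have := h _ ((colorSym 𝕜 c).mul_mem ha t.2)
      rwa [← mul_assoc, mul_assoc _ (t : MvPolynomial P 𝕜) g] at this
    | mem g hg =>
      intro a ha
      have hle : e g ≤ s.sup e := Finset.le_sup hg
      have := he g hg _ ((colorSym 𝕜 c).mul_mem (hE (s.sup e - e g)) ha)
      rwa [← mul_assoc, ← pow_add, Nat.add_sub_cancel' hle] at this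
  refine ⟨s.sup e, fun g hg => ?_⟩
  have := key g hg 1 (colorSym 𝕜 c).one_mem
  rwa [mul_one] at this

/-! ### The induction on the number of points -/

theorem accAbove_of_ne_one [CharZero 𝕜] (hu : u ≠ 0) (hacc : ∀ i, AccRemove u c i)
    (hl : ∀ i, l i ≠ 1) : AccAbove (op u c l b) ⊥ := by
  -- Chains may be assumed to contain the kernels of the Euler operators at points of weight 0.
  have hneg := negligible_sup (ρ := op u c l b) (K := ⊥) (zeroPoints l).toFinset
    (fun i => LinearMap.ker (eul b i)) fun i hi =>
      negligible_ker_eul i (mem_zeroPoints.1 (List.mem_toFinset.1 hi)) (hacc i)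
  have hbot : Invariant (op u c l b) ⊥ := fun _ x hx => by
    rw [Submodule.mem_bot] at hx ⊢; rw [hx, map_zero]
  refine (hneg ⊥ le_rfl hbot).2 ?_
  rw [bot_sup_eq]
  intro N hN hKN hI
  obtain ⟨m₁, hm₁⟩ := monotone_stabilizes_iff_noetherian.2
    (isNoetherian_colorSym (𝕜 := 𝕜) (c := c))
    ⟨fun m => core u c (N m), fun _ _ h => core_mono (hN h)⟩
  have hcore (m : ℕ) (hm : m₁ ≤ m) : core u c (N m) = core u c (N m₁) := (hm₁ m hm).symm
  set R := (core u c (N m₁)).restrictScalars 𝕜 with hR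
  have hIR : Invariant (op u c l b) R := fun ⟨s, g⟩ f hf => op_mem_core (hI m₁) s g hf
  obtain ⟨q, hq⟩ := exists_forall_discr_pow_mul_mem (u := u) (c := c) (N m₁)
  have hIE : Invariant (op u c l b) (multiples (discr u c ^ q)) :=
    invariant_multiples fun s g => dvd_vf_pow (discr_dvd_vf s g) q
  -- Once the cores have stabilised at `R`, the parts of the chain inside `R` are compared modulo
  -- E^q, where E is the discriminant and E^q `R` already lies in `N m₁`.
  obtain ⟨m₂, hm₂⟩ := accAbove_multiples_discr_pow (l := l) (b := b) hu hacc q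
    (fun m => (N m ⊓ R) ⊔ multiples (discr u c ^ q))
    (fun _ _ h => sup_le_sup_right (inf_le_inf_right _ (hN h)) _) (fun _ => le_sup_right)
    fun m => ((hI m).inf hIR).sup hIE
  refine ⟨max m₁ m₂, fun m hm f hf => ?_⟩
  obtain ⟨h, hfh, hh⟩ := exists_sub_mem_core hl (hI m) hf
  rw [hcore m (le_of_max_le_left hm)] at hfh
  have hh' (m : ℕ) : h ∈ N m := hKN m (ker_eulProd_le h hh)
  have hmem := hm₂ m (le_of_max_le_right hm)
    (Submodule.mem_sup_left ⟨(N m).sub_mem hf (hh' m), hfh⟩)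
  obtain ⟨g', hg', y, hy, hgy⟩ := Submodule.mem_sup.1 hmem
  obtain ⟨t, rfl⟩ := mem_multiples.1 hy
  -- The error E^q t lies in the core, and the core is saturated with respect to E, so t lies in it
  -- and E^q t in `N m₁`.
  have ht : t ∈ core u c (N m₁) := by
    refine mem_core_of_discr_pow_mul_mem q ?_
    rw [← add_sub_cancel_left g' (discr u c ^ q * t), hgy]
    exact (core u c (N m₁)).sub_mem hfh hg'.2
  rw [← sub_add_cancel f h, ← hgy]
  exact (N _).add_mem ((N _).add_mem (hN (le_max_right _ _) hg'.1)
    (hN (le_max_left _ _) (hq t ht))) (hh' _)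

theorem accAbove_of_accRemove [CharZero 𝕜] (hu : u ≠ 0) (hacc : ∀ i, AccRemove u c i)
    (l b : P → 𝕜) : AccAbove (op u c l b) ⊥ := by
  classical
  induction h : (Finset.univ.filter fun i => l i = 1).card generalizing l with
  | zero =>
    refine accAbove_of_ne_one hu hacc fun i hi => ?_
    have := Finset.card_eq_zero.1 h
    exact Finset.notMem_empty i (this ▸ Finset.mem_filter.2 ⟨Finset.mem_univ i, hi⟩)
  | succ k ih =>
    obtain ⟨i, hi⟩ := Finset.card_pos.1 (h.symm ▸ k.succ_pos :
      0 < (Finset.univ.filter fun i => l i = 1).card)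
    have hi' : l i = 1 := (Finset.mem_filter.1 hi).2
    -- Weights equal to 1 are lowered to 0 one at a time.
    have hl : l = Function.update (Function.update l i 0) i 1 := by
      rw [Function.update_idem, ← hi', Function.update_eq_self]
    rw [hl]
    refine accAbove_update_one i (Function.update_self ..) (hacc i) (ih _ ?_)
    have he : (Finset.univ.filter fun j => Function.update l i 0 j = 1) =
        (Finset.univ.filter fun j => l j = 1).erase i := by
      ext j
      rcases eq_or_ne j i with rfl | hj
      · simp
      · simp [hj]
    rw [he, Finset.card_erase_of_mem hi, h, Nat.add_sub_cancel]

/-- The representations on the polynomial tensor fields at finitely many points satisfy the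
ascending chain condition. -/
theorem accAbove_bot [CharZero 𝕜] (hu : u ≠ 0) (c : P → C) (l b : P → 𝕜) :
    AccAbove (op u c l b) ⊥ := by
  have key : ∀ (k : ℕ) (P : Type _) [Fintype P] [DecidableEq P], Fintype.card P = k →
      ∀ (c : P → C) (l b : P → 𝕜), AccAbove (op u c l b) ⊥ := by
    intro k
    induction k with
    | zero =>
      intro P _ _ hP c l b
      exact accAbove_of_accRemove hu (fun i => ((Fintype.card_eq_zero_iff.1 hP).false i).elim) l b
    | succ k ih =>
      intro P _ _ hP c l b
      refine accAbove_of_accRemove hu (fun i l' b' => ih _ ?_ _ l' b') l b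
      rw [Fintype.card_subtype_compl, Fintype.card_subtype_eq, hP, Nat.add_sub_cancel]
  exact key _ P rfl c l b

end PointRep

namespace PointRep

open MvPolynomial InvariantChain

set_option linter.unusedSectionVars false

open PolyField PolyField.TensorField

/-! ### Tensor fields -/

section TensorFields

variable {𝕜 : Type*} [Field 𝕜] {n r : ℕ}

/-- The vector field `d⁻¹ xⱼ G(xⱼᵈ) ∂ⱼ`. -/
noncomputable def powField (d : ℕ) (j : Fin n) (G : Polynomial 𝕜) : W 𝕜 n :=
  ((d : 𝕜)⁻¹ • (X j * Polynomial.aeval (X j ^ d) G) : MvPolynomial (Fin n) 𝕜) • pderiv j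

theorem powField_apply (d : ℕ) (j : Fin n) (G : Polynomial 𝕜) (f : MvPolynomial (Fin n) 𝕜) :
    powField d j G f = (d : 𝕜)⁻¹ • (Polynomial.aeval (X j ^ d) G * (X j * pderiv j f)) := by
  rw [powField, Derivation.smul_apply, smul_eq_mul, smul_mul_assoc]
  congr 1
  ring

theorem pderiv_powField_X [CharZero 𝕜] {d : ℕ} (hd : d ≠ 0) (i j k : Fin n) (G : Polynomial 𝕜) :
    pderiv i (powField d j G (X k)) = if i = j ∧ k = j then
      (d : 𝕜)⁻¹ • Polynomial.aeval (X j ^ d) G +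
        Polynomial.aeval (X j ^ d) (Polynomial.X * Polynomial.derivative G) else 0 := by
  have hd' : (d : 𝕜) ≠ 0 := Nat.cast_ne_zero.2 hd
  rw [powField_apply, pderiv_X, Pi.single_apply]
  by_cases hk : k = j
  swap
  · simp [hk]
  subst hk
  by_cases hi : i = k
  swap
  · have h0 : pderiv i (X k : MvPolynomial (Fin n) 𝕜) = 0 := pderiv_X_of_ne (Ne.symm hi)
    simp [hi, Derivation.leibniz, Derivation.map_aeval, Derivation.leibniz_pow, h0]
  subst hi
  rw [if_pos rfl, if_pos ⟨rfl, rfl⟩, mul_one, Derivation.map_smul, Derivation.leibniz,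
    pderiv_X_self, Derivation.map_aeval, Derivation.leibniz_pow, pderiv_X_self]
  obtain ⟨e, rfl⟩ : ∃ e, d = e + 1 := Nat.exists_eq_succ_of_ne_zero hd
  have h : (MvPolynomial.C ((e + 1 : ℕ) : 𝕜)⁻¹ : MvPolynomial (Fin n) 𝕜) *
      ((e + 1 : ℕ) : MvPolynomial (Fin n) 𝕜) = 1 := by
    rw [← map_natCast (MvPolynomial.C : 𝕜 →+* MvPolynomial (Fin n) 𝕜), ← map_mul,
      inv_mul_cancel₀ hd', map_one]
  simp only [smul_eq_mul, Nat.add_sub_cancel, mul_one, map_mul, Polynomial.aeval_X, nsmul_eq_mul,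
    smul_eq_C_mul]
  linear_combination
    (X i * Polynomial.aeval (X i ^ (e + 1)) (Polynomial.derivative G) * X i ^ e) * h

section Factor

variable {V : Type*} [AddCommGroup V] [Module 𝕜 V]

/-- The tensor fields with values in the line of `v`. -/
noncomputable def mkHom (v : V) : MvPolynomial (Fin n) 𝕜 →ₗ[𝕜] TensorField 𝕜 n V where
  toFun f := mk f v
  map_add' f g := TensorProduct.add_tmul f g v
  map_smul' t f := TensorProduct.smul_tmul' t f v

theorem mk_smul_right (f : MvPolynomial (Fin n) 𝕜) (t : 𝕜) (v : V) :
    mk f (t • v) = mkHom v (t • f) := TensorProduct.tmul_smul t f v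

variable [LieRingModule (gl 𝕜 n) V] [LieModule 𝕜 (gl 𝕜 n) V]

/-- In z = xⱼᵈ the field is z G(z) ∂_z, and only E_jj contributes. The exponent d m + a yields the
factor m + a/d in front of G, and the Jacobian entry yields t (G/d + z G'); hence b = (a + t)/d and
l = t. -/
theorem powField_lie_mk [CharZero 𝕜] {d : ℕ} (hd : d ≠ 0) (j : Fin n) (G : Polynomial 𝕜)
    (m a : Fin n →₀ ℕ) {v : V} {t : 𝕜} (hv : ⁅(Matrix.single j j 1 : gl 𝕜 n), v⁆ = t • v) :
    ⁅powField d j G, mk (monomial (d • m + a) (1 : 𝕜)) v⁆ =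
      mkHom v (Polynomial.aeval (X j ^ d) (pointPot t ((d : 𝕜)⁻¹ * (a j + t)) G +
        Polynomial.C (m j : 𝕜) * G) * monomial (d • m + a) (1 : 𝕜)) := by
  have hd' : (d : 𝕜) ≠ 0 := Nat.cast_ne_zero.2 hd
  rw [lie_mk, Finset.sum_eq_single j, Finset.sum_eq_single j, pderiv_powField_X hd,
    if_pos ⟨rfl, rfl⟩, hv, mk_smul_right, powField_apply, X_mul_pderiv_monomial]
  · change mkHom v _ + mkHom v _ = _
    rw [← map_add]
    congr 1
    simp only [Finsupp.add_apply, Finsupp.smul_apply, smul_eq_mul, pointPot, map_add, map_mul,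
      Polynomial.aeval_C, Polynomial.aeval_X, ← Nat.cast_smul_eq_nsmul 𝕜, smul_eq_C_mul,
      algebraMap_eq]
    have h : (MvPolynomial.C (d : 𝕜)⁻¹ : MvPolynomial (Fin n) 𝕜) * MvPolynomial.C (d : 𝕜) = 1 := by
      rw [← map_mul, inv_mul_cancel₀ hd', map_one]
    push_cast
    simp only [map_add, map_mul]
    linear_combination (Polynomial.aeval (X j ^ d) G * MvPolynomial.C (m j : 𝕜) *
      monomial (d • m + a) (1 : 𝕜)) * h
  · intro k _ hk
    rw [pderiv_powField_X hd, if_neg fun h => hk h.2, zero_mul]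
    exact map_zero (mkHom _)
  · simp
  · intro i _ hi
    refine Finset.sum_eq_zero fun k _ => ?_
    rw [pderiv_powField_X hd, if_neg fun h => hi h.1, zero_mul]
    exact map_zero (mkHom _)
  · simp

/-- A simultaneous eigenvector of the diagonal matrices. -/
def IsWeightVector (v : V) (μ : Fin n → 𝕜) : Prop :=
  ∀ j, ⁅(Matrix.single j j 1 : gl 𝕜 n), v⁆ = μ j • v

theorem IsWeightVector.lie_single {v : V} {μ : Fin n → 𝕜} (hv : IsWeightVector v μ)
    (i k : Fin n) : IsWeightVector ⁅(Matrix.single i k 1 : gl 𝕜 n), v⁆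
      fun j => μ j + (if j = i then 1 else 0) - if j = k then 1 else 0 := by
  intro j
  have h : ⁅(Matrix.single j j 1 : gl 𝕜 n), (Matrix.single i k 1 : gl 𝕜 n)⁆ =
      ((if j = i then 1 else 0) - (if j = k then 1 else 0) : 𝕜) • Matrix.single i k 1 := by
    rw [Ring.lie_def, sub_smul]
    congr 1
    · split_ifs with h
      · subst h; simp
      · simp [h]
    · split_ifs with h
      · subst h; simp
      · simp [Ne.symm h]
  rw [leibniz_lie, hv j, h, smul_lie, lie_smul, ← add_smul]
  congr 1
  ring

/-- Matrix units shift weights, so the span is a submodule; it contains the highest weight vector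
and is everything by irreducibility. -/
theorem span_weightVectors {wt : Fin n → 𝕜} (hV : IsIrrepOfHighestWeight 𝕜 n V wt) :
    Submodule.span 𝕜 {v : V | ∃ μ, IsWeightVector (𝕜 := 𝕜) (n := n) v μ} = ⊤ := by
  set S := Submodule.span 𝕜 {v : V | ∃ μ, IsWeightVector (𝕜 := 𝕜) (n := n) v μ} with hS
  have hsingle (i k : Fin n) : ∀ v ∈ S, ⁅(Matrix.single i k 1 : gl 𝕜 n), v⁆ ∈ S := by
    intro v hv
    induction hv using Submodule.span_induction with
    | zero => rw [lie_zero]; exact S.zero_mem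
    | add x y _ _ hx hy => rw [lie_add]; exact S.add_mem hx hy
    | smul t x _ hx => rw [lie_smul]; exact S.smul_mem t hx
    | mem x hx =>
      obtain ⟨μ, hμ⟩ := hx
      exact Submodule.subset_span ⟨_, hμ.lie_single i k⟩
  let N : LieSubmodule 𝕜 (gl 𝕜 n) V :=
    { S with
      lie_mem := by
        intro A v hv
        change ⁅A, v⁆ ∈ S
        rw [Matrix.matrix_eq_sum_single A, ← LieModule.toEnd_apply_apply 𝕜 (gl 𝕜 n) V, map_sum,
          LinearMap.sum_apply]
        refine S.sum_mem fun i _ => ?_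
        rw [map_sum, LinearMap.sum_apply]
        refine S.sum_mem fun k _ => ?_
        rw [← mul_one (A i k), ← smul_eq_mul, ← Matrix.smul_single, map_smul, LinearMap.smul_apply]
        exact S.smul_mem _ (hsingle i k v hv) }
  have hirr := hV.irreducible
  obtain ⟨v, hv0, -, hv⟩ := hV.exists_highestWeightVector
  have hvN : v ∈ N := Submodule.subset_span ⟨wt, hv⟩
  rcases IsSimpleOrder.eq_bot_or_eq_top N with h | h
  · rw [h, LieSubmodule.mem_bot] at hvN
    exact absurd hvN hv0
  · have : (N : Submodule 𝕜 V) = ⊤ := by rw [h]; rfl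
    exact this

theorem exists_weightBasis {wt : Fin n → 𝕜} (hV : IsIrrepOfHighestWeight 𝕜 n V wt) :
    ∃ (k : ℕ) (e : Module.Basis (Fin k) 𝕜 V) (μ : Fin k → Fin n → 𝕜),
      ∀ i, IsWeightVector (e i) (μ i) := by
  have := hV.finiteDimensional
  have hs := (span_weightVectors hV).ge
  have := Module.Finite.finite_basis (Module.Basis.ofSpan hs)
  set e := (Module.Basis.ofSpan hs).reindex (Finite.equivFin _)
  have he (i) : ∃ μ, IsWeightVector (𝕜 := 𝕜) (n := n) (e i) μ := by
    refine Module.Basis.ofSpan_subset hs ?_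
    rw [Module.Basis.reindex_apply]
    exact Set.mem_range_self _
  choose μ hμ using he
  exact ⟨_, e, μ, hμ⟩

end Factor

end TensorFields

/-! ### Tensor products of tensor fields as representations at points -/

section TensorProducts

variable {𝕜 : Type*} [Field 𝕜] {n r : ℕ} {V : Fin r → Type*} [∀ s, AddCommGroup (V s)]
  [∀ s, Module 𝕜 (V s)]

/-- The monomial at the point `s` that belongs to the exponent `M`. -/
noncomputable def slotMonomial (𝕜 : Type*) [Field 𝕜] (d : ℕ) (a : Fin r → Fin n →₀ ℕ)
    (M : Fin r × Fin n →₀ ℕ) (s : Fin r) : MvPolynomial (Fin n) 𝕜 :=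
  monomial (d • M.curry s + a s) 1

/-- The map from polynomials at `r` points to tensor products of tensor fields that sends a monomial
with exponents `m` to the tensor product of the fields `x ^ (d m + a) v`. -/
noncomputable def toTensor (d : ℕ) (a : Fin r → Fin n →₀ ℕ) (v : ∀ s, V s) :
    MvPolynomial (Fin r × Fin n) 𝕜 →ₗ[𝕜] ⨂[𝕜] s, TensorField 𝕜 n (V s) :=
  (basisMonomials (Fin r × Fin n) 𝕜).constr 𝕜 fun M =>
    PiTensorProduct.tprod 𝕜 fun s => mkHom (v s) (slotMonomial 𝕜 d a M s)

variable {d : ℕ} {a : Fin r → Fin n →₀ ℕ} {v : ∀ s, V s}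

theorem toTensor_monomial (M : Fin r × Fin n →₀ ℕ) : toTensor d a v (monomial M (1 : 𝕜)) =
    PiTensorProduct.tprod 𝕜 fun s => mkHom (v s) (slotMonomial 𝕜 d a M s) := by
  have := (basisMonomials (Fin r × Fin n) 𝕜).constr_basis 𝕜 (fun M =>
    PiTensorProduct.tprod 𝕜 fun s => mkHom (v s) (slotMonomial 𝕜 d a M s)) M
  rwa [coe_basisMonomials] at this

theorem toTensor_aeval_mul (p : Fin r × Fin n) (Q : Polynomial 𝕜) (M : Fin r × Fin n →₀ ℕ) :
    toTensor d a v (Polynomial.aeval (X p) Q * monomial M (1 : 𝕜)) =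
      PiTensorProduct.tprod 𝕜 (Function.update
        (fun s => mkHom (v s) (slotMonomial 𝕜 d a M s)) p.1
        (mkHom (v p.1) (Polynomial.aeval (X p.2 ^ d) Q * slotMonomial 𝕜 d a M p.1))) := by
  induction Q using Polynomial.induction_on' with
  | add Q Q' h h' =>
    rw [map_add, map_add, add_mul, add_mul, map_add, map_add, MultilinearMap.map_update_add, h, h']
  | monomial k t =>
    rw [Polynomial.aeval_monomial, Polynomial.aeval_monomial, ← Algebra.smul_def,
      ← Algebra.smul_def, smul_mul_assoc, smul_mul_assoc, map_smul, map_smul,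
      MultilinearMap.map_update_smul, X_pow_eq_monomial, monomial_mul, one_mul, toTensor_monomial]
    congr 2
    funext s
    obtain ⟨s', j⟩ := p
    have hcurry : (Finsupp.single (s', j) k + M).curry s =
        Finsupp.single s' (Finsupp.single j k) s + M.curry s := by
      rw [← Finsupp.curry_single (s', j) k]
      exact Finsupp.ext fun _ => rfl
    rcases eq_or_ne s s' with rfl | hs
    · rw [Function.update_self]
      congr 1
      rw [slotMonomial, slotMonomial, hcurry, Finsupp.single_eq_same, ← pow_mul,
        X_pow_eq_monomial, monomial_mul, one_mul]
      congr 1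
      rw [smul_add, add_assoc, Finsupp.smul_single, smul_eq_mul]
    · rw [Function.update_of_ne hs, slotMonomial, slotMonomial, hcurry,
        Finsupp.single_eq_of_ne hs, zero_add]

variable [∀ s, LieRingModule (gl 𝕜 n) (V s)] [∀ s, LieModule 𝕜 (gl 𝕜 n) (V s)]

/-- The points are the pairs (s, j) and the colour is j, because the Leibniz rule lets a field in xⱼ
act on the j-th variable of every tensor factor. -/
theorem powField_lie_toTensor [CharZero 𝕜] (hd : d ≠ 0) {μ : Fin r → Fin n → 𝕜}
    (hv : ∀ s, IsWeightVector (v s) (μ s)) (u : Polynomial 𝕜) (j : Fin n) (g : Polynomial 𝕜)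
    (f : MvPolynomial (Fin r × Fin n) 𝕜) :
    ⁅powField d j (test u g), toTensor d a v f⁆ = toTensor d a v (op u Prod.snd
      (fun p => μ p.1 p.2) (fun p => (d : 𝕜)⁻¹ * (a p.1 p.2 + μ p.1 p.2)) (j, g) f) := by
  set ρ := op u (P := Fin r × Fin n) Prod.snd
      (fun p => μ p.1 p.2) (fun p => (d : 𝕜)⁻¹ * (a p.1 p.2 + μ p.1 p.2)) (j, g) with hρ
  have h : (LieModule.toEnd 𝕜 (W 𝕜 n) (⨂[𝕜] s, TensorField 𝕜 n (V s))
      (powField d j (test u g))) ∘ₗ toTensor d a v = toTensor d a v ∘ₗ ρ := by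
    refine (basisMonomials (Fin r × Fin n) 𝕜).ext fun M => ?_
    rw [coe_basisMonomials, LinearMap.comp_apply, LinearMap.comp_apply, toTensor_monomial,
      LieModule.toEnd_apply_apply, LieTensor.lie_tprod, hρ, op_eq_sum, map_sum,
      Fintype.sum_prod_type]
    refine Finset.sum_congr rfl fun s _ => ?_
    rw [Finset.sum_eq_single j]
    · rw [if_pos rfl, X_mul_pderiv_monomial]
      have e : Polynomial.aeval (X (s, j)) (test u g) * M (s, j) • monomial M (1 : 𝕜) +
          Polynomial.aeval (X (s, j)) (pointPot (μ s j) ((d : 𝕜)⁻¹ * (a s j + μ s j)) (test u g)) *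
            monomial M 1 = Polynomial.aeval (X (s, j)) (pointPot (μ s j)
              ((d : 𝕜)⁻¹ * (a s j + μ s j)) (test u g) +
              Polynomial.C (M (s, j) : 𝕜) * test u g) * monomial M 1 := by
        rw [← Nat.cast_smul_eq_nsmul 𝕜, smul_eq_C_mul, map_add, map_mul, Polynomial.aeval_C,
          algebraMap_eq]
        ring
      rw [e, toTensor_aeval_mul]
      congr 2
      exact powField_lie_mk hd j (test u g) (M.curry s) (a s) (hv s j)
    · intro k _ hk
      rw [if_neg hk, map_zero]
    · simp
  exact DFunLike.congr_fun h f

theorem isLieNoetherian_of_powField_mem [CharZero 𝕜] (hd : d ≠ 0) {u : Polynomial 𝕜} (hu : u ≠ 0)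
    {wt : Fin r → Fin n → 𝕜} (hV : ∀ s, IsIrrepOfHighestWeight 𝕜 n (V s) (wt s))
    (L : LieSubalgebra 𝕜 (W 𝕜 n)) (hL : ∀ j g, powField d j (test u g) ∈ L) :
    IsLieNoetherian 𝕜 L (⨂[𝕜] s, TensorField 𝕜 n (V s)) := by
  choose k e μ he using fun s => exists_weightBasis (hV s)
  set ρ : Fin n × Polynomial 𝕜 → Module.End 𝕜 (⨂[𝕜] s, TensorField 𝕜 n (V s)) := fun x =>
    LieModule.toEnd 𝕜 (W 𝕜 n) _ (powField d x.1 (test u x.2)) with hρ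
  refine isLieNoetherian_of_accAbove (ρ := ρ) (fun x => (⟨_, hL x.1 x.2⟩ : L))
    (fun x t => rfl) ?_
  -- One image for each choice of weight basis vectors and of exponent residues mod d: finitely
  -- many, and together they contain a basis of pure tensors.
  set A : ((∀ s, Fin (k s)) × (Fin r → Fin n → Fin d)) →
      Submodule 𝕜 (⨂[𝕜] s, TensorField 𝕜 n (V s)) := fun x => LinearMap.range
    (toTensor d (fun s => Finsupp.equivFunOnFinite.symm fun j => (x.2 s j : ℕ))
      fun s => e s (x.1 s)) with hA
  have hneg := negligible_sup (ρ := ρ) (K := ⊥) Finset.univ A fun x _ =>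
    negligible_range _ (fun ⟨j, g⟩ f => by
      rw [Submodule.mem_bot, sub_eq_zero]
      exact powField_lie_toTensor hd (fun s => he s (x.1 s)) u j g f) (accAbove_bot hu _ _ _)
  have hbot : Invariant ρ ⊥ := fun _ x hx => by
    rw [Submodule.mem_bot] at hx ⊢; rw [hx, map_zero]
  refine (hneg ⊥ le_rfl hbot).2 ?_
  have htop : Finset.univ.sup A = ⊤ := by
    set K := Finset.univ.sup A
    have hK : K.mkQ.compMultilinearMap (PiTensorProduct.tprod 𝕜) = 0 := by
      let B (s : Fin r) : Module.Basis ((Fin n →₀ ℕ) × Fin (k s)) 𝕜 (TensorField 𝕜 n (V s)) :=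
        (basisMonomials (Fin n) 𝕜).tensorProduct (e s)
      refine Module.Basis.ext_multilinear B fun w => ?_
      have hB (s : Fin r) : B s (w s) = mkHom (e s (w s).2) (monomial (w s).1 1) := by
        change (basisMonomials (Fin n) 𝕜).tensorProduct (e s) (w s) = _
        rw [Module.Basis.tensorProduct_apply', coe_basisMonomials]
        rfl
      simp only [hB, LinearMap.compMultilinearMap_apply, zero_apply,
        Submodule.mkQ_apply, Submodule.Quotient.mk_eq_zero]
      refine Finset.le_sup (f := A) (Finset.mem_univ (fun s => (w s).2, fun s j =>
        ⟨(w s).1 j % d, Nat.mod_lt _ (Nat.pos_of_ne_zero hd)⟩)) ?_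
      refine ⟨monomial (Finsupp.equivFunOnFinite.symm fun p => (w p.1).1 p.2 / d) 1, ?_⟩
      rw [toTensor_monomial]
      congr 1
      funext s
      exact congrArg (mkHom (e s (w s).2)) (congrArg (fun E => monomial E (1 : 𝕜))
        (Finsupp.ext fun j => Nat.div_add_mod _ _))
    rw [← Submodule.ker_mkQ K, LinearMap.ker_eq_top]
    exact PiTensorProduct.ext hK
  rw [htop, bot_sup_eq]
  exact accAbove_top

end TensorProducts

/-! ### Finding the required fields in the given subalgebras -/

section FiniteCodimension

variable {𝕜 : Type*} [Field 𝕜]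

/-- The bracket `f g' - g f'` of the vector fields `f ∂` and `g ∂` on the line. -/
noncomputable def lineBracket : Polynomial 𝕜 →ₗ[𝕜] Polynomial 𝕜 →ₗ[𝕜] Polynomial 𝕜 :=
  LinearMap.mk₂ 𝕜 (fun f g => f * Polynomial.derivative g - g * Polynomial.derivative f)
    (fun f f' g => by rw [Polynomial.derivative_add]; ring)
    (fun t f g => by simp [smul_sub])
    (fun f g g' => by rw [Polynomial.derivative_add]; ring)
    (fun t f g => by simp [smul_sub])

theorem lineBracket_apply (f g : Polynomial 𝕜) :
    lineBracket f g = f * Polynomial.derivative g - g * Polynomial.derivative f := rfl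

theorem surjective_derivative [CharZero 𝕜] (g : Polynomial 𝕜) :
    ∃ h, Polynomial.derivative h = g := by
  induction g using Polynomial.induction_on' with
  | add p q hp hq =>
    obtain ⟨h, rfl⟩ := hp
    obtain ⟨h', rfl⟩ := hq
    exact ⟨h + h', Polynomial.derivative_add⟩
  | monomial k t =>
    refine ⟨Polynomial.monomial (k + 1) (t * ((k : 𝕜) + 1)⁻¹), ?_⟩
    rw [Polynomial.derivative_monomial, Nat.add_sub_cancel, mul_assoc]
    push_cast
    rw [inv_mul_cancel₀ (Nat.cast_add_one_ne_zero k), mul_one]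

/-- A subalgebra of finite codimension in the vector fields on the line contains all multiples of a
nonzero square. -/
theorem exists_sq_mul_mem [CharZero 𝕜] (A : Submodule 𝕜 (Polynomial 𝕜))
    [FiniteDimensional 𝕜 (Polynomial 𝕜 ⧸ A)]
    (hA : ∀ f ∈ A, ∀ g ∈ A, lineBracket f g ∈ A) : ∃ f ≠ 0, ∀ g, f ^ 2 * g ∈ A := by
  obtain ⟨B, hB⟩ := Submodule.exists_isCompl A
  have : FiniteDimensional 𝕜 B :=
    Module.Finite.equiv (Submodule.quotientEquivOfIsCompl A B hB)
  set Ψ : Polynomial 𝕜 →ₗ[𝕜] B →ₗ[𝕜] Polynomial 𝕜 ⧸ A :=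
    (lineBracket.compr₂ A.mkQ).domRestrict₂ B with hΨ
  -- f ∈ A and [f, B] ⊆ A, with B a finite-dimensional complement of A, are finitely many linear
  -- conditions on an infinite-dimensional space.
  have hker : LinearMap.ker (A.mkQ.prod Ψ) ≠ ⊥ := fun h =>
    Polynomial.not_finite (R := 𝕜) (Module.Finite.of_injective _ (LinearMap.ker_eq_bot.1 h))
  obtain ⟨f, hf, hf0⟩ := Submodule.exists_mem_ne_zero_of_ne_bot hker
  rw [LinearMap.ker_prod, Submodule.mem_inf, Submodule.ker_mkQ, LinearMap.mem_ker] at hf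
  obtain ⟨hf1, hf2⟩ := hf
  have hf2 (g : Polynomial 𝕜) (hg : g ∈ B) : lineBracket f g ∈ A := by
    have h : A.mkQ (lineBracket f g) = 0 := DFunLike.congr_fun hf2 (⟨g, hg⟩ : B)
    rwa [Submodule.mkQ_apply, Submodule.Quotient.mk_eq_zero] at h
  have hf3 (g : Polynomial 𝕜) : lineBracket f g ∈ A := by
    obtain ⟨x, hx, y, hy, rfl⟩ := Submodule.mem_sup.1 (hB.sup_eq_top ▸ Submodule.mem_top (x := g))
    rw [map_add]
    exact A.add_mem (hA f hf1 x hx) (hf2 y hy)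
  refine ⟨f, hf0, fun g => ?_⟩
  obtain ⟨h, rfl⟩ := surjective_derivative g
  -- [f, h f] = f² h', and every polynomial is a derivative in characteristic 0.
  have := hf3 (h * f)
  rw [lineBracket_apply, Polynomial.derivative_mul] at this
  convert this using 1
  ring

variable {n : ℕ}

/-- The vector field `h(xⱼ) ∂ⱼ`. -/
noncomputable def lineField (j : Fin n) : Polynomial 𝕜 →ₗ[𝕜] W 𝕜 n where
  toFun h := (Polynomial.aeval (X j) h : MvPolynomial (Fin n) 𝕜) • pderiv j
  map_add' h h' := by rw [map_add, add_smul]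
  map_smul' t h := by rw [map_smul, smul_assoc]; rfl

theorem lineField_apply (j : Fin n) (h : Polynomial 𝕜) (f : MvPolynomial (Fin n) 𝕜) :
    lineField j h f = Polynomial.aeval (X j) h * pderiv j f := rfl

theorem lineField_lie (j : Fin n) (h h' : Polynomial 𝕜) :
    ⁅lineField j h, lineField j h'⁆ = lineField j (lineBracket h h') := by
  refine MvPolynomial.derivation_ext fun i => ?_
  rw [Derivation.commutator_apply, lineField_apply, lineField_apply, lineField_apply,
    lineField_apply, lineField_apply, lineBracket_apply]
  rcases eq_or_ne i j with rfl | hi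
  · simp [Derivation.map_aeval]
  · simp [pderiv_X_of_ne hi]

theorem powField_one (j : Fin n) (G : Polynomial 𝕜) :
    powField 1 j G = lineField j (Polynomial.X * G) := by
  refine MvPolynomial.derivation_ext fun i => ?_
  rw [powField_apply, lineField_apply, Nat.cast_one, inv_one, one_smul, pow_one, map_mul,
    Polynomial.aeval_X]
  ring

/-- The fields h(xⱼ) ∂ⱼ meet the subalgebra in finite codimension for each j, and the product of the
polynomials found for the single j serves for all of them. -/
theorem exists_powField_mem_of_finiteDimensional [CharZero 𝕜] (g : LieSubalgebra 𝕜 (W 𝕜 n))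
    (hg : FiniteDimensional 𝕜 (W 𝕜 n ⧸ g.toSubmodule)) :
    ∃ u : Polynomial 𝕜, u ≠ 0 ∧ ∀ j h, powField 1 j (test u h) ∈ g := by
  have key (j : Fin n) : ∃ f : Polynomial 𝕜, f ≠ 0 ∧ ∀ h, lineField j (f ^ 2 * h) ∈ g := by
    have : FiniteDimensional 𝕜 (Polynomial 𝕜 ⧸ g.toSubmodule.comap (lineField j)) := by
      refine Module.Finite.of_injective (Submodule.mapQ _ g.toSubmodule (lineField j) le_rfl) ?_
      rw [← LinearMap.ker_eq_bot, Submodule.ker_mapQ, Submodule.mkQ_map_self]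
    exact exists_sq_mul_mem (g.toSubmodule.comap (lineField j)) fun f hf f' hf' => by
      rw [Submodule.mem_comap, ← lineField_lie]
      exact g.lie_mem hf hf'
  choose f hf0 hf using key
  refine ⟨∏ j, f j, Finset.prod_ne_zero_iff.2 fun j _ => hf0 j, fun j h => ?_⟩
  rw [powField_one]
  obtain ⟨q, hq⟩ := Finset.dvd_prod_of_mem f (Finset.mem_univ j)
  convert hf j (Polynomial.X ^ 2 * q ^ 2 * h) using 2
  rw [test, hq]
  ring

/-- For u = 1 the test function of z^k is z^(k+1), so the exponents start at 1, as `coordL`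
requires. -/
theorem powField_mem_coordL {d : ℕ} (j : Fin n) (g : Polynomial 𝕜) :
    powField d j (test 1 g) ∈ coordL 𝕜 n d := by
  induction g using Polynomial.induction_on' with
  | add p q hp hq =>
    have e : (powField d j (test 1 (p + q)) : W 𝕜 n) =
        powField d j (test 1 p) + powField d j (test 1 q) := by
      refine MvPolynomial.derivation_ext fun i => ?_
      rw [Derivation.add_apply, powField_apply, powField_apply, powField_apply, ← smul_add,
        ← add_mul, ← map_add, test, test, test, mul_add]
    rw [e]
    exact (coordL 𝕜 n d).add_mem hp hq
  | monomial k t =>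
    have e : (powField d j (test 1 (Polynomial.monomial k t)) : W 𝕜 n) =
        ((d : 𝕜)⁻¹ * t) • coordField 𝕜 j (d * (k + 1)) := by
      refine MvPolynomial.derivation_ext fun i => ?_
      rw [powField_apply, Derivation.smul_apply, coordField, Derivation.smul_apply, test,
        one_pow, mul_one, map_mul, Polynomial.aeval_X, Polynomial.aeval_monomial, mul_smul,
        smul_eq_mul, algebraMap_eq, smul_eq_C_mul (_ * _) t]
      congr 1
      ring
    rw [e]
    exact (coordL 𝕜 n d).smul_mem _ (Submodule.subset_span ⟨j, k + 1, by omega, rfl⟩)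

theorem coordL_le_L {d : ℕ} : coordL 𝕜 n d ≤ L 𝕜 n d := by
  have h : (coordL 𝕜 n d).toSubmodule ≤ (L 𝕜 n d).toSubmodule := by
    refine Submodule.span_le.2 ?_
    rintro _ ⟨s, k, hk, rfl⟩ j m hm
    rw [coordField, Derivation.smul_apply, smul_eq_mul, pderiv_X, Pi.single_apply] at hm
    split_ifs at hm
    · rw [mul_one, X_pow_eq_monomial] at hm
      have := Finset.mem_singleton.1 (support_monomial_subset hm)
      rw [this, Finsupp.degree_single]
      have := Nat.mul_le_mul_left d hk
      omega
    · simp at hm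
  exact h

end FiniteCodimension

end PointRep

theorem mainTheorem1 {𝕜 : Type*} [Field 𝕜] [CharZero 𝕜] (n r : ℕ)
    (wt : Fin r → Fin n → 𝕜)
    (V : Fin r → Type*) [∀ s, AddCommGroup (V s)] [∀ s, Module 𝕜 (V s)]
    [∀ s, LieRingModule (PolyField.gl 𝕜 n) (V s)] [∀ s, LieModule 𝕜 (PolyField.gl 𝕜 n) (V s)]
    (hV : ∀ s, PolyField.IsIrrepOfHighestWeight 𝕜 n (V s) (wt s)) :
    (∀ d : ℕ, 1 ≤ d → IsLieNoetherian 𝕜 (PolyField.coordL 𝕜 n d)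
      (⨂[𝕜] s, PolyField.TensorField 𝕜 n (V s))) ∧
    (∀ d : ℕ, 1 ≤ d → IsLieNoetherian 𝕜 (PolyField.L 𝕜 n d)
      (⨂[𝕜] s, PolyField.TensorField 𝕜 n (V s))) ∧
    (∀ g : LieSubalgebra 𝕜 (PolyField.W 𝕜 n),
      FiniteDimensional 𝕜 (PolyField.W 𝕜 n ⧸ g.toSubmodule) →
      IsLieNoetherian 𝕜 g (⨂[𝕜] s, PolyField.TensorField 𝕜 n (V s))) := by
  refine ⟨fun d hd => ?_, fun d hd => ?_, fun g hg => ?_⟩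
  · exact PointRep.isLieNoetherian_of_powField_mem (Nat.one_le_iff_ne_zero.1 hd) one_ne_zero hV _
      fun j g => PointRep.powField_mem_coordL j g
  · exact PointRep.isLieNoetherian_of_powField_mem (Nat.one_le_iff_ne_zero.1 hd) one_ne_zero hV _
      fun j g => PointRep.coordL_le_L (PointRep.powField_mem_coordL j g)
  · obtain ⟨u, hu, hmem⟩ := PointRep.exists_powField_mem_of_finiteDimensional g hg
    exact PointRep.isLieNoetherian_of_powField_mem one_ne_zero hu hV g hmem
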